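/- A \emph{planar tree} is a locally finite rooted tree, considered up to isomorphism, in which the offspring of each vertex are linearly ordered and whose root has exactly one child. Let $\mathcal T$ be the set of all (finite or infinite) planar trees. For $T\in\mathcal T$ let $|T|\in\{1,2,\dots\}\cup\{\infty\}$ be its number of edges, let $D_r(T)$ be the set of vertices at graph distance $r$ from the root, and let $B_r(T)$ be the subtree spanned by the vertices at distance at most $r$ from the root; the height $h(T)$ is the maximal distance of a vertex from the root. Equip $\mathcal T$ with the metric $$\mathrm{dist}(T,T')=\inf\Big\{\tfrac1r \;\Big|\; r\in\{1,2,\dots\},\ B_r(T)=B_r(T')\Big\}$$ and its Borel $\sigma$-algebra, and write $\mathcal B_a(T_0)=\{T\in\mathcal T\mid \mathrm{dist}(T,T_0)\le a\}$. For $\mu\in\mathbb R$ and $N\ge 1$ let $\nu_N^{(\mu)}$ be the probability measure on $\mathcal T$ supported on the finite set $\mathcal T_N=\{T\in\mathcal T\mid |T|=N\}$ with $$\nu_N^{(\mu)}(\{T\})=\frac{e^{-\mu h(T)}}{Z_N^{(\mu)}}\quad (T\in\mathcal T_N),\qquad Z_N^{(\mu)}=\sum_{T\in\mathcal T_N}e^{-\mu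 h(T)}.$$ \textbf{Theorem.} For every $\mu>0$ the sequence $(\nu_N^{(\mu)})_{N\ge1}$ converges weakly, as $N\to\infty$, to a Borel probability measure $\nu^{(\mu)}$ on $\mathcal T$. This measure satisfies $$\nu^{(\mu)}\big(\mathcal B_{1/r}(T_0)\big)=\frac{e^{-\mu(r-1)}}{4^{|T_0|}}\,2^{K+1}\sum_{R=1}^{K}\binom KR\frac{\mu^{R-1}}{(R-1)!},\qquad K=|D_r(T_0)|,$$ for every finite tree $T_0\in\mathcal T$ of height $r\ge1$, and it is the only Borel probability measure on $\mathcal T$ with this property. -/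

import Mathlib

open MeasureTheory Filter Topology

/-- A locally finite rooted planar tree, in the usual (Ulam–Harris–Neveu) encoding of isomorphism
classes: a vertex at distance `r` from the root is the word of length `r` whose letters say which
child (numbered `0, 1, 2, …` from left to right) is taken at each step.  So the root is `[]`, the
parent of `u ++ [n]` is `u`, and the vertices at distance `r` are ordered lexicographically.
The root has exactly one child, `[0]`. -/
@[ext]
structure PlanarTree where
  /-- the vertex set -/
  verts : Set (List ℕ)
  root_mem : [] ∈ verts
  singleton_mem_iff : ∀ n : ℕ, [n] ∈ verts ↔ n = 0
  parent_mem : ∀ (u : List ℕ) (n : ℕ), u ++ [n] ∈ verts → u ∈ verts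
  sibling_mem : ∀ (u : List ℕ) (m n : ℕ), m ≤ n → u ++ [n] ∈ verts → u ++ [m] ∈ verts
  locally_finite : ∀ u : List ℕ, {n : ℕ | u ++ [n] ∈ verts}.Finite

namespace PlanarTree

/-- `D_r(T)`: the vertices at distance `r` from the root. -/
def level (T : PlanarTree) (r : ℕ) : Set (List ℕ) := {u ∈ T.verts | u.length = r}

/-- The edges, as pairs (parent, child). -/
def edges (T : PlanarTree) : Set (List ℕ × List ℕ) :=
  {e | e.2 ∈ T.verts ∧ ∃ n : ℕ, e.2 = e.1 ++ [n]}

/-- The size `|T|`: the number of edges. -/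
noncomputable def size (T : PlanarTree) : ℕ∞ := T.edges.encard

/-- The tree has finitely many edges. -/
def IsFinite (T : PlanarTree) : Prop := T.edges.Finite

/-- The height `h(T)`: the maximal distance of a vertex from the root (`⊤` if unbounded). -/
noncomputable def height (T : PlanarTree) : ℕ∞ := ⨆ u ∈ T.verts, (u.length : ℕ∞)

/-- (The vertex set of) `B_r(T)`, the subtree spanned by the vertices at distance at most `r`
from the root. -/
def rootBall (T : PlanarTree) (r : ℕ) : Set (List ℕ) := {u ∈ T.verts | u.length ≤ r}

/-- `dist(T, T') = inf {1/r | r ≥ 1, B_r(T) = B_r(T')}`. -/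
noncomputable instance : Dist PlanarTree where
  dist T T' := sInf {x : ℝ | ∃ r : ℕ, 1 ≤ r ∧ T.rootBall r = T'.rootBall r ∧ x = 1 / (r : ℝ)}

theorem dist_def (T T' : PlanarTree) : dist T T' =
    sInf {x : ℝ | ∃ r : ℕ, 1 ≤ r ∧ T.rootBall r = T'.rootBall r ∧ x = 1 / (r : ℝ)} := rfl

theorem rootBall_one_eq (T T' : PlanarTree) : T.rootBall 1 = T'.rootBall 1 := by
  ext u
  match u with
  | [] => simp [rootBall, T.root_mem, T'.root_mem]
  | [n] => simp [rootBall, T.singleton_mem_iff, T'.singleton_mem_iff]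
  | a :: b :: l => simp [rootBall]

theorem rootBall_eq_of_le {T T' : PlanarTree} {r s : ℕ} (h : r ≤ s)
    (e : T.rootBall s = T'.rootBall s) : T.rootBall r = T'.rootBall r := by
  ext u
  have := Set.ext_iff.1 e u
  simp only [rootBall, Set.mem_ofPred_eq] at this ⊢
  constructor <;> rintro ⟨h1, h2⟩
  · exact ⟨(this.1 ⟨h1, h2.trans h⟩).1, h2⟩
  · exact ⟨(this.2 ⟨h1, h2.trans h⟩).1, h2⟩

theorem dist_set_nonempty (T T' : PlanarTree) :
    {x : ℝ | ∃ r : ℕ, 1 ≤ r ∧ T.rootBall r = T'.rootBall r ∧ x = 1 / (r : ℝ)}.Nonempty :=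
  ⟨_, 1, le_rfl, rootBall_one_eq T T', rfl⟩

theorem dist_le_of_rootBall_eq {T T' : PlanarTree} {r : ℕ} (hr : 1 ≤ r)
    (e : T.rootBall r = T'.rootBall r) : dist T T' ≤ 1 / (r : ℝ) := by
  refine csInf_le ⟨0, ?_⟩ ⟨r, hr, e, rfl⟩
  rintro x ⟨s, -, -, rfl⟩
  positivity

theorem le_dist {T T' : PlanarTree} {a : ℝ}
    (h : ∀ r : ℕ, 1 ≤ r → T.rootBall r = T'.rootBall r → a ≤ 1 / (r : ℝ)) : a ≤ dist T T' := by
  refine le_csInf (dist_set_nonempty T T') ?_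
  rintro x ⟨r, hr, e, rfl⟩
  exact h r hr e

noncomputable instance : MetricSpace PlanarTree where
  dist_self T := by
    refine le_antisymm ?_ (le_dist fun r _ _ => by positivity)
    refine le_of_forall_pos_le_add fun ε hε => ?_
    obtain ⟨n, hn⟩ := exists_nat_one_div_lt hε
    have := dist_le_of_rootBall_eq (T := T) (T' := T) (r := n + 1) (by omega) rfl
    push_cast at this
    linarith
  dist_comm T T' := by
    simp only [dist_def, eq_comm]
  dist_triangle T T' T'' := by
    have key : ∀ r : ℕ, 1 ≤ r → T.rootBall r = T'.rootBall r → ∀ s : ℕ, 1 ≤ s →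
        T'.rootBall s = T''.rootBall s → dist T T'' ≤ 1 / (r : ℝ) + 1 / (s : ℝ) := by
      intro r hr e s hs e'
      rcases le_total r s with h | h
      · refine (dist_le_of_rootBall_eq hr (e.trans (rootBall_eq_of_le h e'))).trans ?_
        have : (0 : ℝ) ≤ 1 / (s : ℝ) := by positivity
        linarith
      · refine (dist_le_of_rootBall_eq hs ((rootBall_eq_of_le h e).trans e')).trans ?_
        have : (0 : ℝ) ≤ 1 / (r : ℝ) := by positivity
        linarith
    rw [← sub_le_iff_le_add]
    refine le_dist fun r hr e => ?_
    rw [sub_le_comm]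
    refine le_dist fun s hs e' => ?_
    linarith [key r hr e s hs e']
  eq_of_dist_eq_zero := by
    intro T T' h
    by_contra hne
    have hv : ¬ ∀ u, u ∈ T.verts ↔ u ∈ T'.verts := fun h' => hne (PlanarTree.ext (Set.ext h'))
    obtain ⟨u, hu⟩ := not_forall.1 hv
    have : 1 / ((u.length : ℝ) + 1) ≤ dist T T' := by
      refine le_dist fun r hr e => ?_
      have hlt : r < u.length := by
        by_contra hle
        have := Set.ext_iff.1 e u
        simp only [rootBall, Set.mem_ofPred_eq, not_lt.1 hle, and_true] at this
        exact hu this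
      apply one_div_le_one_div_of_le
      · exact_mod_cast hr
      · exact_mod_cast (by omega : r ≤ u.length + 1)
    have h0 : (0 : ℝ) < 1 / ((u.length : ℝ) + 1) := by positivity
    linarith

noncomputable instance : MeasurableSpace PlanarTree := borel PlanarTree

instance : BorelSpace PlanarTree := ⟨rfl⟩

/-- `𝒯_N`: the trees of size `N`. -/
def treesOfSize (N : ℕ) : Set PlanarTree := {T | T.size = N}

theorem mem_of_append (T : PlanarTree) (u v : List ℕ) (h : u ++ v ∈ T.verts) : u ∈ T.verts := by
  induction v using List.reverseRecOn with
  | nil => simpa using h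
  | append_singleton v n ih => exact ih (T.parent_mem _ n (by simpa using h))

/-- A tree with `N` edges has at most `N` siblings in each family and height at most `N`. -/
theorem bound_of_size {T : PlanarTree} {N : ℕ} (h : T.size = N) (u : List ℕ) (hu : u ∈ T.verts) :
    u.length ≤ N ∧ ∀ n ∈ u, n < N := by
  have card_le : ∀ (k : ℕ) (f : ℕ → List ℕ × List ℕ), Function.Injective f →
      (∀ i < k, f i ∈ T.edges) → k ≤ N := by
    intro k f hf hk
    have h1 : (f '' (Set.Iio k)).encard ≤ T.edges.encard := by
      apply Set.encard_le_encard
      rintro _ ⟨i, hi, rfl⟩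
      exact hk i hi
    rw [hf.encard_image] at h1
    have h2 : T.edges.encard = N := h
    rw [h2, ← Finset.coe_Iio, Set.encard_coe_eq_coe_finsetCard] at h1
    simpa using h1
  constructor
  · by_contra hlt
    have hmem : ∀ i < u.length, (u.take i, u.take (i + 1)) ∈ T.edges := by
      intro i hi
      refine ⟨T.mem_of_append _ (u.drop (i + 1)) (by simpa using hu), u[i], ?_⟩
      simp
    have h1 : ((fun i => (u.take i, u.take (i + 1))) '' (Set.Iio u.length)).encard
        ≤ T.edges.encard := by
      apply Set.encard_le_encard
      rintro _ ⟨i, hi, rfl⟩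
      exact hmem i hi
    have hinj : Set.InjOn (fun i => (u.take i, u.take (i + 1))) (Set.Iio u.length) := by
      intro i hi j hj hij
      have := congrArg (fun e : List ℕ × List ℕ => e.1.length) hij
      simp only [List.length_take, Set.mem_Iio] at this hi hj
      omega
    have h2 : T.edges.encard = N := h
    rw [hinj.encard_image, h2, ← Finset.coe_Iio, Set.encard_coe_eq_coe_finsetCard] at h1
    simp only [Nat.card_Iio, Nat.cast_le] at h1
    exact hlt h1
  · intro n hn
    obtain ⟨p, q, rfl⟩ := List.append_of_mem hn
    have hp : p ++ [n] ∈ T.verts := T.mem_of_append _ q (by simpa using hu)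
    refine card_le (n + 1) (fun i => (p, p ++ [i])) ?_ ?_
    · intro i j hij
      simpa using hij
    · intro i hi
      exact ⟨T.sibling_mem p i n (by omega) hp, i, rfl⟩

theorem treesOfSize_finite (N : ℕ) : (treesOfSize N).Finite := by
  have hfin : {u : List ℕ | u.length ≤ N ∧ ∀ n ∈ u, n < N}.Finite := by
    refine ((List.finite_length_le (Fin N) N).image (List.map Fin.val)).subset ?_
    rintro u ⟨h1, h2⟩
    refine ⟨u.pmap (fun n hn => ⟨n, hn⟩) h2, by simpa using h1, ?_⟩
    simp [List.map_pmap]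
  refine Set.Finite.of_finite_image (f := verts) (hfin.finite_subsets.subset ?_) ?_
  · rintro _ ⟨T, hT, rfl⟩ u hu
    exact bound_of_size hT u hu
  · intro T _ T' _ h
    exact PlanarTree.ext h

/-- The linear tree with `N ≥ 1` edges. -/
def path (N : ℕ) (hN : 1 ≤ N) : PlanarTree where
  verts := {u | u.length ≤ N ∧ ∀ n ∈ u, n = 0}
  root_mem := by simp
  singleton_mem_iff n := by simp [hN]
  parent_mem u n h := by
    simp only [Set.mem_ofPred_eq, List.length_append, List.length_singleton, List.mem_append] at h ⊢
    exact ⟨by omega, fun m hm => h.2 m (Or.inl hm)⟩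
  sibling_mem u m n hmn h := by
    have h0 : n = 0 := h.2 n (by simp)
    have : m = n := by omega
    rwa [this]
  locally_finite u := by
    refine (Set.finite_singleton 0).subset fun n h => ?_
    exact h.2 n (by simp)

theorem path_mem (N : ℕ) (hN : 1 ≤ N) : path N hN ∈ treesOfSize N := by
  have : (path N hN).edges =
      (fun i => (List.replicate i 0, List.replicate (i + 1) 0)) '' (Set.Iio N) := by
    ext ⟨u, v⟩
    simp only [edges, path, Set.mem_ofPred_eq, Set.mem_image, Set.mem_Iio, Prod.mk.injEq]
    constructor
    · rintro ⟨⟨h1, h2⟩, n, rfl⟩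
      have hu : u = List.replicate u.length 0 :=
        List.eq_replicate_iff.2 ⟨rfl, fun m hm => h2 m (by simp [hm])⟩
      have hn : n = 0 := h2 n (by simp)
      refine ⟨u.length, by simpa using h1, hu.symm, ?_⟩
      rw [List.replicate_succ', ← hu, hn]
    · rintro ⟨i, hi, rfl, rfl⟩
      refine ⟨⟨by simpa using hi, fun n hn => (List.mem_replicate.1 hn).2⟩, 0, ?_⟩
      rw [List.replicate_succ']
  have hinj : Function.Injective
      (fun i => (List.replicate i 0, List.replicate (i + 1) 0) : ℕ → List ℕ × List ℕ) := by
    intro i j hij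
    simpa using congrArg (fun e : List ℕ × List ℕ => e.1.length) hij
  rw [treesOfSize, Set.mem_ofPred_eq, size, this, hinj.encard_image, ← Finset.coe_Iio,
    Set.encard_coe_eq_coe_finsetCard]
  simp

/-- `𝒯_N` as a finite set. -/
noncomputable def treeFinset (N : ℕ) : Finset PlanarTree := (treesOfSize_finite N).toFinset

/-- The weight `e^{-μ h(T)}` of a finite tree. -/
noncomputable def weight (μ : ℝ) (T : PlanarTree) : ℝ := Real.exp (-μ * (T.height.toNat : ℝ))

/-- The partition function `Z_N^{(μ)}`, the total weight of the trees of size `N`. -/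
noncomputable def partitionFunction (μ : ℝ) (N : ℕ) : ℝ := ∑ T ∈ treeFinset N, weight μ T

theorem partitionFunction_pos (μ : ℝ) {N : ℕ} (hN : 1 ≤ N) : 0 < partitionFunction μ N :=
  Finset.sum_pos (fun _ _ => Real.exp_pos _)
    ⟨path N hN, (treesOfSize_finite N).mem_toFinset.2 (path_mem N hN)⟩

/-- The measure on trees with mass `e^{-μ h(T)} / Z_N^{(μ)}` at each tree `T` of size `N`. -/
noncomputable def gibbsMeasure (μ : ℝ) (N : ℕ) : Measure PlanarTree :=
  ∑ T ∈ treeFinset N, ENNReal.ofReal (weight μ T / partitionFunction μ N) • Measure.dirac T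

theorem isProbabilityMeasure_gibbsMeasure (μ : ℝ) {N : ℕ} (hN : 1 ≤ N) :
    IsProbabilityMeasure (gibbsMeasure μ N) := by
  have hZ := partitionFunction_pos μ hN
  constructor
  simp only [gibbsMeasure, Measure.coe_finsetSum, Finset.sum_apply, Measure.smul_apply,
    measure_univ, smul_eq_mul, mul_one]
  rw [← ENNReal.ofReal_sum_of_nonneg, ← Finset.sum_div]
  · change ENNReal.ofReal (partitionFunction μ N / partitionFunction μ N) = 1
    rw [div_self hZ.ne', ENNReal.ofReal_one]
  · intro T _
    exact div_nonneg (Real.exp_pos _).le hZ.le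

/-- `ν_N^{(μ)}`, for `N ≥ 1`, as a Borel probability measure on the space of all trees. -/
noncomputable def nu (μ : ℝ) (N : ℕ+) : ProbabilityMeasure PlanarTree :=
  ⟨gibbsMeasure μ N, isProbabilityMeasure_gibbsMeasure μ N.pos⟩

/-- `ν` takes the values
`ν(ℬ_{1/r}(T₀)) = e^{-μ(r-1)} 4^{-|T₀|} 2^{K+1} ∑_{R=1}^K C(K,R) μ^{R-1}/(R-1)!`, `K = |D_r(T₀)|`,
on the closed balls of radius `1/r` around the finite trees `T₀` of height `r ≥ 1`. -/
def HasBallVolumes (μ : ℝ) (ν : ProbabilityMeasure PlanarTree) : Prop :=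
  ∀ (r : ℕ) (T₀ : PlanarTree), 1 ≤ r → T₀.IsFinite → T₀.height = r →
    (ν : Measure PlanarTree).real (Metric.closedBall T₀ (1 / (r : ℝ))) =
      Real.exp (-μ * ((r : ℝ) - 1)) / 4 ^ T₀.size.toNat * 2 ^ ((T₀.level r).ncard + 1) *
        ∑ R ∈ Finset.Icc 1 (T₀.level r).ncard,
          ((T₀.level r).ncard.choose R : ℝ) * (μ ^ (R - 1) / ((R - 1).factorial : ℝ))

end PlanarTree

namespace PlanarTree

/-! The plan is to compute the limits of the ball masses, to show that these limits carry total mass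
one at every depth, and to conclude by Prokhorov compactness.

Write `e^{-μh} = (1 - e^{-μ}) ∑_{l ≥ h} e^{-μl}`. The mass of a ball around `T` then becomes a ratio
of sums, over height bounds, of numbers of extensions of bounded height. With `K` vertices at
distance `r` these numbers are the coefficients of `B_m ^ K`, where `B_{m+1} = 1/(1 - X B_m)`
(`card_treesOver_heightLE`, `extensionCount_eq_coeff`). The centred series `Y_m = 2 X B_m - 1` has
an explicit spectral expansion over angles `θ = πk/M` with `M = m + 2` (`coeff_centredSeries`). It
also satisfies a Riccati equation (`riccati`), which reduces the coefficients of `Y_m ^ R` to those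
of `Y_m`. Each mode therefore enters with a factor polynomial in `n t s`, `t` and `s`, where `t =
tan²θ` and `s = 1/M` (`coeff_centredSeries_pow_eq`).

Everything is now an average over modes `(M, k)` with weight `e^{-μM} (2/M) tan²θ cos^{2N}θ`. Under
this weight `t` and `s` tend to `0` and `u = N t s` concentrates at `μ/2`. Indeed, changing `M` by
`±1` multiplies the weight by about `e^{±(2u-μ)}`. The total weight does not grow under these
shifts, so the average of `e^x + e^{-x} - 2 ≥ x²`, with `x = 2u - μ`, must vanish
(`modeWeight_mul_min_le`, `tendsto_tsum_min`). Moment bounds turn the concentration into convergence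
of polynomial averages (`IsScalingPoly.tendsto_modeSum`), and at `u = μ/2`, `t = s = 0` the factor
of `Y_m ^ R` is `μ^{R-1}/(R-1)!`.

The limiting volumes satisfy a summation identity over one-level extensions
(`hasSum_multichoose_mul_volumeFactor`), so no mass escapes to large degrees and the sequence is
tight. Balls are clopen, so every cluster point has the stated volumes. The same identity shows that
balls around trees of smaller height are null, so the volumes determine the measure; the cluster
point is unique and the sequence converges to it. -/

/-! ### Levels, truncations and one-level extensions of trees. -/

theorem mem_rootBall {T : PlanarTree} {r : ℕ} {u : List ℕ} :
    u ∈ T.rootBall r ↔ u ∈ T.verts ∧ u.length ≤ r := Iff.rfl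

theorem mem_level {T : PlanarTree} {r : ℕ} {u : List ℕ} :
    u ∈ T.level r ↔ u ∈ T.verts ∧ u.length = r := Iff.rfl

theorem rootBall_finite (T : PlanarTree) (r : ℕ) : (T.rootBall r).Finite := by
  induction r with
  | zero =>
    refine (Set.finite_singleton []).subset fun u hu => ?_
    simpa using hu.2
  | succ r ih =>
    refine (ih.union (ih.biUnion fun u _ => (T.locally_finite u).image (fun n => u ++ [n]))).subset
      fun u hu => ?_
    rcases List.eq_nil_or_concat u with rfl | ⟨v, n, rfl⟩
    · exact Or.inl ⟨T.root_mem, by simp⟩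
    · refine Or.inr ?_
      simp only [List.concat_eq_append] at hu ⊢
      simp only [Set.mem_iUnion]
      refine ⟨v, ⟨T.parent_mem _ _ hu.1, ?_⟩, n, hu.1, rfl⟩
      have := hu.2
      simp at this
      omega

theorem level_finite (T : PlanarTree) (r : ℕ) : (T.level r).Finite :=
  (T.rootBall_finite r).subset fun _ hu => ⟨hu.1, hu.2.le⟩

/-- The vertices at distance `r` from the root, as a finite set. -/
noncomputable def levelFinset (T : PlanarTree) (r : ℕ) : Finset (List ℕ) :=
  (T.level_finite r).toFinset

@[simp]
theorem mem_levelFinset {T : PlanarTree} {r : ℕ} {u : List ℕ} :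
    u ∈ T.levelFinset r ↔ u ∈ T.verts ∧ u.length = r := by
  simp [levelFinset, mem_level]

theorem ncard_level (T : PlanarTree) (r : ℕ) : (T.level r).ncard = (T.levelFinset r).card := by
  rw [levelFinset, Set.ncard_eq_toFinset_card _ (T.level_finite r)]

theorem size_eq_encard_verts (T : PlanarTree) : T.size = (T.verts \ {[]}).encard := by
  have hinj : Function.Injective (fun v : List ℕ => (v.dropLast, v)) :=
    fun v w h => (Prod.mk.inj h).2
  rw [size, ← hinj.encard_image]
  congr 1
  ext ⟨u, v⟩
  simp only [edges, Set.mem_ofPred_eq, Set.mem_image, Set.mem_sdiff, Set.mem_singleton_iff,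
    Prod.mk.injEq]
  constructor
  · rintro ⟨hv, n, rfl⟩
    exact ⟨u ++ [n], ⟨hv, by simp⟩, by simp, rfl⟩
  · rintro ⟨w, ⟨hw, hne⟩, rfl, rfl⟩
    exact ⟨hw, w.getLast hne, (List.dropLast_append_getLast hne).symm⟩

/-- The number of children of a vertex. -/
noncomputable def childCount (T : PlanarTree) (u : List ℕ) : ℕ := {n : ℕ | u ++ [n] ∈ T.verts}.ncard

theorem append_singleton_mem_iff (T : PlanarTree) (u : List ℕ) (n : ℕ) :
    u ++ [n] ∈ T.verts ↔ n < T.childCount u := by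
  have hfin := T.locally_finite u
  constructor
  · intro h
    have hsub : Set.Iic n ⊆ {n : ℕ | u ++ [n] ∈ T.verts} := fun m hm => T.sibling_mem u m n hm h
    have := Set.ncard_le_ncard hsub hfin
    rw [← Finset.coe_Iic n, Set.ncard_coe_finset] at this
    rw [Nat.card_Iic] at this
    exact this
  · intro h
    by_contra hn
    have hsub : {n : ℕ | u ++ [n] ∈ T.verts} ⊆ Set.Iio n := fun m hm => by
      by_contra hmn
      exact hn (T.sibling_mem u n m (not_lt.1 hmn) hm)
    have := Set.ncard_le_ncard hsub (Set.finite_Iio n)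
    rw [← Finset.coe_Iio n, Set.ncard_coe_finset] at this
    simp only [Nat.card_Iio] at this
    exact absurd h (not_lt.2 this)

/-- All vertices are at distance at most `r` from the root. -/
def HeightLE (T : PlanarTree) (r : ℕ) : Prop := ∀ u ∈ T.verts, u.length ≤ r

theorem height_le_iff {T : PlanarTree} {r : ℕ} : T.height ≤ r ↔ T.HeightLE r := by
  simp [height, HeightLE]

theorem HeightLE.rootBall_eq {T : PlanarTree} {r : ℕ} (h : T.HeightLE r) : T.rootBall r = T.verts :=
  Set.ext fun u => ⟨fun hu => hu.1, fun hu => ⟨hu, h u hu⟩⟩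

theorem HeightLE.verts_finite {T : PlanarTree} {r : ℕ} (h : T.HeightLE r) : T.verts.Finite :=
  h.rootBall_eq ▸ T.rootBall_finite r

theorem HeightLE.exists_size {T : PlanarTree} {r : ℕ} (h : T.HeightLE r) :
    ∃ a : ℕ, T.size = a ∧ 1 ≤ a := by
  have hf : (T.verts \ {[]}).Finite := h.verts_finite.subset Set.sdiff_subset
  obtain ⟨a, ha⟩ := ENat.ne_top_iff_exists.1 (Set.encard_ne_top_iff.2 hf)
  refine ⟨a, by rw [size_eq_encard_verts, ← ha], ?_⟩
  have : ({[0]} : Set (List ℕ)) ⊆ T.verts \ {[]} := by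
    rintro _ rfl
    exact ⟨(T.singleton_mem_iff 0).2 rfl, by simp⟩
  have := Set.encard_le_encard this
  rw [← ha, Set.encard_singleton] at this
  exact_mod_cast this

/-- The tree `B_r(T)`. -/
def trunc (T : PlanarTree) (r : ℕ) (hr : 1 ≤ r) : PlanarTree where
  verts := T.rootBall r
  root_mem := ⟨T.root_mem, by simp⟩
  singleton_mem_iff n := by simp [mem_rootBall, T.singleton_mem_iff, hr]
  parent_mem u n h := ⟨T.parent_mem u n h.1, by have := h.2; simp at this; omega⟩
  sibling_mem u m n hmn h := ⟨T.sibling_mem u m n hmn h.1, by have := h.2; simpa using this⟩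
  locally_finite u := (T.locally_finite u).subset fun n h => h.1

theorem trunc_heightLE (T : PlanarTree) {r : ℕ} (hr : 1 ≤ r) : (T.trunc r hr).HeightLE r :=
  fun _ hu => hu.2

/-- Every vertex `u` of `T` at distance `r` from the root is given `f u` children, in addition to
those which it has already. -/
def extend (T : PlanarTree) (r : ℕ) (hr : 1 ≤ r) (f : List ℕ → ℕ) : PlanarTree where
  verts := T.verts ∪ {v | ∃ u n, v = u ++ [n] ∧ u ∈ T.verts ∧ u.length = r ∧ n < f u}
  root_mem := Or.inl T.root_mem
  singleton_mem_iff n := by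
    simp only [Set.mem_union, T.singleton_mem_iff, Set.mem_ofPred_eq, or_iff_left_iff_imp]
    rintro ⟨u, m, h, -, h', -⟩
    have := congrArg List.length h
    simp at this
    simp [this] at h'
    omega
  parent_mem u n h := by
    rcases h with h | ⟨v, m, h, hv, -⟩
    · exact Or.inl (T.parent_mem u n h)
    · rw [(List.append_inj' h rfl).1]
      exact Or.inl hv
  sibling_mem u m n hmn h := by
    rcases h with h | ⟨v, k, h, hv, hr, hk⟩
    · exact Or.inl (T.sibling_mem u m n hmn h)
    · obtain ⟨rfl, h'⟩ := List.append_inj' h rfl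
      obtain rfl : n = k := by simpa using h'
      exact Or.inr ⟨u, m, rfl, hv, hr, by omega⟩
  locally_finite u := by
    refine ((T.locally_finite u).union (Set.finite_Iio (f u))).subset fun n h => ?_
    rcases h with h | ⟨v, k, h, hv, hr, hk⟩
    · exact Or.inl h
    · obtain ⟨rfl, h'⟩ := List.append_inj' h rfl
      obtain rfl : n = k := by simpa using h'
      exact Or.inr hk

section extend

variable {T : PlanarTree} {r : ℕ} (hr : 1 ≤ r)

theorem HeightLE.extend (hT : T.HeightLE r) (f : List ℕ → ℕ) :
    (T.extend r hr f).HeightLE (r + 1) := by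
  rintro v (h | ⟨u, n, rfl, -, h, -⟩)
  · exact (hT v h).trans (by omega)
  · simp [h]

theorem HeightLE.level_extend (hT : T.HeightLE r) (f : List ℕ → ℕ) :
    (T.extend r hr f).level (r + 1) =
    {v | ∃ u n, v = u ++ [n] ∧ u ∈ T.verts ∧ u.length = r ∧ n < f u} := by
  ext v
  constructor
  · rintro ⟨h | h, hl⟩
    · have := hT v h
      omega
    · exact h
  · rintro ⟨u, n, rfl, hu, h, hn⟩
    exact ⟨Or.inr ⟨u, n, rfl, hu, h, hn⟩, by simp [h]⟩

theorem HeightLE.card_levelFinset_extend (hT : T.HeightLE r) (f : List ℕ → ℕ) :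
    ((T.extend r hr f).levelFinset (r + 1)).card = ∑ u ∈ T.levelFinset r, f u := by
  have : (T.extend r hr f).levelFinset (r + 1) =
      ((T.levelFinset r).sigma fun u => Finset.range (f u)).image fun x => x.1 ++ [x.2] := by
    ext v
    rw [← Finset.mem_coe, levelFinset, Set.Finite.coe_toFinset, hT.level_extend]
    simp only [Set.mem_ofPred_eq, Finset.mem_image, Finset.mem_sigma, mem_levelFinset,
      Finset.mem_range, Sigma.exists]
    constructor
    · rintro ⟨u, n, rfl, hu, h, hn⟩
      exact ⟨u, n, ⟨⟨hu, h⟩, hn⟩, rfl⟩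
    · rintro ⟨u, n, ⟨⟨hu, h⟩, hn⟩, rfl⟩
      exact ⟨u, n, rfl, hu, h, hn⟩
  rw [this, Finset.card_image_of_injective, Finset.card_sigma]
  · simp
  · rintro ⟨u, m⟩ ⟨v, n⟩ h
    obtain ⟨h1, h2⟩ := List.append_inj' h rfl
    simp at h1 h2
    simp [h1, h2]

theorem HeightLE.size_extend (hT : T.HeightLE r) (f : List ℕ → ℕ) :
    (T.extend r hr f).size = T.size + (∑ u ∈ T.levelFinset r, f u : ℕ) := by
  rw [size_eq_encard_verts, size_eq_encard_verts, ← hT.card_levelFinset_extend hr,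
    ← Set.encard_coe_eq_coe_finsetCard, levelFinset, Set.Finite.coe_toFinset,
    ← Set.encard_union_eq]
  · congr 1
    rw [hT.level_extend]
    ext v
    simp only [PlanarTree.extend, Set.mem_union, Set.mem_sdiff, Set.mem_singleton_iff]
    constructor
    · rintro ⟨h | h, hne⟩
      · exact Or.inl ⟨h, hne⟩
      · exact Or.inr h
    · rintro (h | h)
      · exact ⟨Or.inl h.1, h.2⟩
      · refine ⟨Or.inr h, ?_⟩
        obtain ⟨u, n, rfl, -⟩ := h
        simp
  · rw [Set.disjoint_left]
    rintro v ⟨hv, -⟩ ⟨-, h⟩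
    have := hT v hv
    omega

end extend

/-- The numbers of children of the vertices at distance `r` from the root. -/
noncomputable def profile (T : PlanarTree) (r : ℕ) (u : List ℕ) : ℕ :=
  if u.length = r then T.childCount u else 0

theorem level_eq_of_rootBall_eq {T T' : PlanarTree} {r : ℕ} (h : T'.rootBall r = T.rootBall r) :
    T'.levelFinset r = T.levelFinset r := by
  ext u
  have := Set.ext_iff.1 h u
  simp only [mem_rootBall, mem_levelFinset] at this ⊢
  constructor
  · rintro ⟨h1, h2⟩
    exact ⟨(this.1 ⟨h1, h2.le⟩).1, h2⟩
  · rintro ⟨h1, h2⟩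
    exact ⟨(this.2 ⟨h1, h2.le⟩).1, h2⟩

theorem profile_support {T : PlanarTree} {r : ℕ} {u : List ℕ} (h : T.profile r u ≠ 0) :
    u ∈ T.levelFinset r := by
  unfold profile at h
  split_ifs at h with hu
  · rw [mem_levelFinset]
    exact ⟨T.parent_mem u 0 ((T.append_singleton_mem_iff u 0).2 (by omega)), hu⟩
  · exact absurd rfl h

/-- Children of a vertex are numbered consecutively, so the next level amounts to one child count
per vertex at distance `r`. The support condition makes `f` unique. -/
theorem rootBall_succ_eq_iff {T T' : PlanarTree} {r : ℕ} (hr : 1 ≤ r) (hT : T.HeightLE r)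
    {f : List ℕ → ℕ} (hf : ∀ u, f u ≠ 0 → u ∈ T.levelFinset r) :
    T'.rootBall (r + 1) = (T.extend r hr f).verts ↔
      T'.rootBall r = T.verts ∧ T'.profile r = f := by
  constructor
  · intro h
    have hmem : ∀ u : List ℕ, u.length ≤ r + 1 → (u ∈ T'.verts ↔ u ∈ (T.extend r hr f).verts) := by
      intro u hu
      rw [← h, mem_rootBall, and_iff_left hu]
    have hle : ∀ u : List ℕ, u.length ≤ r → (u ∈ T'.verts ↔ u ∈ T.verts) := by
      intro u hu
      rw [hmem u (by omega)]
      refine ⟨?_, Or.inl⟩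
      rintro (h | ⟨v, n, rfl, -, h, -⟩)
      · exact h
      · simp at hu
        omega
    have hball : T'.rootBall r = T.verts := by
      ext u
      rw [mem_rootBall]
      exact ⟨fun hu => (hle u hu.2).1 hu.1, fun hu => ⟨(hle u (hT u hu)).2 hu, hT u hu⟩⟩
    refine ⟨hball, ?_⟩
    ext u
    by_cases hu : u ∈ T.levelFinset r
    · rw [mem_levelFinset] at hu
      rw [profile, if_pos hu.2]
      refine Nat.le_antisymm ?_ ?_ <;> refine Nat.le_of_not_lt fun hlt => ?_
      · have := (T'.append_singleton_mem_iff u (f u)).2 hlt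
        rw [hmem _ (by simp [hu.2])] at this
        rcases this with h' | ⟨v, n, h', -, -, hn⟩
        · have := hT _ h'
          simp [hu.2] at this
        · obtain ⟨rfl, h''⟩ := List.append_inj' h' rfl
          simp at h''
          omega
      · have : u ++ [T'.childCount u] ∈ T'.verts := by
          rw [hmem _ (by simp [hu.2])]
          exact Or.inr ⟨u, _, rfl, hu.1, hu.2, hlt⟩
        exact absurd ((T'.append_singleton_mem_iff _ _).1 this) (lt_irrefl _)
    · have h1 : f u = 0 := by
        by_contra h'
        exact hu (hf u h')
      rw [h1]
      by_contra h'
      have h2 := profile_support h'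
      rw [mem_levelFinset] at h2 hu
      exact hu ⟨(hle u h2.2.le).1 h2.1, h2.2⟩
  · rintro ⟨hball, rfl⟩
    have hle : ∀ u : List ℕ, u.length ≤ r → (u ∈ T'.verts ↔ u ∈ T.verts) := by
      intro u hu
      rw [← hball, mem_rootBall, and_iff_left hu]
    ext v
    constructor
    · rintro ⟨hv, hl⟩
      rcases hl.lt_or_eq with hl | hl
      · exact Or.inl ((hle v (by omega)).1 hv)
      · rcases List.eq_nil_or_concat v with rfl | ⟨u, n, rfl⟩
        · simp at hl
        · simp only [List.concat_eq_append, List.length_append, List.length_singleton,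
            Nat.add_right_cancel_iff] at hl hv ⊢
          refine Or.inr ⟨u, n, rfl, (hle u hl.le).1 (T'.parent_mem _ _ hv), hl, ?_⟩
          rw [profile, if_pos hl]
          exact (T'.append_singleton_mem_iff _ _).1 hv
    · rintro (h | ⟨u, n, rfl, -, h, hn⟩)
      · exact ⟨(hle v (hT v h)).2 h, (hT v h).trans (by omega)⟩
      · rw [profile, if_pos h] at hn
        exact ⟨(T'.append_singleton_mem_iff _ _).2 hn, by simp [h]⟩

end PlanarTree

/-! ### Counting the trees over a given ball. -/

/-- The number of ways to add `n` edges on top of `K` vertices, reaching at most `m` levels higher. -/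
def extensionCount : ℕ → ℕ → ℕ → ℕ
  | 0, _, n => if n = 0 then 1 else 0
  | m + 1, K, n => ∑ j ∈ Finset.range (n + 1), K.multichoose j * extensionCount m j (n - j)

theorem card_piAntidiag_nat {ι : Type*} [DecidableEq ι] (s : Finset ι) (n : ℕ) :
    (Finset.piAntidiag s n).card = s.card.multichoose n := by
  rw [← Finset.card_finsuppAntidiag_nat_eq_multichoose]
  symm
  refine Finset.card_bij (fun f _ => ⇑f) (fun f hf => ?_) (fun f _ g _ h => DFunLike.coe_injective h)
    fun f hf => ?_
  · rw [Finset.mem_finsuppAntidiag] at hf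
    rw [Finset.mem_piAntidiag]
    exact ⟨hf.1, fun i hi => hf.2 (by simpa using hi)⟩
  · rw [Finset.mem_piAntidiag] at hf
    refine ⟨Finsupp.onFinset s f hf.2, ?_, rfl⟩
    rw [Finset.mem_finsuppAntidiag]
    exact ⟨hf.1, Finsupp.support_onFinset_subset⟩

namespace PlanarTree

@[simp]
theorem mem_treeFinset {T : PlanarTree} {N : ℕ} : T ∈ treeFinset N ↔ T.size = N := by
  simp [treeFinset, treesOfSize]

open Classical in
/-- The trees of size `N` whose ball of radius `r` is `T`. -/
noncomputable def treesOver (T : PlanarTree) (r N : ℕ) : Finset PlanarTree :=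
  {T' ∈ treeFinset N | T'.rootBall r = T.verts}

theorem mem_treesOver {T T' : PlanarTree} {r N : ℕ} :
    T' ∈ T.treesOver r N ↔ T'.size = N ∧ T'.rootBall r = T.verts := by
  simp [treesOver]

theorem size_le_of_subset {T T' : PlanarTree} (h : T.verts ⊆ T'.verts) : T.size ≤ T'.size := by
  rw [size_eq_encard_verts, size_eq_encard_verts]
  exact Set.encard_le_encard (Set.sdiff_subset_sdiff_left h)

theorem subset_of_rootBall_eq {T T' : PlanarTree} {r : ℕ} (h : T'.rootBall r = T.verts) :
    T.verts ⊆ T'.verts := fun _ hu => (h ▸ hu : _ ∈ T'.rootBall r).1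

theorem HeightLE.level_eq {T T' : PlanarTree} {r : ℕ} (hT : T.HeightLE r)
    (h : T'.rootBall r = T.verts) : T'.levelFinset r = T.levelFinset r :=
  level_eq_of_rootBall_eq (h.trans hT.rootBall_eq.symm)

open Classical in
-- Sort the trees by their child counts at distance `r`. If these add up to `j`, there are
-- `multichoose` many choices, and each fibre is the same problem over an extended tree with `j` top
-- vertices. Only the number of top vertices matters.
theorem card_treesOver_heightLE (m : ℕ) : ∀ {r : ℕ} (_ : 1 ≤ r) {T : PlanarTree}
    (_ : T.HeightLE r) {a : ℕ} (_ : T.size = a) (n : ℕ),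
    ({T' ∈ T.treesOver r (a + n) | T'.HeightLE (r + m)} : Finset PlanarTree).card =
      extensionCount m (T.levelFinset r).card n := by
  induction m with
  | zero =>
    intro r hr T hT a ha n
    rw [extensionCount]
    split_ifs with hn
    · subst hn
      rw [Finset.card_eq_one]
      refine ⟨T, Finset.eq_singleton_iff_unique_mem.2 ⟨?_, fun T' hT' => ?_⟩⟩
      · simp [mem_treesOver, ha, hT.rootBall_eq, hT]
      · simp only [Finset.mem_filter, mem_treesOver] at hT'
        exact PlanarTree.ext (hT'.2.rootBall_eq.symm.trans hT'.1.2)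
    · rw [Finset.card_eq_zero, Finset.filter_eq_empty_iff]
      intro T' hT' hle
      rw [mem_treesOver] at hT'
      have : T' = T := PlanarTree.ext (hle.rootBall_eq.symm.trans hT'.2)
      rw [this, ha] at hT'
      have := hT'.1
      norm_cast at this
      omega
  | succ m ih =>
    intro r hr T hT a ha n
    rw [extensionCount]
    have key : ∀ f : List ℕ → ℕ, ∀ j ≤ n, f ∈ Finset.piAntidiag (T.levelFinset r) j →
        (({T' ∈ T.treesOver r (a + n) | T'.HeightLE (r + (m + 1))} : Finset PlanarTree).filter
          fun T' => T'.profile r = f).card = extensionCount m j (n - j) := by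
      intro f j hj hf
      rw [Finset.mem_piAntidiag] at hf
      have h1 := ih (r := r + 1) (by omega) (hT.extend hr f) (a := a + j)
        (by rw [hT.size_extend, ha, hf.1]; push_cast; rfl) (n - j)
      rw [hT.card_levelFinset_extend, hf.1] at h1
      rw [← h1]
      congr 1
      ext T'
      simp only [Finset.mem_filter, mem_treesOver, rootBall_succ_eq_iff hr hT hf.2]
      have e1 : a + j + (n - j) = a + n := by omega
      have e2 : r + 1 + m = r + (m + 1) := by omega
      rw [e1, e2]
      tauto
    -- Pairing the profile with its sum groups the fibres by `j`. Here `j ≤ n` because the ball of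
    -- radius `r + 1` already has `a + j` of the `a + n` edges.
    have hmaps : ∀ T' ∈ ({T' ∈ T.treesOver r (a + n) | T'.HeightLE (r + (m + 1))} :
        Finset PlanarTree), (⟨∑ u ∈ T.levelFinset r, T'.profile r u, T'.profile r⟩ :
          Σ _ : ℕ, List ℕ → ℕ) ∈ (Finset.range (n + 1)).sigma
            fun j => Finset.piAntidiag (T.levelFinset r) j := by
      intro T' hT'
      simp only [Finset.mem_filter, mem_treesOver] at hT'
      have hsupp : ∀ u, T'.profile r u ≠ 0 → u ∈ T.levelFinset r := fun u hu => by
        rw [← hT.level_eq hT'.1.2]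
        exact profile_support hu
      simp only [Finset.mem_sigma, Finset.mem_range, Finset.mem_piAntidiag, true_and]
      refine ⟨?_, hsupp⟩
      have h2 := (rootBall_succ_eq_iff hr hT hsupp).2 ⟨hT'.1.2, rfl⟩
      have h3 := size_le_of_subset (subset_of_rootBall_eq h2)
      rw [hT.size_extend, hT'.1.1, ha] at h3
      norm_cast at h3
      omega
    rw [Finset.card_eq_sum_card_fiberwise hmaps, Finset.sum_sigma]
    refine Finset.sum_congr rfl fun j hj => ?_
    rw [← card_piAntidiag_nat, ← smul_eq_mul, ← Finset.sum_const]
    refine Finset.sum_congr rfl fun f hf => ?_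
    rw [← key f j (by simpa [Nat.lt_succ_iff] using hj) hf]
    congr 1
    refine Finset.filter_congr fun T' _ => ?_
    constructor
    · intro h
      simpa using (Sigma.mk.inj_iff.1 h).2
    · rintro rfl
      rw [Finset.mem_piAntidiag] at hf
      rw [hf.1]

end PlanarTree

/-! ### From height weights to sums over height bounds. -/

/-- The number of ways to add `n` edges on top of `K` vertices, weighted by the height added. -/
noncomputable def weightedCount (μ : ℝ) (K n : ℕ) : ℝ :=
  ∑' m : ℕ, Real.exp (-μ * m) * extensionCount m K n

/-- A geometric tail. It trades the weight of an exact height for a sum over all upper bounds of the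
height, which are what generating functions count. -/
theorem hasSum_exp_of_le {μ : ℝ} (hμ : 0 < μ) (r d : ℕ) :
    HasSum (fun m : ℕ => if d ≤ m then Real.exp (-μ * ((r : ℝ) + m)) else 0)
      (Real.exp (-μ * ((r : ℝ) + d)) / (1 - Real.exp (-μ))) := by
  have h1 : Real.exp (-μ) < 1 := by simpa using hμ
  rw [← hasSum_nat_add_iff' d]
  have h0 : ∑ m ∈ Finset.range d, (if d ≤ m then Real.exp (-μ * ((r : ℝ) + m)) else 0) = 0 :=
    Finset.sum_eq_zero fun m hm => if_neg (by simpa using hm)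
  rw [h0, sub_zero, div_eq_mul_inv]
  refine HasSum.congr_fun ((hasSum_geometric_of_lt_one (Real.exp_pos _).le h1).mul_left
    (Real.exp (-μ * ((r : ℝ) + d)))) fun m => ?_
  rw [if_pos (by omega), ← Real.exp_nat_mul, ← Real.exp_add]
  congr 1
  push_cast
  ring

namespace PlanarTree

theorem exists_height_of_size {T : PlanarTree} {N : ℕ} (h : T.size = N) :
    ∃ d : ℕ, T.height = d := by
  have : T.height ≤ N := height_le_iff.2 fun u hu => (bound_of_size h u hu).1
  obtain ⟨d, hd⟩ := ENat.ne_top_iff_exists.1 (ne_top_of_le_ne_top (ENat.natCast_ne_top N) this)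
  exact ⟨d, hd.symm⟩

/-- Exchange the finite sum over trees with the sum over height bounds. Since `n ≥ 1`, no tree
counted here is `T` itself, so all heights are at least `r` and the bounds `r + m` suffice. -/
theorem hasSum_treesOver {μ : ℝ} (hμ : 0 < μ) {r : ℕ} (hr : 1 ≤ r) {T : PlanarTree}
    (hT : T.HeightLE r) {a : ℕ} (ha : T.size = a) {n : ℕ} (hn : 1 ≤ n) :
    HasSum (fun m : ℕ => Real.exp (-μ * ((r : ℝ) + m)) *
        extensionCount m (T.levelFinset r).card n)
      (∑ T' ∈ T.treesOver r (a + n), weight μ T' / (1 - Real.exp (-μ))) := by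
  classical
  have key : ∀ T' ∈ T.treesOver r (a + n),
      HasSum (fun m : ℕ => if T'.HeightLE (r + m) then Real.exp (-μ * ((r : ℝ) + m)) else 0)
        (weight μ T' / (1 - Real.exp (-μ))) := by
    intro T' hT'
    rw [mem_treesOver] at hT'
    obtain ⟨d, hd⟩ := exists_height_of_size hT'.1
    have hle : ∀ l : ℕ, T'.HeightLE l ↔ d ≤ l := fun l => by
      rw [← height_le_iff, hd, Nat.cast_le]
    have hrd : r ≤ d := by
      by_contra hlt
      have h1 : T'.HeightLE r := (hle r).2 (by omega)
      have h2 : T' = T := PlanarTree.ext (h1.rootBall_eq.symm.trans hT'.2)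
      rw [h2, ha] at hT'
      have := hT'.1
      norm_cast at this
      omega
    obtain ⟨e, rfl⟩ := Nat.exists_eq_add_of_le hrd
    convert hasSum_exp_of_le hμ r e using 2
    · rw [hle]
      simp
    · rw [weight, hd, ENat.toNat_natCast]
      push_cast
      rfl
  convert hasSum_sum key using 2 with m
  rw [← card_treesOver_heightLE m hr hT ha n, Finset.sum_ite, Finset.sum_const_zero, add_zero,
    Finset.sum_const, nsmul_eq_mul, mul_comm]

theorem sum_treesOver_weight {μ : ℝ} (hμ : 0 < μ) {r : ℕ} (hr : 1 ≤ r) {T : PlanarTree}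
    (hT : T.HeightLE r) {a : ℕ} (ha : T.size = a) {n : ℕ} (hn : 1 ≤ n) :
    ∑ T' ∈ T.treesOver r (a + n), weight μ T' =
      (1 - Real.exp (-μ)) * Real.exp (-μ * r) * weightedCount μ (T.levelFinset r).card n := by
  have h1 : 0 < 1 - Real.exp (-μ) := by simpa using hμ
  have h2 := (hasSum_treesOver hμ hr hT ha hn).tsum_eq
  rw [← Finset.sum_div, eq_div_iff h1.ne'] at h2
  rw [← h2, weightedCount, mul_assoc, mul_comm]
  congr 1
  rw [← tsum_mul_left]
  refine tsum_congr fun m => ?_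
  rw [← mul_assoc, ← Real.exp_add]
  congr 2
  ring

theorem path_one_heightLE : (path 1 le_rfl).HeightLE 1 := fun _ hu => hu.1

theorem card_levelFinset_path_one : ((path 1 le_rfl).levelFinset 1).card = 1 := by
  rw [Finset.card_eq_one]
  refine ⟨[0], ?_⟩
  ext u
  rw [mem_levelFinset, Finset.mem_singleton]
  constructor
  · rintro ⟨h, hl⟩
    obtain ⟨n, rfl⟩ := List.length_eq_one_iff.1 hl
    rw [singleton_mem_iff] at h
    rw [h]
  · rintro rfl
    exact ⟨((path 1 le_rfl).singleton_mem_iff 0).2 rfl, rfl⟩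

/-- All trees share the ball of radius one, a single edge, so this is the case `r = 1`, `K = 1` of
the weight over a ball. -/
theorem partitionFunction_eq {μ : ℝ} (hμ : 0 < μ) {n : ℕ} (hn : 1 ≤ n) :
    partitionFunction μ (1 + n) =
      (1 - Real.exp (-μ)) * Real.exp (-μ) * weightedCount μ 1 n := by
  have := sum_treesOver_weight hμ le_rfl path_one_heightLE (a := 1) (path_mem 1 le_rfl) hn
  rw [card_levelFinset_path_one, Nat.cast_one, mul_one] at this
  rw [← this, partitionFunction]
  refine Finset.sum_congr ?_ fun _ _ => rfl
  ext T'
  rw [mem_treeFinset, mem_treesOver, ← path_one_heightLE.rootBall_eq,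
    and_iff_left (rootBall_one_eq _ _)]

/-- Agreement at one radius implies agreement at smaller ones, so trees that differ within radius
`r` are at distance at least `1/(r-1) > 1/r`. For `r = 1` there is never a difference. -/
theorem closedBall_eq (T : PlanarTree) {r : ℕ} (hr : 1 ≤ r) :
    Metric.closedBall T (1 / (r : ℝ)) = {T' | T'.rootBall r = T.rootBall r} := by
  ext T'
  rw [Metric.mem_closedBall, Set.mem_ofPred_eq]
  refine ⟨fun h => ?_, dist_le_of_rootBall_eq hr⟩
  by_contra hne
  have hr2 : 2 ≤ r := by
    by_contra hlt
    obtain rfl : r = 1 := by omega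
    exact hne (rootBall_one_eq _ _)
  have h1 : 1 / ((r : ℝ) - 1) ≤ dist T' T := by
    refine le_dist fun s hs e => ?_
    have : s < r := by
      by_contra hle
      exact hne (rootBall_eq_of_le (not_lt.1 hle) e)
    have h3 : (s : ℝ) + 1 ≤ r := by exact_mod_cast this
    exact one_div_le_one_div_of_le (by exact_mod_cast hs) (by linarith)
  have h4 : (2 : ℝ) ≤ r := by exact_mod_cast hr2
  have h5 : 1 / (r : ℝ) < 1 / ((r : ℝ) - 1) := one_div_lt_one_div_of_lt (by linarith) (by linarith)
  linarith

theorem HeightLE.closedBall_eq {T : PlanarTree} {r : ℕ} (hT : T.HeightLE r) (hr : 1 ≤ r) :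
    Metric.closedBall T (1 / (r : ℝ)) = {T' | T'.rootBall r = T.verts} := by
  rw [PlanarTree.closedBall_eq T hr, hT.rootBall_eq]

theorem nu_real_closedBall (μ : ℝ) {r : ℕ} (hr : 1 ≤ r) {T : PlanarTree} (hT : T.HeightLE r)
    (N : ℕ+) :
    (nu μ N : Measure PlanarTree).real (Metric.closedBall T (1 / (r : ℝ))) =
      (∑ T' ∈ T.treesOver r N, weight μ T') / partitionFunction μ N := by
  classical
  have hZ := partitionFunction_pos μ N.pos
  have hm : MeasurableSet (Metric.closedBall T (1 / (r : ℝ))) := Metric.isClosed_closedBall.measurableSet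
  have hw : ∀ T' : PlanarTree, 0 ≤ weight μ T' / partitionFunction μ N :=
    fun T' => div_nonneg (Real.exp_pos _).le hZ.le
  have : (nu μ N : Measure PlanarTree) = gibbsMeasure μ N := rfl
  rw [measureReal_def, this, gibbsMeasure]
  simp only [Measure.coe_finsetSum, Finset.sum_apply, Measure.smul_apply, smul_eq_mul,
    Measure.dirac_apply' _ hm]
  rw [ENNReal.toReal_sum, treesOver, Finset.sum_filter, Finset.sum_div]
  · refine Finset.sum_congr rfl fun T' _ => ?_
    rw [ENNReal.toReal_mul, ENNReal.toReal_ofReal (hw T'), hT.closedBall_eq hr, Set.indicator_apply]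
    by_cases h : T'.rootBall r = T.verts <;> simp [h]
  · intro T' _
    refine ENNReal.mul_ne_top ENNReal.ofReal_ne_top ?_
    rw [Set.indicator_apply]
    split_ifs <;> simp

theorem nu_real_closedBall_eq {μ : ℝ} (hμ : 0 < μ) {r : ℕ} (hr : 1 ≤ r) {T : PlanarTree}
    (hT : T.HeightLE r) {a : ℕ} (ha : T.size = a) (ha1 : 1 ≤ a) {N : ℕ+} (hN : a < N) :
    (nu μ N : Measure PlanarTree).real (Metric.closedBall T (1 / (r : ℝ))) =
      Real.exp (-μ * ((r : ℝ) - 1)) * (weightedCount μ (T.levelFinset r).card (N - a) /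
        weightedCount μ 1 (N - 1)) := by
  have h1 : (1 - Real.exp (-μ)) ≠ 0 := by
    have : 0 < 1 - Real.exp (-μ) := by simpa using hμ
    exact this.ne'
  obtain ⟨n, hn⟩ := Nat.exists_eq_add_of_lt hN
  have e1 : (N : ℕ) = a + (n + 1) := by omega
  have e2 : (N : ℕ) = 1 + (N - 1) := by omega
  rw [nu_real_closedBall μ hr hT]
  conv_lhs => rw [e2, partitionFunction_eq hμ (by omega), ← e2, e1,
    sum_treesOver_weight hμ hr hT ha (by omega), mul_assoc, mul_assoc,
    mul_div_mul_left _ _ h1, mul_div_mul_comm, ← Real.exp_sub]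
  rw [show (N : ℕ) - a = n + 1 by omega]
  congr 2
  · ring
  · rw [e1]

end PlanarTree

/-! ### Generating functions and the Riccati equation. -/

section Series

open PowerSeries

/-- The generating function of the forests of height at most `m`, counted by edges. -/
noncomputable def forestSeries : ℕ → PowerSeries ℝ
  | 0 => 1
  | m + 1 => (1 - X * forestSeries m)⁻¹

theorem forestSeries_succ_mul (m : ℕ) : forestSeries (m + 1) * (1 - X * forestSeries m) = 1 := by
  rw [forestSeries]
  exact PowerSeries.inv_mul_cancel _ (by simp)

theorem sum_multichoose_mul_one_sub {R : Type*} [CommRing R] (x : R) (K L : ℕ) :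
    (∑ j ∈ Finset.range (L + 1), ((K + 1).multichoose j : R) * x ^ j) * (1 - x) =
      ∑ j ∈ Finset.range (L + 1), (K.multichoose j : R) * x ^ j -
        ((K + 1).multichoose L : R) * x ^ (L + 1) := by
  induction L with
  | zero => simp
  | succ L ih =>
    rw [Finset.sum_range_succ, add_mul, ih, Finset.sum_range_succ _ (L + 1),
      Nat.multichoose_succ_succ]
    push_cast
    ring

theorem coeff_eq_of_mul_isUnit {F G U : PowerSeries ℝ} {n : ℕ} (hU : constantCoeff U ≠ 0)
    (h : ∀ i ≤ n, coeff i (F * U) = coeff i (G * U)) : coeff n F = coeff n G := by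
  have h1 : F = F * U * U⁻¹ := by rw [mul_assoc, PowerSeries.mul_inv_cancel _ hU, mul_one]
  have h2 : G = G * U * U⁻¹ := by rw [mul_assoc, PowerSeries.mul_inv_cancel _ hU, mul_one]
  rw [h1, h2, coeff_mul, coeff_mul]
  refine Finset.sum_congr rfl fun p hp => ?_
  rw [h p.1 (by have := Finset.HasAntidiagonal.mem_antidiagonal.1 hp; omega)]

/-- This is the negative binomial series of `(1 - X F)^{-K}`, cut off at `L`. The error of the
truncated identity `sum_multichoose_mul_one_sub` is divisible by `X ^ (L + 1)`, so it is invisible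
up to order `L`. -/
theorem coeff_sum_multichoose (F G : PowerSeries ℝ) (h : G * (1 - X * F) = 1) (K L : ℕ) :
    ∀ n ≤ L, coeff n (∑ j ∈ Finset.range (L + 1), (K.multichoose j : PowerSeries ℝ) * (X * F) ^ j) =
      coeff n (G ^ K) := by
  induction K with
  | zero =>
    intro n _
    rw [Finset.sum_range_succ']
    simp
  | succ K ih =>
    intro n hn
    refine coeff_eq_of_mul_isUnit (U := 1 - X * F) (by simp) fun i hi => ?_
    rw [sum_multichoose_mul_one_sub, pow_succ G, mul_assoc, h, mul_one, map_sub, ih i (by omega),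
      mul_pow, mul_left_comm, coeff_X_pow_mul', if_neg (by omega), sub_zero]

theorem coeff_natCast_mul (k n : ℕ) (F : PowerSeries ℝ) :
    coeff n ((k : PowerSeries ℝ) * F) = k * coeff n F := by
  rw [← nsmul_eq_mul, map_nsmul, nsmul_eq_mul]

theorem extensionCount_eq_coeff (m : ℕ) : ∀ K n : ℕ,
    (extensionCount m K n : ℝ) = coeff n (forestSeries m ^ K) := by
  induction m with
  | zero =>
    intro K n
    rw [extensionCount, forestSeries, one_pow, coeff_one]
    split_ifs <;> simp
  | succ m ih =>
    intro K n
    rw [← coeff_sum_multichoose _ _ (forestSeries_succ_mul m) K n n le_rfl, extensionCount, map_sum]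
    push_cast
    refine Finset.sum_congr rfl fun j hj => ?_
    rw [Finset.mem_range] at hj
    rw [ih, mul_pow, mul_left_comm, coeff_X_pow_mul', if_pos (by omega), coeff_natCast_mul]

/-- The centred generating function `2 g B_m - 1`. -/
noncomputable def centredSeries (m : ℕ) : PowerSeries ℝ := 2 * (X * forestSeries m) - 1

/-- The centring makes the fixed points of the recursion symmetric: they are `±√(1 - 4X)`. -/
theorem centredSeries_succ_mul (m : ℕ) :
    centredSeries (m + 1) * (1 - centredSeries m) = 4 * X - 1 + centredSeries m := by
  have := forestSeries_succ_mul m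
  unfold centredSeries
  linear_combination 4 * X * this

/-- With `X = 1/(4 cos²θ)` the series is `-tan θ · cot((m + 2)θ)`, and this is the differential
equation of the cotangent. The proof stays with formal series: it differentiates the recursion and
inducts on `m`. -/
theorem riccati (m : ℕ) :
    2 * X * (4 * X - 1) * d⁄dX ℝ (centredSeries m) =
      ((m : PowerSeries ℝ) + 2) * (4 * X - 1) + ((m : PowerSeries ℝ) + 2) * centredSeries m ^ 2 +
        4 * X * centredSeries m := by
  have hnat : ∀ n : ℕ, d⁄dX ℝ (n : PowerSeries ℝ) = 0 := fun n => by simp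
  have h2 : d⁄dX ℝ (2 : PowerSeries ℝ) = 0 := hnat 2
  have h4 : d⁄dX ℝ (4 : PowerSeries ℝ) = 0 := hnat 4
  induction m with
  | zero =>
    have : d⁄dX ℝ (centredSeries 0) = 2 := by
      simp [centredSeries, forestSeries, h2]
    rw [this]
    simp only [centredSeries, forestSeries]
    push_cast
    ring
  | succ m ih =>
    have h := centredSeries_succ_mul m
    have hd := congrArg (d⁄dX ℝ) h
    simp only [Derivation.leibniz, map_sub, map_add, h4, derivative_X, smul_eq_mul,
      Derivation.map_one_eq_zero, mul_zero, mul_one, sub_zero, zero_sub, add_zero] at hd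
    -- The recursion and its derivative give the next series and its derivative only after
    -- multiplication by powers of `1 - Y`; this has constant coefficient `2`, so it can be
    -- cancelled.
    have hne : (1 - centredSeries m) ≠ 0 := by
      intro h0
      have := congrArg constantCoeff h0
      simp [centredSeries] at this
    have hne2 : (1 - centredSeries m) ^ 2 ≠ 0 := pow_ne_zero _ hne
    refine mul_right_cancel₀ hne2 ?_
    generalize centredSeries m = Y at *
    generalize centredSeries (m + 1) = Z at *
    generalize d⁄dX ℝ Y = dY at *
    generalize d⁄dX ℝ Z = dZ at *
    push_cast
    linear_combination (2 * X * (4 * X - 1) * (1 - Y)) * hd + 4 * X * ih +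
      (2 * X * (4 * X - 1) * dY - ((m : PowerSeries ℝ) + 3) * (Z * (1 - Y) + (4 * X - 1 + Y))
        - 4 * X * (1 - Y)) * h

theorem coeff_X_mul_derivative (F : PowerSeries ℝ) (n : ℕ) :
    coeff n (X * d⁄dX ℝ F) = n * coeff n F := by
  cases n with
  | zero => simp
  | succ n =>
    rw [coeff_succ_X_mul, coeff_derivative]
    push_cast
    ring

/-- Multiply the Riccati equation by `(R + 1) Y ^ R`: the product `Y ^ R · Y'` becomes the
derivative of `Y ^ (R + 1)`, so `Y ^ (R + 2)` is expressed linearly through the two lower powers. -/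
theorem coeff_centredSeries_pow (m R n : ℕ) :
    ((R : ℝ) + 1) * ((m + 2) * coeff (n + 1) (centredSeries m ^ (R + 2))) =
      2 * (4 * n * coeff n (centredSeries m ^ (R + 1)) -
        (n + 1) * coeff (n + 1) (centredSeries m ^ (R + 1))) -
      (R + 1) * (4 * coeff n (centredSeries m ^ (R + 1)) +
        (m + 2) * (4 * coeff n (centredSeries m ^ R) - coeff (n + 1) (centredSeries m ^ R))) := by
  have h := riccati m
  set Y := centredSeries m
  have hd : d⁄dX ℝ (Y ^ (R + 1)) = ((R : PowerSeries ℝ) + 1) * Y ^ R * d⁄dX ℝ Y := by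
    rw [derivative_pow]
    push_cast
    simp
  have key : ((R + 1 : ℕ) : PowerSeries ℝ) * (((m + 2 : ℕ) : PowerSeries ℝ) * Y ^ (R + 2)) =
      ((8 : ℕ) : PowerSeries ℝ) * (X * (X * d⁄dX ℝ (Y ^ (R + 1)))) -
      ((2 : ℕ) : PowerSeries ℝ) * (X * d⁄dX ℝ (Y ^ (R + 1))) -
      ((R + 1 : ℕ) : PowerSeries ℝ) * (((4 : ℕ) : PowerSeries ℝ) * (X * Y ^ (R + 1)) +
        ((m + 2 : ℕ) : PowerSeries ℝ) * (((4 : ℕ) : PowerSeries ℝ) * (X * Y ^ R) - Y ^ R)) := by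
    rw [hd]
    push_cast
    linear_combination -((R : PowerSeries ℝ) + 1) * Y ^ R * h
  have h2 := congrArg (coeff (n + 1)) key
  simp only [coeff_natCast_mul, map_sub, map_add, coeff_X_mul_derivative (Y ^ (R + 1)) (n + 1)] at h2
  simp only [coeff_succ_X_mul, coeff_X_mul_derivative] at h2
  push_cast at h2
  linear_combination h2

end Series

/-! ### Spectral expansion of the coefficients. -/

section Modes

open PowerSeries

/-- The closed form of a cosine sum; the bounds on `l` keep its denominator `sin (lπ/(2M))` nonzero.
Only the parity of `l` matters for the value. -/
theorem sum_cos_multiples {M l : ℕ} (hl : 0 < l) (hlM : l < 2 * M) :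
    ∑ k ∈ Finset.range M, Real.cos (l * (Real.pi * k / M)) = Real.sin (l * Real.pi / 2) ^ 2 := by
  have hM : (0 : ℝ) < M := by
    have : 0 < M := by omega
    exact_mod_cast this
  have hl' : (0 : ℝ) < l := by exact_mod_cast hl
  have hlM' : (l : ℝ) < 2 * M := by exact_mod_cast hlM
  have h := Real.sin_mul_sum_cos M (l * Real.pi / M) 0
  have hα : 0 < Real.sin (l * Real.pi / M / 2) := by
    apply Real.sin_pos_of_pos_of_lt_pi
    · positivity
    · rw [div_div, div_lt_iff₀ (by positivity)]
      nlinarith [Real.pi_pos]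
  refine mul_left_cancel₀ hα.ne' ?_
  have e1 : (M : ℝ) * (l * Real.pi / M) / 2 = l * Real.pi / 2 := by field_simp
  have e2 : ((M : ℝ) - 1) * (l * Real.pi / M) / 2 + 0 = l * Real.pi / 2 - l * Real.pi / M / 2 := by
    field_simp
    ring
  have e3 : 2 * Real.sin (l * Real.pi / 2) * Real.cos (l * Real.pi / 2) = 0 := by
    rw [← Real.sin_two_mul, mul_div_cancel₀ _ (two_ne_zero), Real.sin_nat_mul_pi]
  rw [e1, e2, Real.cos_sub] at h
  have e4 : ∑ k ∈ Finset.range M, Real.cos (l * (Real.pi * k / M)) =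
      ∑ i ∈ Finset.range M, Real.cos (l * Real.pi / M * i + 0) := by
    refine Finset.sum_congr rfl fun k _ => ?_
    congr 1
    ring
  rw [e4, h]
  linear_combination (Real.cos (l * Real.pi / M / 2) / 2) * e3

/-- The spectral representation of the number of walks of length `n` from `1` to `j` on the path
with vertices `1, …, M - 1`. -/
noncomputable def walkCount (M n j : ℕ) : ℝ :=
  2 / M * ∑ k ∈ Finset.range M, Real.sin (Real.pi * k / M) * Real.sin (j * (Real.pi * k / M)) *
    (2 * Real.cos (Real.pi * k / M)) ^ n

theorem walkCount_zero_right (M n : ℕ) : walkCount M n 0 = 0 := by simp [walkCount]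

theorem walkCount_self (M n : ℕ) : walkCount M n M = 0 := by
  rcases Nat.eq_zero_or_pos M with rfl | hM
  · simp [walkCount]
  · have hM' : (M : ℝ) ≠ 0 := by exact_mod_cast hM.ne'
    rw [walkCount, Finset.sum_eq_zero, mul_zero]
    intro k _
    have : (M : ℝ) * (Real.pi * k / M) = k * Real.pi := by field_simp
    rw [this, Real.sin_nat_mul_pi]
    ring

theorem walkCount_succ (M n j : ℕ) :
    walkCount M (n + 1) (j + 1) = walkCount M n j + walkCount M n (j + 2) := by
  simp only [walkCount]
  rw [← mul_add, ← Finset.sum_add_distrib]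
  congr 1
  refine Finset.sum_congr rfl fun k _ => ?_
  set x := Real.pi * k / M
  have e1 : ((j : ℕ) : ℝ) * x = ((j + 1 : ℕ) : ℝ) * x - x := by push_cast; ring
  have e2 : ((j + 2 : ℕ) : ℝ) * x = ((j + 1 : ℕ) : ℝ) * x + x := by push_cast; ring
  rw [e1, e2, Real.sin_sub, Real.sin_add, pow_succ]
  ring

/-- Orthogonality of sines: the product becomes cosines of the multiples `j - 1` and `j + 1`, which
have equal parity and so cancel unless `j = 1`. -/
theorem walkCount_zero_left {M j : ℕ} (hM : 2 ≤ M) (hj : 1 ≤ j) (hjM : j ≤ M) :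
    walkCount M 0 j = if j = 1 then 1 else 0 := by
  have hM' : (M : ℝ) ≠ 0 := by
    have : M ≠ 0 := by omega
    exact_mod_cast this
  obtain ⟨i, rfl⟩ : ∃ i, j = i + 1 := ⟨j - 1, by omega⟩
  have h1 : walkCount M 0 (i + 1) = 1 / M * (∑ k ∈ Finset.range M, Real.cos (i * (Real.pi * k / M)) -
      ∑ k ∈ Finset.range M, Real.cos ((i + 2 : ℕ) * (Real.pi * k / M))) := by
    rw [walkCount, ← Finset.sum_sub_distrib, Finset.mul_sum, Finset.mul_sum]
    refine Finset.sum_congr rfl fun k _ => ?_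
    set x := Real.pi * k / M
    have e1 : ((i : ℕ) : ℝ) * x = ((i + 1 : ℕ) : ℝ) * x - x := by push_cast; ring
    have e2 : ((i + 2 : ℕ) : ℝ) * x = ((i + 1 : ℕ) : ℝ) * x + x := by push_cast; ring
    rw [e1, e2, Real.cos_sub, Real.cos_add]
    ring
  have h2 : Real.sin ((i + 2 : ℕ) * Real.pi / 2) ^ 2 = Real.sin (i * Real.pi / 2) ^ 2 := by
    have : ((i + 2 : ℕ) : ℝ) * Real.pi / 2 = i * Real.pi / 2 + Real.pi := by push_cast; ring
    rw [this, Real.sin_add_pi]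
    ring
  rw [h1, sum_cos_multiples (l := i + 2) (by omega) (by omega), h2]
  by_cases hi : i = 0
  · subst hi
    simp [hM']
  · rw [sum_cos_multiples (by omega) (by omega), if_neg (by omega)]
    ring

theorem walkCount_eq_zero {M : ℕ} (hM : 2 ≤ M) (n : ℕ) : ∀ j, n + 1 < j → j ≤ M →
    walkCount M n j = 0 := by
  induction n with
  | zero =>
    intro j hj hjM
    rw [walkCount_zero_left hM (by omega) hjM, if_neg (by omega)]
  | succ n ih =>
    intro j hj hjM
    obtain ⟨i, rfl⟩ : ∃ i, j = i + 1 := ⟨j - 1, by omega⟩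
    rcases hjM.eq_or_lt with rfl | hlt
    · exact walkCount_self _ _
    · rw [walkCount_succ, ih i (by omega) (by omega), ih (i + 2) (by omega) (by omega), add_zero]

/-- The generating function of the walks from `1` to `j + 1`, with two steps counted as one. -/
noncomputable def walkSeries (M j : ℕ) : PowerSeries ℝ :=
  PowerSeries.mk fun n => walkCount M (2 * n + j) (j + 1)

theorem walkSeries_zero {M : ℕ} (hM : 2 ≤ M) : walkSeries M 0 = 1 + X * walkSeries M 1 := by
  ext n
  cases n with
  | zero => simp [walkSeries, walkCount_zero_left hM le_rfl (by omega)]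
  | succ n =>
    rw [map_add, coeff_succ_X_mul, coeff_one, if_neg (by omega), zero_add, walkSeries, walkSeries,
      coeff_mk, coeff_mk, show 2 * (n + 1) + 0 = 2 * n + 1 + 1 by ring, walkCount_succ,
      walkCount_zero_right, zero_add]

theorem walkSeries_succ {M j : ℕ} (hj : j + 3 ≤ M) :
    walkSeries M (j + 1) = walkSeries M j + X * walkSeries M (j + 2) := by
  ext n
  rw [map_add, walkSeries, coeff_mk, ← add_assoc, walkCount_succ, walkSeries, coeff_mk]
  congr 1
  cases n with
  | zero =>
    rw [coeff_zero_X_mul]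
    exact walkCount_eq_zero (by omega) _ _ (by omega) (by omega)
  | succ n =>
    rw [coeff_succ_X_mul, walkSeries, coeff_mk]
    congr 1
    ring

theorem walkSeries_last {M j : ℕ} (hj : j + 1 = M) : walkSeries M j = 0 := by
  ext n
  rw [walkSeries, coeff_mk, hj, walkCount_self, map_zero]

/-- Ratios of consecutive walk series obey the continued fraction of `forestSeries`. The induction
starts at the far end of the path, where the series vanishes, and comes down to `j = 0`. -/
theorem walkSeries_succ_eq {M : ℕ} (i : ℕ) : ∀ j, i + j + 3 = M →
    walkSeries M (j + 1) = forestSeries i * walkSeries M j := by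
  induction i with
  | zero =>
    intro j hj
    rw [walkSeries_succ (by omega), walkSeries_last (by omega : j + 2 + 1 = M), forestSeries]
    ring
  | succ i ih =>
    intro j hj
    have h1 := walkSeries_succ (M := M) (j := j) (by omega)
    rw [ih (j + 1) (by omega)] at h1
    linear_combination forestSeries (i + 1) * h1 - walkSeries M (j + 1) * forestSeries_succ_mul i

theorem walkSeries_zero_eq (m : ℕ) : walkSeries (m + 2) 0 = forestSeries m := by
  have h := walkSeries_zero (M := m + 2) (by omega)
  cases m with
  | zero =>
    rw [h, walkSeries_last (by omega), forestSeries]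
    ring
  | succ m =>
    rw [walkSeries_succ_eq m 0 (by omega)] at h
    linear_combination forestSeries (m + 1) * h - walkSeries _ 0 * forestSeries_succ_mul m

theorem coeff_forestSeries (m n : ℕ) :
    coeff n (forestSeries m) = 2 / ((m + 2 : ℕ) : ℝ) * ∑ k ∈ Finset.range (m + 2),
      Real.sin (Real.pi * k / (m + 2 : ℕ)) ^ 2 * (4 * Real.cos (Real.pi * k / (m + 2 : ℕ)) ^ 2) ^ n := by
  rw [← walkSeries_zero_eq, walkSeries, coeff_mk, walkCount]
  congr 1
  refine Finset.sum_congr rfl fun k _ => ?_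
  rw [add_zero, pow_mul, zero_add, Nat.cast_one, one_mul]
  ring

/-- The indices `1 ≤ k < M / 2` of the positive eigenvalues. -/
def modes (M : ℕ) : Finset ℕ := {k ∈ Finset.range M | 1 ≤ k ∧ 2 * k < M}

theorem mem_modes {M k : ℕ} : k ∈ modes M ↔ 1 ≤ k ∧ 2 * k < M := by
  simp only [modes, Finset.mem_filter, Finset.mem_range]
  omega

/-- The angle of a mode. -/
noncomputable def modeAngle (M k : ℕ) : ℝ := Real.pi * k / M

theorem sum_range_eq_two_mul_sum_modes {M : ℕ} {f : ℕ → ℝ} (h0 : f 0 = 0)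
    (hmid : ∀ k, 2 * k = M → f k = 0) (hsymm : ∀ k, k ≤ M → f (M - k) = f k) :
    ∑ k ∈ Finset.range M, f k = 2 * ∑ k ∈ modes M, f k := by
  have h1 : ∑ k ∈ modes M, f k = ∑ k ∈ Finset.range M with M < 2 * k, f k := by
    refine Finset.sum_nbij' (fun k => M - k) (fun k => M - k) ?_ ?_ ?_ ?_ ?_
    · intro k hk
      rw [mem_modes] at hk
      simp only [Finset.mem_filter, Finset.mem_range]
      omega
    · intro k hk
      simp only [Finset.mem_filter, Finset.mem_range] at hk
      rw [mem_modes]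
      omega
    · intro k hk
      rw [mem_modes] at hk
      omega
    · intro k hk
      simp only [Finset.mem_filter, Finset.mem_range] at hk
      omega
    · intro k hk
      rw [mem_modes] at hk
      exact (hsymm k (by omega)).symm
  rw [two_mul]
  nth_rewrite 2 [h1]
  rw [modes, Finset.sum_filter, Finset.sum_filter, ← Finset.sum_add_distrib]
  refine Finset.sum_congr rfl fun k hk => ?_
  rw [Finset.mem_range] at hk
  rcases Nat.eq_zero_or_pos k with rfl | hk0
  · simp [h0]
  · rcases lt_trichotomy (2 * k) M with h | h | h
    · rw [if_pos ⟨hk0, h⟩, if_neg (by omega), add_zero]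
    · rw [if_neg (by omega), if_neg (by omega), hmid k h, add_zero]
    · rw [if_neg (by omega), if_pos h, zero_add]

theorem modeAngle_pos {M k : ℕ} (h : k ∈ modes M) : 0 < modeAngle M k := by
  rw [mem_modes] at h
  have h1 : (0 : ℝ) < k := by exact_mod_cast (by omega : 0 < k)
  have h2 : (0 : ℝ) < M := by exact_mod_cast (by omega : 0 < M)
  have := Real.pi_pos
  rw [modeAngle]
  positivity

theorem modeAngle_lt {M k : ℕ} (h : k ∈ modes M) : modeAngle M k < Real.pi / 2 := by
  rw [mem_modes] at h
  have h1 : (2 : ℝ) * k < M := by exact_mod_cast h.2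
  have h2 : (0 : ℝ) < M := by exact_mod_cast (by omega : 0 < M)
  rw [modeAngle, div_lt_div_iff₀ h2 two_pos]
  nlinarith [Real.pi_pos]

theorem cos_modeAngle_pos {M k : ℕ} (h : k ∈ modes M) : 0 < Real.cos (modeAngle M k) :=
  Real.cos_pos_of_mem_Ioo ⟨by linarith [modeAngle_pos h, Real.pi_pos], modeAngle_lt h⟩

/-- The squared sine is written as `tan² · cos²` to absorb the shift of the exponent, and the terms
`k` and `M - k` are merged. The condition `1 ≤ n` removes the zero eigenvalue at `k = M/2`, which
contributes `0 ^ n`. -/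
theorem coeff_centredSeries (m n : ℕ) (hn : 1 ≤ n) :
    coeff (n + 1) (centredSeries m) = ∑ k ∈ modes (m + 2), 2 / ((m + 2 : ℕ) : ℝ) *
      Real.tan (modeAngle (m + 2) k) ^ 2 * (4 * Real.cos (modeAngle (m + 2) k) ^ 2) ^ (n + 1) := by
  have hM : ((m + 2 : ℕ) : ℝ) ≠ 0 := by positivity
  have h2 : (2 : PowerSeries ℝ) = ((2 : ℕ) : PowerSeries ℝ) := by norm_num
  rw [centredSeries, map_sub, coeff_one, if_neg (by omega), sub_zero, h2, coeff_natCast_mul,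
    coeff_succ_X_mul, coeff_forestSeries, sum_range_eq_two_mul_sum_modes, Finset.mul_sum,
    Finset.mul_sum, Finset.mul_sum]
  · refine Finset.sum_congr rfl fun k hk => ?_
    have := (cos_modeAngle_pos hk).ne'
    rw [Real.tan_eq_sin_div_cos, ← modeAngle]
    field_simp
    push_cast
    ring
  · simp
  · intro k hk
    have : Real.pi * k / (m + 2 : ℕ) = Real.pi / 2 := by
      rw [← hk] at hM ⊢
      push_cast at hM ⊢
      have hk0 : (k : ℝ) ≠ 0 := fun h => hM (by simp [h])
      field_simp
    rw [this, Real.cos_pi_div_two]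
    simp
    omega
  · intro k hk
    have : Real.pi * (m + 2 - k : ℕ) / (m + 2 : ℕ) = Real.pi - Real.pi * k / (m + 2 : ℕ) := by
      rw [Nat.cast_sub hk]
      field_simp
    rw [this, Real.sin_pi_sub, Real.cos_pi_sub]
    ring

end Modes

/-! ### Polynomials in the scaling variables and the factors of the modes. -/

/-- `F n t s` is a polynomial in `n t s`, `t` and `s`, and `c` is its value at `n t s = v`,
`t = 0`, `s = 0`. -/
inductive IsScalingPoly (v : ℝ) : (ℝ → ℝ → ℝ → ℝ) → ℝ → Prop
  | const (c : ℝ) : IsScalingPoly v (fun _ _ _ => c) c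
  | scale : IsScalingPoly v (fun n t s => n * t * s) v
  | fst : IsScalingPoly v (fun _ t _ => t) 0
  | snd : IsScalingPoly v (fun _ _ s => s) 0
  | add {F G : ℝ → ℝ → ℝ → ℝ} {c d : ℝ} : IsScalingPoly v F c → IsScalingPoly v G d →
      IsScalingPoly v (fun n t s => F n t s + G n t s) (c + d)
  | mul {F G : ℝ → ℝ → ℝ → ℝ} {c d : ℝ} : IsScalingPoly v F c → IsScalingPoly v G d →
      IsScalingPoly v (fun n t s => F n t s * G n t s) (c * d)

namespace IsScalingPoly

variable {v : ℝ} {F G : ℝ → ℝ → ℝ → ℝ} {c d : ℝ}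

theorem congr (hF : IsScalingPoly v F c) (h : ∀ n t s, G n t s = F n t s) (hc : d = c) :
    IsScalingPoly v G d := by
  have : G = F := by
    ext n t s
    exact h n t s
  rwa [this, hc]

theorem shift (hF : IsScalingPoly v F c) : IsScalingPoly v (fun n t s => F (n - 1) t s) c := by
  induction hF with
  | const c => exact const c
  | scale =>
    exact (scale.add ((const (-1)).mul (fst.mul snd))).congr (fun n t s => by ring) (by ring)
  | fst => exact fst
  | snd => exact snd
  | add _ _ hF hG => exact hF.add hG
  | mul _ _ hF hG => exact hF.mul hG

/-- Passing from `n` to `n - 1` changes the scaling variable by `-t s`; times `n s` this is `-s · (n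
t s)`, which is still polynomial and has value `0`. This handles the discrete derivatives in the
recursion. -/
theorem exists_difference (hF : IsScalingPoly v F c) :
    ∃ G, IsScalingPoly v G 0 ∧ ∀ n t s, n * s * (F (n - 1) t s - F n t s) = G n t s := by
  induction hF with
  | const c => exact ⟨_, const 0, fun n t s => by ring⟩
  | scale =>
    exact ⟨_, ((const (-1)).mul (snd.mul scale)).congr (fun n t s => rfl) (by ring),
      fun n t s => by ring⟩
  | fst => exact ⟨_, const 0, fun n t s => by ring⟩
  | snd => exact ⟨_, const 0, fun n t s => by ring⟩
  | add _ _ hF hG =>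
    obtain ⟨F', hF', eF⟩ := hF
    obtain ⟨G', hG', eG⟩ := hG
    exact ⟨_, (hF'.add hG').congr (fun n t s => rfl) (by ring),
      fun n t s => by linear_combination eF n t s + eG n t s⟩
  | @mul F G c d hF hG iF iG =>
    obtain ⟨F', hF', eF⟩ := iF
    obtain ⟨G', hG', eG⟩ := iG
    exact ⟨_, ((hF'.mul hG.shift).add (hF.mul hG')).congr (fun n t s => rfl) (by ring),
      fun n t s => by linear_combination G (n - 1) t s * eF n t s + F n t s * eG n t s⟩

end IsScalingPoly

/-- The factors by which the modes enter the coefficients of the powers of the centred series. -/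
noncomputable def modeFactor : ℕ → ℝ → ℝ → ℝ → ℝ
  | 0 => fun _ _ _ => 0
  | 1 => fun _ _ _ => 1
  | R + 2 => fun n t s =>
      2 * s / (R + 1) * ((n - 1) * (1 + t) * modeFactor (R + 1) (n - 1) t s -
        n * modeFactor (R + 1) n t s) - s * (1 + t) * modeFactor (R + 1) (n - 1) t s -
      ((1 + t) * modeFactor R (n - 1) t s - modeFactor R n t s)

/-- Of the first bracket only the term with `n t s` survives in the limit; the difference term has
value `0`, as does everything with an isolated `s`. The two copies of the lower factor cancel, so
`d` does not enter the result. -/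
theorem isScalingPoly_modeFactor_step {v : ℝ} {R : ℕ} {c d : ℝ}
    (h1 : IsScalingPoly v (modeFactor (R + 1)) c) (h0 : IsScalingPoly v (modeFactor R) d) :
    IsScalingPoly v (modeFactor (R + 2)) (2 * v / (R + 1) * c) := by
  obtain ⟨G, hG, eG⟩ := h1.exists_difference
  have A := ((IsScalingPoly.scale (v := v)).mul h1.shift).add (hG.add ((IsScalingPoly.const (-1)).mul
    (IsScalingPoly.snd.mul (((IsScalingPoly.const 1).add IsScalingPoly.fst).mul h1.shift))))
  have B := (IsScalingPoly.const (-1)).mul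
    (IsScalingPoly.snd.mul (((IsScalingPoly.const 1).add IsScalingPoly.fst).mul h1.shift))
  have D := (IsScalingPoly.const (-1)).mul ((((IsScalingPoly.const 1).add
    IsScalingPoly.fst).mul h0.shift).add ((IsScalingPoly.const (-1)).mul h0))
  refine ((((IsScalingPoly.const (2 / ((R : ℝ) + 1))).mul A).add B).add D).congr
    (fun n t s => ?_) (by ring)
  rw [← eG, modeFactor]
  ring

theorem isScalingPoly_modeFactor (μ : ℝ) (R : ℕ) :
    IsScalingPoly (μ / 2) (modeFactor (R + 1)) (μ ^ R / R.factorial) := by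
  induction R using Nat.strong_induction_on with
  | _ R ih =>
    match R with
    | 0 => exact (IsScalingPoly.const 1).congr (fun n t s => rfl) (by simp)
    | R + 1 =>
      -- Some value is enough here, since it cancels in the step; the factor of index `0` is outside
      -- the induction hypothesis.
      have h0 : ∃ d, IsScalingPoly (μ / 2) (modeFactor R) d := by
        match R with
        | 0 => exact ⟨0, IsScalingPoly.const 0⟩
        | R + 1 => exact ⟨_, ih R (by omega)⟩
      obtain ⟨d, h0⟩ := h0
      refine (isScalingPoly_modeFactor_step (ih R (by omega)) h0).congr (fun n t s => rfl) ?_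
      rw [Nat.factorial_succ]
      have : (R.factorial : ℝ) ≠ 0 := by positivity
      have : (R : ℝ) + 1 ≠ 0 := by positivity
      push_cast
      field_simp
      ring

theorem mul_one_add_tan_sq {M k : ℕ} (hk : k ∈ modes M) (n : ℕ) :
    (4 * Real.cos (modeAngle M k) ^ 2) ^ (n + 1) * (1 + Real.tan (modeAngle M k) ^ 2) =
      4 * (4 * Real.cos (modeAngle M k) ^ 2) ^ n := by
  have h := (cos_modeAngle_pos hk).ne'
  rw [pow_succ, mul_assoc, Real.tan_eq_sin_div_cos]
  have := Real.sin_sq_add_cos_sq (modeAngle M k)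
  field_simp
  linear_combination this

open PowerSeries in
-- `coeff_centredSeries_pow` acts mode by mode: a factor `4` at exponent `n - 1` becomes `1 + tan²θ`
-- at exponent `n`. Raising `R` by one consumes one index, whence `R < n`.
theorem coeff_centredSeries_pow_eq (m R : ℕ) : ∀ n : ℕ, R < n →
    coeff n (centredSeries m ^ R) = ∑ k ∈ modes (m + 2), 2 / ((m + 2 : ℕ) : ℝ) *
      Real.tan (modeAngle (m + 2) k) ^ 2 * (4 * Real.cos (modeAngle (m + 2) k) ^ 2) ^ n *
        modeFactor R n (Real.tan (modeAngle (m + 2) k) ^ 2) (1 / ((m + 2 : ℕ) : ℝ)) := by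
  induction R using Nat.strong_induction_on with
  | _ R ih =>
    match R with
    | 0 =>
      intro n hn
      simp only [pow_zero, coeff_one, if_neg hn.ne', modeFactor, mul_zero, Finset.sum_const_zero]
    | 1 =>
      intro n hn
      obtain ⟨i, rfl⟩ : ∃ i, n = i + 1 := ⟨n - 1, by omega⟩
      simp only [pow_one, modeFactor, mul_one]
      exact coeff_centredSeries m i (by omega)
    | R + 2 =>
      intro n hn
      obtain ⟨i, rfl⟩ : ∃ i, n = i + 1 := ⟨n - 1, by omega⟩
      have h := coeff_centredSeries_pow m R i
      rw [ih (R + 1) (by omega) i (by omega), ih (R + 1) (by omega) (i + 1) (by omega),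
        ih R (by omega) i (by omega), ih R (by omega) (i + 1) (by omega)] at h
      have hR : ((R : ℝ) + 1) ≠ 0 := by positivity
      have hM : ((m : ℝ) + 2) ≠ 0 := by positivity
      refine mul_left_cancel₀ hR (mul_left_cancel₀ hM ?_)
      rw [mul_left_comm, h]
      simp only [Finset.mul_sum, ← Finset.sum_sub_distrib, ← Finset.sum_add_distrib]
      refine Finset.sum_congr rfl fun k hk => ?_
      have e := mul_one_add_tan_sq hk i
      simp only [modeFactor]
      push_cast at e ⊢
      rw [show (i : ℝ) + 1 - 1 = i by ring]
      generalize modeFactor (R + 1) (i : ℝ) _ _ = p1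
      generalize modeFactor (R + 1) ((i : ℝ) + 1) _ _ = p2
      generalize modeFactor R (i : ℝ) _ _ = p3
      generalize modeFactor R ((i : ℝ) + 1) _ _ = p4
      generalize (4 * Real.cos (modeAngle (m + 2) k) ^ 2) ^ i = x at *
      generalize (4 * Real.cos (modeAngle (m + 2) k) ^ 2) ^ (i + 1) = x' at *
      generalize Real.tan (modeAngle (m + 2) k) ^ 2 = t at *
      field_simp
      linear_combination (-t * (2 * i * p1 - (R + 1) * p1 - (R + 1) * (m + 2) * p3)) * e

/-! ### The weights of the modes and the growth of their total. -/

/-- The weight `e^{-μM} (2/M) tan²θ cos^{2N}θ` of the mode `k` for the height bound `M`. -/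
noncomputable def modeWeight (μ : ℝ) (N : ℕ) (x : ℕ × ℕ) : ℝ :=
  if x.2 ∈ modes x.1 then Real.exp (-μ * x.1) * (2 / x.1) * Real.tan (modeAngle x.1 x.2) ^ 2 *
    (Real.cos (modeAngle x.1 x.2) ^ 2) ^ N else 0

/-- The squared tangent of the angle of a mode. -/
noncomputable def modeTan (x : ℕ × ℕ) : ℝ := Real.tan (modeAngle x.1 x.2) ^ 2

/-- The total weight of all modes. -/
noncomputable def totalWeight (μ : ℝ) (N : ℕ) : ℝ := ∑' x, modeWeight μ N x

section Weight

variable {μ : ℝ} {N : ℕ} {x : ℕ × ℕ}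

theorem modeWeight_nonneg (μ : ℝ) (N : ℕ) (x : ℕ × ℕ) : 0 ≤ modeWeight μ N x := by
  unfold modeWeight
  split_ifs <;> positivity

theorem modeTan_nonneg (x : ℕ × ℕ) : 0 ≤ modeTan x := sq_nonneg _

theorem modeWeight_of_notMem (h : x.2 ∉ modes x.1) : modeWeight μ N x = 0 := if_neg h

theorem three_le_of_mem_modes {M k : ℕ} (h : k ∈ modes M) : 3 ≤ M := by
  rw [mem_modes] at h
  omega

theorem modeWeight_pos (h : x.2 ∈ modes x.1) : 0 < modeWeight μ N x := by
  have h1 := cos_modeAngle_pos h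
  have h2 := Real.tan_pos_of_pos_of_lt_pi_div_two (modeAngle_pos h) (modeAngle_lt h)
  have h3 : (0 : ℝ) < x.1 := by
    have := three_le_of_mem_modes h
    exact_mod_cast (by omega : 0 < x.1)
  rw [modeWeight, if_pos h]
  positivity

theorem modeWeight_succ (μ : ℝ) (N : ℕ) (x : ℕ × ℕ) :
    modeWeight μ (N + 1) x = Real.cos (modeAngle x.1 x.2) ^ 2 * modeWeight μ N x := by
  unfold modeWeight
  split_ifs
  · ring
  · simp

theorem modeWeight_succ_eq (h : x.2 ∈ modes x.1) : modeWeight μ (N + 1) x =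
    Real.exp (-μ * x.1) * (2 / x.1) * Real.sin (modeAngle x.1 x.2) ^ 2 *
      (Real.cos (modeAngle x.1 x.2) ^ 2) ^ N := by
  have := (cos_modeAngle_pos h).ne'
  rw [modeWeight, if_pos h, Real.tan_eq_sin_div_cos]
  field_simp
  ring

theorem modeWeight_succ_mul (μ : ℝ) (N : ℕ) (x : ℕ × ℕ) :
    modeWeight μ (N + 1) x * (1 + modeTan x) = modeWeight μ N x := by
  by_cases h : x.2 ∈ modes x.1
  · have h1 := (cos_modeAngle_pos h).ne'
    have h2 := Real.sin_sq_add_cos_sq (modeAngle x.1 x.2)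
    rw [modeWeight_succ, modeTan, Real.tan_eq_sin_div_cos]
    field_simp
    linear_combination modeWeight μ N x * h2
  · simp [modeWeight_of_notMem h]

theorem modeWeight_add_mul (μ : ℝ) (N n : ℕ) (x : ℕ × ℕ) :
    modeWeight μ (N + n) x * (1 + modeTan x) ^ n = modeWeight μ N x := by
  induction n with
  | zero => simp
  | succ n ih => rw [← ih, ← add_assoc, pow_succ', ← mul_assoc, modeWeight_succ_mul]

theorem modeWeight_anti (μ : ℝ) (N : ℕ) (x : ℕ × ℕ) : modeWeight μ (N + 1) x ≤ modeWeight μ N x := by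
  rw [modeWeight_succ]
  exact mul_le_of_le_one_left (modeWeight_nonneg _ _ _) (Real.cos_sq_le_one _)

/-- One factor `cos²` tames the tangent, and `k ≤ M` splits `e^{-μM}` into a product of two
geometric terms in `M` and `k`. -/
theorem summable_modeWeight (hμ : 0 < μ) (hN : 1 ≤ N) : Summable (modeWeight μ N) := by
  have hg : Summable fun n : ℕ => Real.exp (-μ / 2) ^ n :=
    summable_geometric_of_lt_one (Real.exp_pos _).le (by rw [Real.exp_lt_one_iff]; linarith)
  refine Summable.of_nonneg_of_le (modeWeight_nonneg μ N) (fun x => ?_)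
    (hg.mul_of_nonneg hg (fun _ => by positivity) fun _ => by positivity)
  by_cases h : x.2 ∈ modes x.1
  · obtain ⟨n, rfl⟩ : ∃ n, N = n + 1 := ⟨N - 1, by omega⟩
    have hM : (3 : ℝ) ≤ x.1 := by exact_mod_cast three_le_of_mem_modes h
    have hk : (x.2 : ℝ) ≤ x.1 := by
      rw [mem_modes] at h
      exact_mod_cast (by omega : x.2 ≤ x.1)
    rw [modeWeight_succ_eq h]
    have h1 : 2 / (x.1 : ℝ) ≤ 1 := by
      rw [div_le_one (by linarith)]
      linarith
    have h2 : (Real.cos (modeAngle x.1 x.2) ^ 2) ^ n ≤ 1 :=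
      pow_le_one₀ (sq_nonneg _) (Real.cos_sq_le_one _)
    have h3 := Real.sin_sq_le_one (modeAngle x.1 x.2)
    calc _ ≤ Real.exp (-μ * x.1) * 1 * 1 * 1 := by gcongr
      _ ≤ Real.exp (-μ / 2) ^ x.1 * Real.exp (-μ / 2) ^ x.2 := by
        rw [← Real.exp_nat_mul, ← Real.exp_nat_mul, ← Real.exp_add, mul_one, mul_one, mul_one,
          Real.exp_le_exp]
        nlinarith
  · rw [modeWeight_of_notMem h]
    positivity

theorem totalWeight_pos (hμ : 0 < μ) (hN : 1 ≤ N) : 0 < totalWeight μ N :=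
  (summable_modeWeight hμ hN).tsum_pos (modeWeight_nonneg μ N) (3, 1)
    (modeWeight_pos (by simp [mem_modes]))

theorem exists_mode_cos_gt {c : ℝ} (hc : c < 1) :
    ∃ x : ℕ × ℕ, x.2 ∈ modes x.1 ∧ c < Real.cos (modeAngle x.1 x.2) ^ 2 := by
  have h1 : Tendsto (fun M : ℕ => Real.cos (modeAngle M 1) ^ 2) atTop (𝓝 (Real.cos 0 ^ 2)) := by
    refine ((Real.continuous_cos.tendsto 0).comp ?_).pow 2
    simp only [modeAngle, Nat.cast_one, mul_one]
    exact tendsto_const_div_atTop_nhds_zero_nat _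
  rw [Real.cos_zero, one_pow] at h1
  obtain ⟨M, h2, h3⟩ := ((h1.eventually_const_lt hc).and (eventually_ge_atTop 3)).exists
  exact ⟨(M, 1), by rw [mem_modes]; omega, h2⟩

theorem modeWeight_add (μ : ℝ) (n : ℕ) (x : ℕ × ℕ) :
    modeWeight μ (n + 1) x = (Real.cos (modeAngle x.1 x.2) ^ 2) ^ n * modeWeight μ 1 x := by
  induction n with
  | zero => simp
  | succ n ih => rw [modeWeight_succ, ih, pow_succ' (_ ^ 2), mul_assoc]

/-- Each weight decays like `(cos²θ) ^ N`, and `cos²θ` comes arbitrarily close to `1`. Modes with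
`cos²θ ≤ 1 - η` are therefore exponentially negligible against a single mode with `cos²θ > 1 - η`,
and each of the others loses at most a fraction `η` per step. -/
theorem tendsto_totalWeight_ratio (hμ : 0 < μ) :
    Tendsto (fun N => totalWeight μ (N + 1) / totalWeight μ N) atTop (𝓝 1) := by
  rw [← tendsto_add_atTop_iff_nat 1, Metric.tendsto_atTop]
  intro ε hε
  set η := min (ε / 2) (1 / 2) with hη
  have hη0 : 0 < η := by positivity
  have hη1 : η ≤ 1 / 2 := min_le_right _ _
  obtain ⟨x, hx, hc⟩ := exists_mode_cos_gt (by linarith : 1 - η < 1)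
  set c := Real.cos (modeAngle x.1 x.2) ^ 2
  have hc0 : 0 < c := by linarith
  have h1 : Tendsto (fun n : ℕ => totalWeight μ 1 / modeWeight μ 1 x * ((1 - η) / c) ^ n) atTop
      (𝓝 (totalWeight μ 1 / modeWeight μ 1 x * 0)) := by
    refine (tendsto_pow_atTop_nhds_zero_of_lt_one ?_ ?_).const_mul _
    · exact div_nonneg (by linarith) hc0.le
    · rwa [div_lt_one hc0]
  rw [mul_zero] at h1
  obtain ⟨n₀, hn₀⟩ := eventually_atTop.1 (h1.eventually_lt_const (half_pos hε))
  refine ⟨n₀, fun n hn => ?_⟩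
  have hS := totalWeight_pos hμ (N := n + 1) (by omega)
  have hs0 := summable_modeWeight hμ (N := n + 1) (by omega)
  have hs1 := summable_modeWeight hμ (N := n + 1 + 1) (by omega)
  have hle : totalWeight μ (n + 1 + 1) ≤ totalWeight μ (n + 1) :=
    hs1.tsum_le_tsum (modeWeight_anti μ _) hs0
  have hlow : modeWeight μ 1 x * c ^ n ≤ totalWeight μ (n + 1) := by
    rw [mul_comm, ← modeWeight_add]
    exact hs0.le_tsum x fun y _ => modeWeight_nonneg _ _ _
  have hpt : ∀ y, modeWeight μ (n + 1) y - modeWeight μ (n + 1 + 1) y ≤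
      η * modeWeight μ (n + 1) y + (1 - η) ^ n * modeWeight μ 1 y := by
    intro y
    have hw := modeWeight_nonneg μ (n + 1) y
    have hw1 := modeWeight_nonneg μ 1 y
    rw [modeWeight_succ μ (n + 1)]
    rcases le_total (1 - η) (Real.cos (modeAngle y.1 y.2) ^ 2) with h | h
    · have : 0 ≤ (1 - η) ^ n * modeWeight μ 1 y := mul_nonneg (pow_nonneg (by linarith) _) hw1
      nlinarith
    · have h2 : modeWeight μ (n + 1) y ≤ (1 - η) ^ n * modeWeight μ 1 y := by
        rw [modeWeight_add]
        exact mul_le_mul_of_nonneg_right (pow_le_pow_left₀ (sq_nonneg _) h n) hw1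
      have h3 : 0 ≤ Real.cos (modeAngle y.1 y.2) ^ 2 * modeWeight μ (n + 1) y := by positivity
      have h4 : 0 ≤ η * modeWeight μ (n + 1) y := by positivity
      linarith
  have hsum := (hs0.sub hs1).tsum_le_tsum hpt
    ((hs0.mul_left η).add ((summable_modeWeight hμ le_rfl).mul_left _))
  rw [hs0.tsum_sub hs1, (hs0.mul_left η).tsum_add ((summable_modeWeight hμ le_rfl).mul_left _),
    tsum_mul_left, tsum_mul_left] at hsum
  change totalWeight μ (n + 1) - totalWeight μ (n + 1 + 1) ≤
    η * totalWeight μ (n + 1) + (1 - η) ^ n * totalWeight μ 1 at hsum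
  have hx1 := modeWeight_pos (μ := μ) (N := 1) hx
  have h5 := hn₀ n hn
  have h6 : (1 - η) ^ n * totalWeight μ 1 < ε / 2 * totalWeight μ (n + 1) := by
    refine lt_of_lt_of_le ?_ (mul_le_mul_of_nonneg_left hlow (by positivity))
    rw [div_pow, div_mul_div_comm, div_lt_iff₀ (by positivity)] at h5
    linarith
  have h7 : η * totalWeight μ (n + 1) ≤ ε / 2 * totalWeight μ (n + 1) :=
    mul_le_mul_of_nonneg_right (min_le_left _ _) hS.le
  rw [Real.dist_eq, abs_sub_comm, abs_of_nonneg, sub_lt_iff_lt_add, ← sub_lt_iff_lt_add',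
    lt_div_iff₀ hS]
  · linarith
  · rw [sub_nonneg, div_le_one hS]
    exact hle

theorem tendsto_totalWeight_ratio_add (hμ : 0 < μ) (n : ℕ) :
    Tendsto (fun N => totalWeight μ (N + n) / totalWeight μ N) atTop (𝓝 1) := by
  induction n with
  | zero =>
    refine tendsto_const_nhds.congr' ?_
    filter_upwards [eventually_ge_atTop 1] with N hN
    rw [add_zero, div_self (totalWeight_pos hμ hN).ne']
  | succ n ih =>
    have h := (ih.mul ((tendsto_totalWeight_ratio hμ).comp (tendsto_add_atTop_nat n)))
    rw [mul_one] at h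
    refine h.congr' ?_
    filter_upwards [eventually_ge_atTop 1] with N hN
    have h1 := (totalWeight_pos hμ hN).ne'
    have h2 := (totalWeight_pos hμ (N := N + n) (by omega)).ne'
    simp only [Function.comp]
    rw [← add_assoc]
    field_simp

end Weight

/-! ### Comparison of the weights at neighbouring height bounds. -/

section Shift

variable {μ : ℝ}

theorem mul_sin_le_sin_mul {a θ : ℝ} (ha : 0 ≤ a) (ha1 : a ≤ 1) (hθ : 0 ≤ θ)
    (hθπ : θ ≤ Real.pi) : a * Real.sin θ ≤ Real.sin (a * θ) := by
  have := strictConcaveOn_sin_Icc.concaveOn.2 ⟨le_rfl, Real.pi_pos.le⟩ ⟨hθ, hθπ⟩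
    (by linarith : 0 ≤ 1 - a) ha (by ring)
  simpa using this

/-- With `k` fixed the angle shrinks by `θ/(M + 1)`, and the addition formula gives the cosine
factor. Concavity costs `M/(M + 1)` per sine; with the prefactor `2/M` this makes the cube. -/
theorem modeWeight_up_le {M k : ℕ} (h : k ∈ modes M) (n : ℕ) :
    modeWeight μ (n + 1) (M, k) * (Real.exp (-μ) * ((M : ℝ) / (M + 1)) ^ 3 *
      ((Real.cos (modeAngle M k / (M + 1)) +
        Real.tan (modeAngle M k) * Real.sin (modeAngle M k / (M + 1))) ^ 2) ^ n) ≤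
      modeWeight μ (n + 1) (M + 1, k) := by
  have h' : k ∈ modes (M + 1) := by
    rw [mem_modes] at h ⊢
    omega
  have hM : (3 : ℝ) ≤ M := by exact_mod_cast three_le_of_mem_modes h
  set θ := modeAngle M k with hθ
  have hc : Real.cos θ ≠ 0 := (cos_modeAngle_pos h).ne'
  have e1 : modeAngle (M + 1) k = θ - θ / (M + 1) := by
    rw [hθ, modeAngle, modeAngle]
    push_cast
    field_simp
    ring
  have e2 : θ - θ / (M + 1) = (M : ℝ) / (M + 1) * θ := by
    field_simp
    ring
  have e3 : Real.cos (modeAngle (M + 1) k) = Real.cos θ * (Real.cos (θ / (M + 1)) +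
      Real.tan θ * Real.sin (θ / (M + 1))) := by
    rw [e1, Real.cos_sub, Real.tan_eq_sin_div_cos]
    field_simp
  have e4 : (M : ℝ) / (M + 1) * Real.sin θ ≤ Real.sin (modeAngle (M + 1) k) := by
    rw [e1, e2]
    refine mul_sin_le_sin_mul (by positivity) ?_ (modeAngle_pos h).le ?_
    · rw [div_le_one (by linarith)]
      linarith
    · linarith [modeAngle_lt h, Real.pi_pos]
  have hs : 0 ≤ Real.sin θ := Real.sin_nonneg_of_nonneg_of_le_pi (modeAngle_pos h).le
    (by linarith [modeAngle_lt h, Real.pi_pos])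
  rw [modeWeight_succ_eq (x := (M, k)) h, modeWeight_succ_eq (x := (M + 1, k)) h']
  simp only [e3, mul_pow]
  rw [← hθ]
  have e5 : ((M : ℝ) / (M + 1)) ^ 2 * Real.sin θ ^ 2 ≤ Real.sin (modeAngle (M + 1) k) ^ 2 := by
    rw [← mul_pow]
    exact pow_le_pow_left₀ (by positivity) e4 2
  have e6 : Real.exp (-μ * ((M + 1 : ℕ) : ℝ)) = Real.exp (-μ * M) * Real.exp (-μ) := by
    rw [← Real.exp_add]
    push_cast
    ring_nf
  have e7 : 2 / ((M + 1 : ℕ) : ℝ) = 2 / M * ((M : ℝ) / (M + 1)) := by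
    push_cast
    field_simp
  rw [e6, e7]
  set A := (Real.cos θ ^ 2) ^ n
  set B := ((Real.cos (θ / (M + 1)) + Real.tan θ * Real.sin (θ / (M + 1))) ^ 2) ^ n
  have hA : 0 ≤ A := by positivity
  have hB : 0 ≤ B := by positivity
  calc _ = Real.exp (-μ * M) * Real.exp (-μ) * (2 / M * ((M : ℝ) / (M + 1))) * A * B *
        (((M : ℝ) / (M + 1)) ^ 2 * Real.sin θ ^ 2) := by ring
    _ ≤ Real.exp (-μ * M) * Real.exp (-μ) * (2 / M * ((M : ℝ) / (M + 1))) * A * B *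
        Real.sin (modeAngle (M + 1) k) ^ 2 := by
      gcongr
    _ = _ := by ring

/-- The angle grows by `θ/M`. Sine and prefactor both increase, so only the exponential and the
cosine factor have to be tracked. -/
theorem modeWeight_down_le {M k : ℕ} (h : k ∈ modes M) (n : ℕ) :
    modeWeight μ (n + 1) (M + 1, k) * (Real.exp μ *
      ((Real.cos (modeAngle (M + 1) k / M) -
        Real.tan (modeAngle (M + 1) k) * Real.sin (modeAngle (M + 1) k / M)) ^ 2) ^ n) ≤
      modeWeight μ (n + 1) (M, k) := by
  have h' : k ∈ modes (M + 1) := by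
    rw [mem_modes] at h ⊢
    omega
  have hM : (3 : ℝ) ≤ M := by exact_mod_cast three_le_of_mem_modes h
  set θ := modeAngle (M + 1) k with hθ
  have hc : Real.cos θ ≠ 0 := (cos_modeAngle_pos h').ne'
  have e1 : modeAngle M k = θ + θ / M := by
    rw [hθ, modeAngle, modeAngle]
    push_cast
    field_simp
  have e3 : Real.cos (modeAngle M k) = Real.cos θ * (Real.cos (θ / M) -
      Real.tan θ * Real.sin (θ / M)) := by
    rw [e1, Real.cos_add, Real.tan_eq_sin_div_cos]
    field_simp
  have hs : 0 ≤ Real.sin θ := Real.sin_nonneg_of_nonneg_of_le_pi (modeAngle_pos h').le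
    (by linarith [modeAngle_lt h', Real.pi_pos])
  have hθ0 := modeAngle_pos h'
  have e4 : Real.sin θ ≤ Real.sin (modeAngle M k) := by
    refine Real.sin_le_sin_of_le_of_le_pi_div_two (by linarith [Real.pi_pos]) (modeAngle_lt h).le ?_
    rw [e1]
    have : 0 ≤ θ / M := by positivity
    linarith
  rw [modeWeight_succ_eq (x := (M, k)) h, modeWeight_succ_eq (x := (M + 1, k)) h']
  simp only [e3, mul_pow]
  rw [← hθ]
  have e5 : Real.sin θ ^ 2 ≤ Real.sin (modeAngle M k) ^ 2 := pow_le_pow_left₀ hs e4 2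
  have e6 : Real.exp (-μ * M) = Real.exp (-μ * ((M + 1 : ℕ) : ℝ)) * Real.exp μ := by
    rw [← Real.exp_add]
    push_cast
    ring_nf
  have e7 : 2 / ((M + 1 : ℕ) : ℝ) ≤ 2 / M := by
    push_cast
    gcongr
    linarith
  rw [e6]
  set A := (Real.cos θ ^ 2) ^ n
  set B := ((Real.cos (θ / M) - Real.tan θ * Real.sin (θ / M)) ^ 2) ^ n
  have hA : 0 ≤ A := by positivity
  have hB : 0 ≤ B := by positivity
  calc _ = Real.exp (-μ * ((M + 1 : ℕ) : ℝ)) * Real.exp μ * (2 / ((M + 1 : ℕ) : ℝ)) * A * B *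
        Real.sin θ ^ 2 := by ring
    _ ≤ Real.exp (-μ * ((M + 1 : ℕ) : ℝ)) * Real.exp μ * (2 / M) * A * B *
        Real.sin (modeAngle M k) ^ 2 := by
      gcongr
    _ = _ := by ring

theorem summable_modeWeight_up (hμ : 0 < μ) {N : ℕ} (hN : 1 ≤ N) :
    Summable (fun x : ℕ × ℕ => modeWeight μ N (x.1 + 1, x.2)) :=
  (summable_modeWeight hμ hN).comp_injective (i := fun x : ℕ × ℕ => (x.1 + 1, x.2))
    fun x y h => by simpa [Prod.ext_iff] using h

theorem tsum_modeWeight_up_le (hμ : 0 < μ) {N : ℕ} (hN : 1 ≤ N) :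
    ∑' x : ℕ × ℕ, modeWeight μ N (x.1 + 1, x.2) ≤ totalWeight μ N :=
  tsum_comp_le_tsum_of_inj (summable_modeWeight hμ hN) (modeWeight_nonneg μ N)
    (i := fun x : ℕ × ℕ => (x.1 + 1, x.2)) fun x y h => by simpa [Prod.ext_iff] using h

/-- Truncated subtraction sends the height bound `0` to `0`, where there are no modes, so the sum is
preserved exactly. -/
theorem hasSum_modeWeight_down (hμ : 0 < μ) {N : ℕ} (hN : 1 ≤ N) :
    HasSum (fun x : ℕ × ℕ => modeWeight μ N (x.1 - 1, x.2)) (totalWeight μ N) := by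
  have hinj : Function.Injective (fun x : ℕ × ℕ => (x.1 + 1, x.2)) :=
    fun x y h => by simpa [Prod.ext_iff] using h
  refine (hinj.hasSum_iff ?_).1 ?_
  · rintro ⟨M, k⟩ hx
    obtain rfl : M = 0 := by
      by_contra h
      exact hx ⟨(M - 1, k), by simp; omega⟩
    exact modeWeight_of_notMem (by simp [mem_modes])
  · exact (summable_modeWeight hμ hN).hasSum

end Shift

/-! ### Elementary inequalities for the weight ratios. -/

section Bounds

/-- A crude lower bound, uniform over all angles, for the moment estimates. -/
theorem one_add_le_cos_add {θ M : ℝ} (h0 : 0 < θ) (h1 : θ < Real.pi / 2) (hM : 3 ≤ M) :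
    1 + θ * Real.tan θ / (2 * M) ≤
      Real.cos (θ / (M + 1)) + Real.tan θ * Real.sin (θ / (M + 1)) := by
  have hT : θ < Real.tan θ := Real.lt_tan h0 h1
  set T := Real.tan θ
  set δ := θ / (M + 1) with hδ
  have hδ0 : 0 < δ := by positivity
  have hθδ : θ = δ * (M + 1) := by rw [hδ]; field_simp
  have hδ4 : δ ≤ θ / 4 := by rw [hδ]; gcongr; linarith
  have hδ1 : δ ≤ 1 / 2 := by linarith [Real.pi_le_four]
  have hc := Real.one_sub_sq_div_two_le_cos (x := δ)
  have hs := (Real.sin_gt_sub_cube hδ0).le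
  have h2 : T * (δ - δ ^ 3 / 6) ≤ T * Real.sin δ := mul_le_mul_of_nonneg_left hs (by linarith)
  have h3 : δ ^ 2 / 2 ≤ T * δ / 8 := by nlinarith
  have h4 : δ ^ 2 ≤ 1 / 4 := by nlinarith
  have h5 : T * (δ ^ 3 / 6) ≤ T * δ / 24 := by
    have : 0 ≤ T * δ := by nlinarith
    nlinarith
  have h6 : θ * T / (2 * M) ≤ T * δ * (2 / 3) := by
    rw [div_le_iff₀ (by linarith), hθδ]
    have : 0 ≤ T * δ := by nlinarith
    nlinarith
  have : 0 ≤ T * δ := by nlinarith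
  -- The quadratic and cubic errors cost `1/8` and `1/24` of `T δ`; the remaining `5/6` exceeds the
  -- `2/3` needed.
  nlinarith

section Small

variable {θ s ε : ℝ}

theorem tan_mul_le (h0 : 0 < θ) (h1 : θ < Real.pi / 2) (hT : Real.tan θ ≤ ε) (hε : ε ≤ 1 / 10) :
    Real.tan θ * (1 - ε) ≤ θ := by
  have hθT : θ < Real.tan θ := Real.lt_tan h0 h1
  have hc := Real.one_sub_sq_div_two_le_cos (x := θ)
  have hcos : 0 < Real.cos θ := Real.cos_pos_of_mem_Ioo ⟨by linarith, h1⟩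
  have h2 : 1 - ε ≤ Real.cos θ := by nlinarith
  calc Real.tan θ * (1 - ε) ≤ Real.tan θ * Real.cos θ :=
        mul_le_mul_of_nonneg_left h2 (by linarith)
    _ = Real.sin θ := Real.tan_mul_cos hcos.ne'
    _ ≤ θ := Real.sin_le h0.le

theorem exp_mul_one_sub_le {q : ℝ} (hq : 0 ≤ q) (hqε : q ≤ ε) (hε : ε ≤ 1 / 10) :
    Real.exp (q * (1 - 5 * ε)) ≤ 1 + q * (1 - 2 * ε) := by
  have hz : q * (1 - 5 * ε) ≤ q := mul_le_of_le_one_right hq (by linarith)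
  have hz0 : 0 ≤ q * (1 - 5 * ε) := mul_nonneg hq (by linarith)
  have hy : q * (1 - 2 * ε) ≤ q := mul_le_of_le_one_right hq (by linarith)
  have e1 := Real.one_sub_le_exp_neg (q * (1 - 5 * ε))
  rw [Real.exp_neg, le_inv_comm₀ (by linarith) (Real.exp_pos _)] at e1
  refine e1.trans ?_
  rw [inv_le_iff_one_le_mul₀ (by linarith)]
  have e3 : q * (1 - 2 * ε) * (q * (1 - 5 * ε)) ≤ q * ε :=
    mul_le_mul hy (hz.trans hqε) hz0 hq
  have e4 : 0 ≤ q * ε := mul_nonneg hq (hq.trans hqε)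
  linarith

theorem exp_neg_mul_one_add_le {q : ℝ} (hq : 0 ≤ q) (hqε : q ≤ ε) (hε : ε ≤ 1 / 10) :
    Real.exp (-(q * (1 + 10 * ε))) ≤ 1 - q * (1 + 3 * ε) := by
  have hε0 : 0 ≤ ε := hq.trans hqε
  have hz : q * (1 + 10 * ε) ≤ q * 2 := mul_le_mul_of_nonneg_left (by linarith) hq
  have hz0 : 0 ≤ q * (1 + 10 * ε) := by positivity
  have hy : q * (1 + 3 * ε) ≤ q * 2 := mul_le_mul_of_nonneg_left (by linarith) hq
  have e1 := Real.add_one_le_exp (q * (1 + 10 * ε))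
  rw [Real.exp_neg]
  refine (inv_anti₀ (by linarith) e1).trans ?_
  rw [inv_le_iff_one_le_mul₀ (by linarith)]
  have e3 : q * (1 + 3 * ε) * (q * (1 + 10 * ε)) ≤ q * 2 * (ε * 2) :=
    mul_le_mul hy (by linarith) hz0 (by linarith)
  have e4 : 0 ≤ q * ε := mul_nonneg hq hε0
  linarith

/-- The sharp bound for small angles, to be used with `s = 1/M`: the ratio is at least about `e^{T²
s}`. The condition `π s ≤ θ` expresses `k ≥ 1` and forces `s ≤ ε/3`. -/
theorem exp_le_cos_add (h0 : 0 < θ) (h1 : θ < Real.pi / 2) (hT : Real.tan θ ≤ ε) (hε : ε ≤ 1 / 10)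
    (hs : 0 < s) (hsθ : Real.pi * s ≤ θ) :
    Real.exp (Real.tan θ ^ 2 * s * (1 - 5 * ε)) ≤
      Real.cos (θ * s / (1 + s)) + Real.tan θ * Real.sin (θ * s / (1 + s)) := by
  have hθT : θ < Real.tan θ := Real.lt_tan h0 h1
  have hTθ := tan_mul_le h0 h1 hT hε
  set T := Real.tan θ
  have hε0 : 0 < ε := by linarith
  have hs3 : s ≤ ε / 3 := by nlinarith [Real.pi_gt_three]
  set δ := θ * s / (1 + s) with hδ
  have hδ0 : 0 < δ := by positivity
  have hδs : δ * (1 + s) = θ * s := by rw [hδ]; field_simp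
  have hδ1 : δ ≤ T * s := by nlinarith
  have hδ2 : T * s * (1 - 4 / 3 * ε) ≤ δ := by
    have e1 : θ * s * (1 - s) ≤ δ := by nlinarith [mul_pos hδ0 hs, mul_pos (mul_pos hδ0 hs) hs]
    have e2 : T * (1 - ε) * (s * (1 - s)) ≤ θ * (s * (1 - s)) :=
      mul_le_mul_of_nonneg_right hTθ (mul_nonneg hs.le (by linarith))
    have e3 : T * s * (1 - 4 / 3 * ε) ≤ T * s * ((1 - ε) * (1 - s)) := by
      refine mul_le_mul_of_nonneg_left ?_ (by nlinarith)
      nlinarith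
    nlinarith
  have hc := Real.one_sub_sq_div_two_le_cos (x := δ)
  have hsin := (Real.sin_gt_sub_cube hδ0).le
  have h2 : T * (δ - δ ^ 3 / 6) ≤ T * Real.sin δ := mul_le_mul_of_nonneg_left hsin (by linarith)
  have hTδ : 0 < T * δ := by nlinarith
  have h3 : δ ^ 2 / 2 ≤ T * δ * (ε / 6) := by
    have : δ ≤ T * (ε / 3) := hδ1.trans (mul_le_mul_of_nonneg_left hs3 (by linarith))
    nlinarith
  have hδε : δ ≤ ε := by nlinarith
  have h4 : T * (δ ^ 3 / 6) ≤ T * δ * (ε / 6) := by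
    have : δ ^ 2 ≤ ε := by nlinarith
    nlinarith
  have h5 : T * δ * (1 - ε / 3) ≥ T ^ 2 * s * (1 - 2 * ε) := by
    have e1 : T * (1 - ε / 3) * (T * s * (1 - 4 / 3 * ε)) ≤ T * (1 - ε / 3) * δ :=
      mul_le_mul_of_nonneg_left hδ2 (mul_nonneg (by linarith) (by linarith))
    have e2 : T ^ 2 * s * (1 - 2 * ε) ≤ T ^ 2 * s * ((1 - ε / 3) * (1 - 4 / 3 * ε)) := by
      refine mul_le_mul_of_nonneg_left ?_ (by positivity)
      nlinarith
    linarith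
  set q := T ^ 2 * s with hq
  have hq0 : 0 < q := by have : 0 < T := by linarith
                         positivity
  have hqε : q ≤ ε := by
    have : T ^ 2 ≤ 1 := by nlinarith
    nlinarith
  have h6 := exp_mul_one_sub_le hq0.le hqε hε
  linarith

theorem exp_le_cos_sub (h0 : 0 < θ) (h1 : θ < Real.pi / 2) (hT : Real.tan θ ≤ ε) (hε : ε ≤ 1 / 10)
    (hs : 0 < s) (hsθ : Real.pi * s ≤ θ) :
    Real.exp (-(Real.tan θ ^ 2 * s * (1 + 10 * ε))) ≤
      Real.cos (θ * s / (1 - s)) - Real.tan θ * Real.sin (θ * s / (1 - s)) := by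
  have hθT : θ < Real.tan θ := Real.lt_tan h0 h1
  set T := Real.tan θ
  have hε0 : 0 < ε := by linarith
  have hs3 : s ≤ ε / 3 := by nlinarith [Real.pi_gt_three]
  have hs1 : 0 < 1 - s := by linarith
  set δ := θ * s / (1 - s) with hδ
  have hδ0 : 0 < δ := by positivity
  have hδ1 : δ ≤ T * s * (1 + ε) := by
    rw [hδ, div_le_iff₀ hs1]
    have e1 : θ * s ≤ T * s := by nlinarith
    have e2 : T * s * 1 ≤ T * s * ((1 + ε) * (1 - s)) := by
      refine mul_le_mul_of_nonneg_left ?_ (by nlinarith)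
      nlinarith
    linarith
  have hc := Real.one_sub_sq_div_two_le_cos (x := δ)
  have h2 : T * Real.sin δ ≤ T * δ := mul_le_mul_of_nonneg_left (Real.sin_le hδ0.le) (by linarith)
  have hTδ : 0 < T * δ := by nlinarith
  have h3 : δ ^ 2 / 2 ≤ T * δ * ε := by
    have : s * (1 + ε) ≤ ε := by nlinarith
    have : δ ≤ T * ε := by nlinarith
    nlinarith
  have h5 : T * δ * (1 + ε) ≤ T ^ 2 * s * (1 + 3 * ε) := by
    have e1 : T * (1 + ε) * δ ≤ T * (1 + ε) * (T * s * (1 + ε)) :=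
      mul_le_mul_of_nonneg_left hδ1 (mul_nonneg (by linarith) (by linarith))
    have e2 : T ^ 2 * s * ((1 + ε) * (1 + ε)) ≤ T ^ 2 * s * (1 + 3 * ε) := by
      refine mul_le_mul_of_nonneg_left ?_ (by positivity)
      nlinarith
    linarith
  set q := T ^ 2 * s with hq
  have hq0 : 0 < q := by have : 0 < T := by linarith
                         positivity
  have hqε : q ≤ ε := by
    have : T ^ 2 ≤ 1 := by nlinarith
    nlinarith
  have h6 := exp_neg_mul_one_add_le hq0.le hqε hε
  linarith

end Small

theorem two_add_sq_le_exp_add (x : ℝ) : 2 + x ^ 2 ≤ Real.exp x + Real.exp (-x) := by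
  have h1 : |x / 2| ≤ |Real.sinh (x / 2)| := by
    rw [Real.abs_sinh]
    exact Real.self_le_sinh_iff.2 (abs_nonneg _)
  have h2 := sq_le_sq.2 h1
  have h3 := Real.cosh_two_mul (x / 2)
  have h4 := Real.cosh_sq (x / 2)
  rw [mul_div_cancel₀ _ (two_ne_zero), Real.cosh_eq] at h3
  linarith

/-- Here `a` and `b` stand for the weight ratios upwards and downwards. Up to errors of order `ε`
this is `x² ≤ e^x + e^{-x} - 2` with `x = 2u - μ`. -/
theorem min_sq_one_le {μ u ε a b : ℝ} (hμ : 0 < μ) (hu : 0 ≤ u) (hε0 : 0 < ε) (hε : ε ≤ 1 / 10)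
    (ha : (1 - 2 * ε) * Real.exp (2 * u - μ - 10 * ε * u) ≤ a)
    (hb : Real.exp (μ - 2 * u - 20 * ε * u) ≤ b) :
    min ((2 * u - μ) ^ 2) 1 ≤
      a + b - 2 + (20 * (μ + 2) + 2) * (2 + (2 * (μ + 2) + μ) ^ 2) * ε := by
  have hb0 : 0 ≤ b := (Real.exp_pos _).le.trans hb
  -- For bounded `u` the errors `ε u` are of order `ε`. For larger `u` the ratio `a` alone is at
  -- least `4`, which is enough because the left side is capped at `1`.
  rcases le_or_gt u (μ + 2) with h | h
  · set x := 2 * u - μ with hx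
    set κ := Real.exp (-(20 * ε * u)) with hκ
    have hκ0 : 0 < κ := Real.exp_pos _
    have hκ1 : κ ≤ 1 := by
      rw [hκ, Real.exp_le_one_iff]
      nlinarith
    have hκ2 : 1 - 20 * (μ + 2) * ε ≤ κ := by
      have := Real.one_sub_le_exp_neg (20 * ε * u)
      nlinarith
    have e1 : κ * Real.exp x ≤ Real.exp (2 * u - μ - 10 * ε * u) := by
      rw [hκ, ← Real.exp_add, Real.exp_le_exp]
      nlinarith
    have e2 : κ * Real.exp (-x) ≤ b := by
      refine le_trans (le_of_eq ?_) hb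
      rw [hκ, ← Real.exp_add]
      congr 1
      rw [hx]
      ring
    have e3 : (1 - 2 * ε) * (κ * Real.exp x) ≤ a :=
      (mul_le_mul_of_nonneg_left e1 (by linarith)).trans ha
    have e4 : (1 - 2 * ε) * (κ * Real.exp (-x)) ≤ b := by
      have : 0 ≤ κ * Real.exp (-x) := by positivity
      nlinarith
    have e5 := two_add_sq_le_exp_add x
    have e6 : (1 - 2 * ε) * κ * (2 + x ^ 2) ≤ a + b := by
      have : (1 - 2 * ε) * κ * (2 + x ^ 2) ≤ (1 - 2 * ε) * κ * (Real.exp x + Real.exp (-x)) :=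
        mul_le_mul_of_nonneg_left e5 (mul_nonneg (by linarith) hκ0.le)
      linarith
    have e7 : 1 - (20 * (μ + 2) + 2) * ε ≤ (1 - 2 * ε) * κ := by nlinarith
    have e8 : (1 - (20 * (μ + 2) + 2) * ε) * (2 + x ^ 2) ≤ (1 - 2 * ε) * κ * (2 + x ^ 2) :=
      mul_le_mul_of_nonneg_right e7 (by positivity)
    have e9 : x ^ 2 ≤ (2 * (μ + 2) + μ) ^ 2 := by
      rw [hx]
      apply sq_le_sq'
      · linarith
      · linarith
    have e10 : (20 * (μ + 2) + 2) * ε * (2 + x ^ 2) ≤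
        (20 * (μ + 2) + 2) * ε * (2 + (2 * (μ + 2) + μ) ^ 2) := by
      gcongr
    refine (min_le_left _ _).trans ?_
    linarith
  · have e1 : 2 ≤ 2 * u - μ - 10 * ε * u := by nlinarith
    have e2 : (5 : ℝ) ≤ Real.exp 2 := by
      have := Real.quadratic_le_exp_of_nonneg (x := 2) (by norm_num)
      linarith
    have e3 : (4 : ℝ) ≤ a := by
      have := Real.exp_le_exp.2 e1
      nlinarith
    have e4 : 0 ≤ (20 * (μ + 2) + 2) * (2 + (2 * (μ + 2) + μ) ^ 2) * ε := by positivity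
    refine (min_le_right _ _).trans ?_
    linarith

end Bounds

/-- The scaling variable `N tan²θ / M` of a mode. -/
noncomputable def modeScale (N : ℕ) (x : ℕ × ℕ) : ℝ := N * modeTan x * (1 / x.1)

/-! ### Moments of the scaling variable. -/

section Moments

variable {μ : ℝ} {N : ℕ} {x : ℕ × ℕ}

theorem modeScale_nonneg (N : ℕ) (x : ℕ × ℕ) : 0 ≤ modeScale N x := by
  have := modeTan_nonneg x
  unfold modeScale
  positivity

theorem pow_div_le_one_add_pow {y : ℝ} (hy : 0 ≤ y) {p n : ℕ} (hp : 1 ≤ p) (hn : 2 * p + 1 ≤ n) :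
    (((n + 1 : ℕ) : ℝ) * y / (2 * p)) ^ (2 * p) ≤ ((1 + y) ^ 2) ^ n := by
  -- Bernoulli is applied to `(1 + y) ^ q`, and the result is raised to the power `2p`. The size of
  -- `n` ensures `q ≥ (n + 1)/(2p)` despite the floor.
  set q := n / p
  have hq1 : p * q ≤ n := Nat.mul_div_le n p
  have hq2 : n < p * (q + 1) := Nat.lt_mul_div_succ n (by omega)
  have hp0 : (0 : ℝ) < p := by exact_mod_cast hp
  have h1 : ((n + 1 : ℕ) : ℝ) / (2 * p) ≤ q := by
    rw [div_le_iff₀ (by positivity)]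
    have : n + 1 ≤ q * (2 * p) := by nlinarith
    exact_mod_cast this
  have h2 : ((n + 1 : ℕ) : ℝ) * y / (2 * p) ≤ (1 + y) ^ q := by
    have := one_add_mul_le_pow (by linarith : (-2 : ℝ) ≤ y) q
    have h3 : ((n + 1 : ℕ) : ℝ) * y / (2 * p) = ((n + 1 : ℕ) : ℝ) / (2 * p) * y := by ring
    rw [h3]
    have := mul_le_mul_of_nonneg_right h1 hy
    linarith
  calc _ ≤ ((1 + y) ^ q) ^ (2 * p) := pow_le_pow_left₀ (by positivity) h2 _
    _ = (1 + y) ^ (q * (2 * p)) := (pow_mul _ _ _).symm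
    _ ≤ (1 + y) ^ (2 * n) := pow_le_pow_right₀ (by linarith) (by nlinarith)
    _ = _ := by rw [pow_mul]

/-- The upward weight ratio grows at least like any fixed power of `N θ tan θ / M`. That power is
thus paid for by moving to the next height bound, and summation gives moments bounded by the total
weight. -/
theorem modeWeight_mul_pow_le {p n : ℕ} (hp : 1 ≤ p) (hn : 2 * p + 1 ≤ n)
    (h : x.2 ∈ modes x.1) :
    modeWeight μ (n + 1) x * (((n + 1 : ℕ) : ℝ) * (modeAngle x.1 x.2 *
      Real.tan (modeAngle x.1 x.2)) / x.1) ^ (2 * p) ≤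
      Real.exp μ * (4 / 3) ^ 3 * (4 * p) ^ (2 * p) * modeWeight μ (n + 1) (x.1 + 1, x.2) := by
  obtain ⟨M, k⟩ := x
  simp only at h ⊢
  have hM : (3 : ℝ) ≤ M := by exact_mod_cast three_le_of_mem_modes h
  have hp0 : (0 : ℝ) < p := by exact_mod_cast hp
  have h1 := modeWeight_up_le (μ := μ) h n
  have h2 := one_add_le_cos_add (modeAngle_pos h) (modeAngle_lt h) hM
  have hT : 0 < Real.tan (modeAngle M k) :=
    Real.tan_pos_of_pos_of_lt_pi_div_two (modeAngle_pos h) (modeAngle_lt h)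
  have hθ := modeAngle_pos h
  set θ := modeAngle M k
  set T := Real.tan θ
  have h3 := pow_div_le_one_add_pow (y := θ * T / (2 * M)) (by positivity) hp hn
  set A := Real.cos (θ / (M + 1)) + T * Real.sin (θ / (M + 1))
  have h4 : ((1 + θ * T / (2 * M)) ^ 2) ^ n ≤ (A ^ 2) ^ n := by gcongr
  have h5 : (3 / 4 : ℝ) ≤ M / (M + 1) := by
    rw [div_le_div_iff₀ (by norm_num) (by linarith)]
    linarith
  have h6 : (3 / 4 : ℝ) ^ 3 ≤ ((M : ℝ) / (M + 1)) ^ 3 := by gcongr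
  have hw := modeWeight_nonneg μ (n + 1) (M, k)
  have e1 : ((n + 1 : ℕ) : ℝ) * (θ * T) / M =
      4 * p * (((n + 1 : ℕ) : ℝ) * (θ * T / (2 * M)) / (2 * p)) := by
    field_simp
    ring
  have e2 : Real.exp μ * Real.exp (-μ) = 1 := by rw [← Real.exp_add, add_neg_cancel, Real.exp_zero]
  set V := (((n + 1 : ℕ) : ℝ) * (θ * T / (2 * M)) / (2 * p)) ^ (2 * p)
  rw [e1, mul_pow]
  calc modeWeight μ (n + 1) (M, k) * ((4 * p : ℝ) ^ (2 * p) * V)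
      = Real.exp μ * (4 / 3) ^ 3 * (4 * p) ^ (2 * p) * (modeWeight μ (n + 1) (M, k) *
          (Real.exp (-μ) * (3 / 4) ^ 3 * V)) := by
        linear_combination (-(modeWeight μ (n + 1) (M, k) * ((4 * p : ℝ) ^ (2 * p) * V))) * e2
    _ ≤ Real.exp μ * (4 / 3) ^ 3 * (4 * p) ^ (2 * p) * (modeWeight μ (n + 1) (M, k) *
          (Real.exp (-μ) * ((M : ℝ) / (M + 1)) ^ 3 * (A ^ 2) ^ n)) := by
        have := h3.trans h4
        gcongr
    _ ≤ _ := by gcongr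

theorem tan_sq_le_sq_mul (h : x.2 ∈ modes x.1) :
    modeTan x ≤ modeAngle x.1 x.2 ^ 2 * (1 + modeTan x) := by
  have hc := cos_modeAngle_pos h
  have h1 := Real.sin_le (modeAngle_pos h).le
  have h2 : 0 ≤ Real.sin (modeAngle x.1 x.2) :=
    Real.sin_nonneg_of_nonneg_of_le_pi (modeAngle_pos h).le
      (by linarith [modeAngle_lt h, Real.pi_pos])
  have h3 := Real.sin_sq_add_cos_sq (modeAngle x.1 x.2)
  have h4 : Real.sin (modeAngle x.1 x.2) ^ 2 ≤ modeAngle x.1 x.2 ^ 2 := pow_le_pow_left₀ h2 h1 2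
  rw [modeTan, Real.tan_eq_sin_div_cos, div_pow]
  have e : 1 + Real.sin (modeAngle x.1 x.2) ^ 2 / Real.cos (modeAngle x.1 x.2) ^ 2 =
      1 / Real.cos (modeAngle x.1 x.2) ^ 2 := by
    field_simp
    linarith
  rw [e, mul_one_div]
  gcongr

/-- From `sin θ ≤ θ` one gets `u² ≤ v² (1 + t)` with `v = N θ tan θ / M`; the arithmetic-geometric
inequality then separates the two factors. -/
theorem modeScale_pow_le (p : ℕ) (h : x.2 ∈ modes x.1) :
    modeScale N x ^ p ≤ ((N : ℝ) * (modeAngle x.1 x.2 * Real.tan (modeAngle x.1 x.2)) / x.1) ^ (2 * p) +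
      (1 + modeTan x) ^ p := by
  set v := (N : ℝ) * (modeAngle x.1 x.2 * Real.tan (modeAngle x.1 x.2)) / x.1
  have ht := modeTan_nonneg x
  have h1 : modeScale N x ^ 2 ≤ v ^ 2 * (1 + modeTan x) := by
    have h2 := tan_sq_le_sq_mul h
    have e1 : modeScale N x ^ 2 = ((N : ℝ) / x.1) ^ 2 * modeTan x * modeTan x := by
      rw [modeScale]
      ring
    have e2 : v ^ 2 * (1 + modeTan x) = ((N : ℝ) / x.1) ^ 2 * modeTan x *
        (modeAngle x.1 x.2 ^ 2 * (1 + modeTan x)) := by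
      simp only [v, modeTan]
      ring
    rw [e1, e2]
    gcongr
  refine le_of_sq_le_sq ?_ (by rw [pow_mul]; positivity)
  have h3 : (modeScale N x ^ p) ^ 2 ≤ v ^ (2 * p) * (1 + modeTan x) ^ p := by
    rw [← pow_mul, mul_comm p 2, pow_mul, pow_mul, ← mul_pow]
    exact pow_le_pow_left₀ (sq_nonneg _) h1 p
  have h4 : 0 ≤ v ^ (2 * p) := by rw [pow_mul]; positivity
  have h5 : 0 ≤ (1 + modeTan x) ^ p := by positivity
  nlinarith

/-- Since `1 + tan² = 1/cos²`, the factor only lowers the exponent `N` by `p`, and ratios of total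
weights tend to `1`. -/
theorem eventually_tsum_one_add_modeTan_pow_le (hμ : 0 < μ) (p : ℕ) :
    ∀ᶠ N in atTop, Summable (fun x => modeWeight μ N x * (1 + modeTan x) ^ p) ∧
      ∑' x, modeWeight μ N x * (1 + modeTan x) ^ p ≤ 2 * totalWeight μ N := by
  have h1 := (tendsto_totalWeight_ratio_add hμ p).eventually_const_lt (by norm_num : (1 / 2 : ℝ) < 1)
  obtain ⟨N₀, hN₀⟩ := eventually_atTop.1 (h1.and (eventually_ge_atTop 1))
  filter_upwards [eventually_ge_atTop (N₀ + p)] with N hN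
  obtain ⟨n, rfl⟩ : ∃ n, N = n + p := ⟨N - p, by omega⟩
  obtain ⟨h2, h3⟩ := hN₀ n (by omega)
  simp only [modeWeight_add_mul]
  refine ⟨summable_modeWeight hμ h3, ?_⟩
  rw [lt_div_iff₀ (totalWeight_pos hμ h3)] at h2
  change totalWeight μ n ≤ _
  linarith

theorem eventually_tsum_modeScale_pow_le (hμ : 0 < μ) (p : ℕ) :
    ∃ C : ℝ, ∀ᶠ N in atTop, Summable (fun x => modeWeight μ N x * modeScale N x ^ p) ∧
      ∑' x, modeWeight μ N x * modeScale N x ^ p ≤ C * totalWeight μ N := by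
  rcases Nat.eq_zero_or_pos p with rfl | hp
  · refine ⟨1, ?_⟩
    filter_upwards [eventually_ge_atTop 1] with N hN
    simp only [pow_zero, mul_one, one_mul]
    exact ⟨summable_modeWeight hμ hN, le_rfl⟩
  · set D := Real.exp μ * (4 / 3) ^ 3 * (4 * p) ^ (2 * p) with hD
    have hD0 : 0 ≤ D := by positivity
    refine ⟨D + 2, ?_⟩
    filter_upwards [eventually_ge_atTop (2 * p + 2),
      eventually_tsum_one_add_modeTan_pow_le hμ p] with N hN h1
    obtain ⟨n, rfl⟩ : ∃ n, N = n + 1 := ⟨N - 1, by omega⟩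
    have hpt : ∀ x, modeWeight μ (n + 1) x * modeScale (n + 1) x ^ p ≤
        D * modeWeight μ (n + 1) (x.1 + 1, x.2) + modeWeight μ (n + 1) x * (1 + modeTan x) ^ p := by
      intro x
      by_cases h : x.2 ∈ modes x.1
      · have h2 := mul_le_mul_of_nonneg_left (modeScale_pow_le (N := n + 1) p h)
          (modeWeight_nonneg μ (n + 1) x)
        have h3 := modeWeight_mul_pow_le (μ := μ) (n := n) hp (by omega) h
        rw [mul_add] at h2
        rw [← hD] at h3
        linarith
      · rw [modeWeight_of_notMem h, zero_mul, zero_mul, add_zero]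
        exact mul_nonneg hD0 (modeWeight_nonneg _ _ _)
    have hs1 := (summable_modeWeight_up hμ (N := n + 1) (by omega)).mul_left D
    have hs2 := hs1.add h1.1
    have hs : Summable (fun x => modeWeight μ (n + 1) x * modeScale (n + 1) x ^ p) :=
      Summable.of_nonneg_of_le (fun x => mul_nonneg (modeWeight_nonneg _ _ _)
        (pow_nonneg (modeScale_nonneg _ _) _)) hpt hs2
    refine ⟨hs, (hs.tsum_le_tsum hpt hs2).trans ?_⟩
    rw [hs1.tsum_add h1.1, tsum_mul_left]
    have h4 := mul_le_mul_of_nonneg_left (tsum_modeWeight_up_le hμ (N := n + 1) (by omega)) hD0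
    linarith [h1.2]

theorem eventually_tsum_pow_le (hμ : 0 < μ) (p : ℕ) :
    ∃ C : ℝ, ∀ᶠ N in atTop,
      Summable (fun x => modeWeight μ N x * (1 + modeScale N x + modeTan x) ^ p) ∧
      ∑' x, modeWeight μ N x * (1 + modeScale N x + modeTan x) ^ p ≤ C * totalWeight μ N := by
  obtain ⟨C, hC⟩ := eventually_tsum_modeScale_pow_le hμ p
  refine ⟨2 ^ (p - 1) * (2 + C), ?_⟩
  filter_upwards [hC, eventually_tsum_one_add_modeTan_pow_le hμ p] with N h1 h2
  have hpt : ∀ x, modeWeight μ N x * (1 + modeScale N x + modeTan x) ^ p ≤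
      2 ^ (p - 1) * (modeWeight μ N x * (1 + modeTan x) ^ p + modeWeight μ N x * modeScale N x ^ p) := by
    intro x
    have h3 := add_pow_le (by linarith [modeTan_nonneg x] : 0 ≤ 1 + modeTan x)
      (modeScale_nonneg N x) p
    have h4 := mul_le_mul_of_nonneg_left h3 (modeWeight_nonneg μ N x)
    calc _ = modeWeight μ N x * (1 + modeTan x + modeScale N x) ^ p := by ring
      _ ≤ _ := h4
      _ = _ := by ring
  have hs2 := (h2.1.add h1.1).mul_left (2 ^ (p - 1))
  have hs : Summable (fun x => modeWeight μ N x * (1 + modeScale N x + modeTan x) ^ p) :=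
    Summable.of_nonneg_of_le (fun x => mul_nonneg (modeWeight_nonneg _ _ _)
      (pow_nonneg (by linarith [modeScale_nonneg N x, modeTan_nonneg x]) _)) hpt hs2
  refine ⟨hs, (hs.tsum_le_tsum hpt hs2).trans ?_⟩
  rw [tsum_mul_left, h2.1.tsum_add h1.1, mul_assoc]
  refine mul_le_mul_of_nonneg_left ?_ (by positivity)
  linarith [h1.2, h2.2]

end Moments

/-! ### Concentration of the scaling variable at `μ/2`. -/

section Concentration

variable {μ : ℝ} {N : ℕ} {x : ℕ × ℕ}

theorem pi_div_le_modeAngle {M k : ℕ} (h : k ∈ modes M) : Real.pi * (1 / M) ≤ modeAngle M k := by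
  have hk : (1 : ℝ) ≤ k := by
    rw [mem_modes] at h
    exact_mod_cast h.1
  rw [modeAngle, mul_one_div]
  gcongr
  nlinarith [Real.pi_pos]

/-- Smallness of `s = 1/M` follows from that of `t = tan²θ`, so `s` needs no estimate of its own. -/
theorem inv_sq_le_modeTan (h : x.2 ∈ modes x.1) : (1 / (x.1 : ℝ)) ^ 2 ≤ modeTan x := by
  have h1 := pi_div_le_modeAngle h
  have h2 := Real.lt_tan (modeAngle_pos h) (modeAngle_lt h)
  have h3 : 0 ≤ 1 / (x.1 : ℝ) := by positivity
  rw [modeTan]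
  refine pow_le_pow_left₀ h3 ?_ 2
  nlinarith [Real.pi_gt_three]

theorem modeWeight_up_ge {ε : ℝ} (hε : ε ≤ 1 / 10) (h : x.2 ∈ modes x.1)
    (hT : Real.tan (modeAngle x.1 x.2) ≤ ε) (n : ℕ) :
    modeWeight μ (n + 1) x * ((1 - 2 * ε) * Real.exp (2 * modeScale (n + 1) x - μ -
      10 * ε * modeScale (n + 1) x)) ≤ modeWeight μ (n + 1) (x.1 + 1, x.2) := by
  obtain ⟨M, k⟩ := x
  simp only at h hT ⊢
  have hM : (3 : ℝ) ≤ M := by exact_mod_cast three_le_of_mem_modes h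
  have h1 := modeWeight_up_le (μ := μ) h n
  have hθ := modeAngle_pos h
  have hθT := Real.lt_tan hθ (modeAngle_lt h)
  have hs := pi_div_le_modeAngle h
  have h2 := exp_le_cos_add hθ (modeAngle_lt h) hT hε (s := 1 / (M : ℝ)) (by positivity) hs
  have e0 : modeAngle M k * (1 / M) / (1 + 1 / M) = modeAngle M k / (M + 1) := by
    field_simp
  rw [e0] at h2
  refine le_trans (mul_le_mul_of_nonneg_left ?_ (modeWeight_nonneg _ _ _)) h1
  set A := Real.cos (modeAngle M k / (M + 1)) +
    Real.tan (modeAngle M k) * Real.sin (modeAngle M k / (M + 1))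
  have eu : modeScale (n + 1) (M, k) = (n + 1) * (Real.tan (modeAngle M k) ^ 2 * (1 / M)) := by
    rw [modeScale, modeTan]
    push_cast
    ring
  set T := Real.tan (modeAngle M k)
  have hε0 : 0 < ε := by linarith
  have hs3 : 1 / (M : ℝ) ≤ ε / 3 := by
    have : 0 < 1 / (M : ℝ) := by positivity
    nlinarith [Real.pi_gt_three]
  have h3 : 1 - ε ≤ ((M : ℝ) / (M + 1)) ^ 3 := by
    have e1 : 1 - ε / 3 ≤ (M : ℝ) / (M + 1) := by
      rw [le_div_iff₀ (by linarith)]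
      rw [div_le_iff₀ (by linarith)] at hs3
      linarith
    have e2 : (1 - ε / 3) ^ 3 ≤ ((M : ℝ) / (M + 1)) ^ 3 := pow_le_pow_left₀ (by linarith) e1 3
    have e3 := one_add_mul_le_pow (by linarith : (-2 : ℝ) ≤ -(ε / 3)) 3
    have e4 : (1 + -(ε / 3)) ^ 3 = (1 - ε / 3) ^ 3 := by ring
    rw [e4] at e3
    push_cast at e3
    linarith
  set y := T ^ 2 * (1 / (M : ℝ)) with hy
  have hy0 : 0 ≤ y := by positivity
  have hyε : 2 * y ≤ ε := by
    have : T ^ 2 ≤ 1 := by nlinarith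
    have : y ≤ 1 * (ε / 3) := mul_le_mul this hs3 (by positivity) zero_le_one
    linarith
  have h4 : Real.exp (2 * n * (y * (1 - 5 * ε))) ≤ (A ^ 2) ^ n := by
    calc _ = (Real.exp (y * (1 - 5 * ε)) ^ 2) ^ n := by
          rw [← pow_mul, ← Real.exp_nat_mul]
          push_cast
          ring_nf
      _ ≤ _ := by gcongr
  rw [eu]
  -- The cosine ratio has exponent `2n` while the scale uses `n + 1`; the difference is paid for by
  -- `2y ≤ ε`. This factor and the cube of `M/(M + 1)` account for `1 - 2ε`.
  have h5 : Real.exp (-ε) * Real.exp (2 * ((n + 1) * y) - 10 * ε * ((n + 1) * y)) ≤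
      Real.exp (2 * n * (y * (1 - 5 * ε))) := by
    rw [← Real.exp_add, Real.exp_le_exp]
    nlinarith
  have h6 := Real.one_sub_le_exp_neg ε
  have e7 : Real.exp (2 * ((n + 1) * y) - μ - 10 * ε * ((n + 1) * y)) =
      Real.exp (-μ) * Real.exp (2 * ((n + 1) * y) - 10 * ε * ((n + 1) * y)) := by
    rw [← Real.exp_add]
    ring_nf
  rw [e7]
  set E := Real.exp (2 * ((n + 1) * y) - 10 * ε * ((n + 1) * y))
  have hE : 0 < E := Real.exp_pos _
  have h8 : (1 - ε) * E ≤ (A ^ 2) ^ n :=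
    ((mul_le_mul_of_nonneg_right h6 hE.le).trans h5).trans h4
  have h9 : 1 - 2 * ε ≤ (1 - ε) * (1 - ε) := by nlinarith
  calc (1 - 2 * ε) * (Real.exp (-μ) * E) ≤ (1 - ε) * (1 - ε) * (Real.exp (-μ) * E) := by gcongr
    _ = Real.exp (-μ) * (1 - ε) * ((1 - ε) * E) := by ring
    _ ≤ Real.exp (-μ) * ((M : ℝ) / (M + 1)) ^ 3 * (A ^ 2) ^ n :=
      mul_le_mul (mul_le_mul_of_nonneg_left h3 (Real.exp_pos _).le) h8
        (mul_nonneg (by linarith) hE.le) (by positivity)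

theorem modeWeight_down_ge {ε : ℝ} (hε : ε ≤ 1 / 10) (h : x.2 ∈ modes x.1)
    (hT : Real.tan (modeAngle x.1 x.2) ≤ ε) (n : ℕ) :
    modeWeight μ (n + 1) x * Real.exp (μ - 2 * modeScale (n + 1) x -
      20 * ε * modeScale (n + 1) x) ≤ modeWeight μ (n + 1) (x.1 - 1, x.2) := by
  obtain ⟨M, k⟩ := x
  simp only at h hT ⊢
  have hM3 := three_le_of_mem_modes h
  obtain ⟨m, rfl⟩ : ∃ m, M = m + 1 := ⟨M - 1, by omega⟩
  have hθ := modeAngle_pos h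
  have hθT := Real.lt_tan hθ (modeAngle_lt h)
  have hm2 : (2 : ℝ) ≤ m := by exact_mod_cast (by omega : 2 ≤ m)
  -- Lowering the height bound could push the angle to `π/2` or beyond; the small tangent rules this
  -- out.
  have h' : k ∈ modes m := by
    rw [mem_modes] at h ⊢
    refine ⟨h.1, ?_⟩
    have h1 : modeAngle (m + 1) k ≤ 1 / 10 := by linarith
    rw [modeAngle, div_le_iff₀ (by positivity)] at h1
    push_cast at h1
    have h2 : (2 : ℝ) * k < m := by nlinarith [Real.pi_gt_three]
    exact_mod_cast h2
  have h1 := modeWeight_down_le (μ := μ) h' n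
  have hs := pi_div_le_modeAngle h
  have h2 := exp_le_cos_sub hθ (modeAngle_lt h) hT hε (s := 1 / ((m + 1 : ℕ) : ℝ)) (by positivity) hs
  have e0 : modeAngle (m + 1) k * (1 / ((m + 1 : ℕ) : ℝ)) / (1 - 1 / ((m + 1 : ℕ) : ℝ)) =
      modeAngle (m + 1) k / m := by
    have : (m : ℝ) ≠ 0 := by positivity
    have e : 1 - 1 / ((m + 1 : ℕ) : ℝ) = m / ((m + 1 : ℕ) : ℝ) := by
      field_simp
      push_cast
      ring
    rw [e]
    field_simp
  rw [e0] at h2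
  rw [Nat.add_sub_cancel]
  refine le_trans (mul_le_mul_of_nonneg_left ?_ (modeWeight_nonneg _ _ _)) h1
  set A := Real.cos (modeAngle (m + 1) k / m) -
    Real.tan (modeAngle (m + 1) k) * Real.sin (modeAngle (m + 1) k / m)
  have eu : modeScale (n + 1) (m + 1, k) =
      (n + 1) * (Real.tan (modeAngle (m + 1) k) ^ 2 * (1 / ((m + 1 : ℕ) : ℝ))) := by
    rw [modeScale, modeTan]
    push_cast
    ring
  have hε0 : 0 < ε := by linarith
  set y := Real.tan (modeAngle (m + 1) k) ^ 2 * (1 / ((m + 1 : ℕ) : ℝ)) with hy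
  have hy0 : 0 ≤ y := by positivity
  have h4 : Real.exp (-(2 * n * (y * (1 + 10 * ε)))) ≤ (A ^ 2) ^ n := by
    calc _ = (Real.exp (-(y * (1 + 10 * ε))) ^ 2) ^ n := by
          rw [← pow_mul, ← Real.exp_nat_mul]
          push_cast
          ring_nf
      _ ≤ _ := by gcongr
  rw [eu]
  have h5 : Real.exp (μ - 2 * ((n + 1) * y) - 20 * ε * ((n + 1) * y)) ≤
      Real.exp μ * Real.exp (-(2 * n * (y * (1 + 10 * ε)))) := by
    rw [← Real.exp_add, Real.exp_le_exp]
    nlinarith [mul_nonneg hy0 hε0.le]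
  exact h5.trans (mul_le_mul_of_nonneg_left h4 (Real.exp_pos _).le)

/-- The right side is a second difference of the weight in `M` plus errors. Modes with `tan θ ≤ ε`
are governed by `min_sq_one_le`; the others are charged to the last term. -/
theorem modeWeight_mul_min_le (hμ : 0 < μ) : ∃ C : ℝ, 0 < C ∧ ∀ ε : ℝ, 0 < ε → ε ≤ 1 / 10 →
    ∀ (n : ℕ) (x : ℕ × ℕ), modeWeight μ (n + 1) x * min ((2 * modeScale (n + 1) x - μ) ^ 2) 1 ≤
      modeWeight μ (n + 1) (x.1 + 1, x.2) + modeWeight μ (n + 1) (x.1 - 1, x.2) +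
        (C * ε - 2) * modeWeight μ (n + 1) x + 3 / ε ^ 2 * (modeWeight μ (n + 1) x * modeTan x) := by
  refine ⟨(20 * (μ + 2) + 2) * (2 + (2 * (μ + 2) + μ) ^ 2), by positivity,
    fun ε hε0 hε n x => ?_⟩
  set C := (20 * (μ + 2) + 2) * (2 + (2 * (μ + 2) + μ) ^ 2)
  have hC : 0 < C := by positivity
  have hup := modeWeight_nonneg μ (n + 1) (x.1 + 1, x.2)
  have hdown := modeWeight_nonneg μ (n + 1) (x.1 - 1, x.2)
  have hw := modeWeight_nonneg μ (n + 1) x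
  have ht := modeTan_nonneg x
  by_cases h : x.2 ∈ modes x.1
  · rcases le_or_gt (Real.tan (modeAngle x.1 x.2)) ε with hT | hT
    · have ha := modeWeight_up_ge (μ := μ) hε h hT n
      have hb := modeWeight_down_ge (μ := μ) hε h hT n
      have hm := min_sq_one_le hμ (modeScale_nonneg (n + 1) x) hε0 hε le_rfl le_rfl
      have h1 := mul_le_mul_of_nonneg_left hm hw
      have h2 : 0 ≤ 3 / ε ^ 2 * (modeWeight μ (n + 1) x * modeTan x) := by positivity
      nlinarith
    -- The `3` covers the capped square, at most `1`, and the `-2` of the second difference.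
    · have h1 : 3 ≤ 3 / ε ^ 2 * modeTan x := by
        rw [div_mul_eq_mul_div, le_div_iff₀ (by positivity), modeTan]
        have := pow_le_pow_left₀ hε0.le hT.le 2
        linarith
      have h2 := mul_le_mul_of_nonneg_left (min_le_right ((2 * modeScale (n + 1) x - μ) ^ 2) 1) hw
      have h3 := mul_le_mul_of_nonneg_left h1 hw
      have h4 : 0 ≤ C * ε * modeWeight μ (n + 1) x := by positivity
      nlinarith
  · rw [modeWeight_of_notMem (x := x) h]
    simp only [zero_mul, mul_zero, add_zero]
    positivity

/-- The weight at `N + 1` times `tan²θ` is the decrease of the weight from `N` to `N + 1`, so the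
average is a ratio of totals minus one. -/
theorem tendsto_tsum_modeTan (hμ : 0 < μ) :
    Tendsto (fun N => (∑' x, modeWeight μ N x * modeTan x) / totalWeight μ N) atTop (𝓝 0) := by
  rw [← tendsto_add_atTop_iff_nat 1]
  have h := ((tendsto_totalWeight_ratio hμ).inv₀ one_ne_zero).sub_const 1
  rw [inv_one, sub_self] at h
  refine h.congr' ?_
  filter_upwards [eventually_ge_atTop 1] with N hN
  have h0 := (totalWeight_pos hμ hN).ne'
  have h1 := (totalWeight_pos hμ (N := N + 1) (by omega)).ne'
  have e : ∀ x, modeWeight μ (N + 1) x * modeTan x = modeWeight μ N x - modeWeight μ (N + 1) x :=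
    fun x => by linear_combination modeWeight_succ_mul μ N x
  simp only [e]
  rw [(summable_modeWeight hμ hN).tsum_sub (summable_modeWeight hμ (by omega)), inv_div, sub_div,
    ← totalWeight, ← totalWeight, div_self h1]

theorem summable_modeWeight_mul_modeTan (hμ : 0 < μ) (hN : 2 ≤ N) :
    Summable (fun x => modeWeight μ N x * modeTan x) := by
  obtain ⟨n, rfl⟩ : ∃ n, N = n + 1 := ⟨N - 1, by omega⟩
  have e : ∀ x, modeWeight μ (n + 1) x * modeTan x = modeWeight μ n x - modeWeight μ (n + 1) x :=
    fun x => by linear_combination modeWeight_succ_mul μ n x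
  simp only [e]
  exact (summable_modeWeight hμ (by omega)).sub (summable_modeWeight hμ (by omega))

theorem summable_modeWeight_mul_min (hμ : 0 < μ) (hN : 1 ≤ N) :
    Summable (fun x => modeWeight μ N x * min ((2 * modeScale N x - μ) ^ 2) 1) :=
  Summable.of_nonneg_of_le (fun x => mul_nonneg (modeWeight_nonneg _ _ _) (by positivity))
    (fun x => mul_le_of_le_one_right (modeWeight_nonneg _ _ _) (min_le_right _ _))
    (summable_modeWeight hμ hN)

/-- Summed over all modes, the second difference is at most zero. What remains is `C ε` and, for
fixed `ε`, a multiple of the vanishing average of `tan²θ`. -/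
theorem tendsto_tsum_min (hμ : 0 < μ) :
    Tendsto (fun N => (∑' x, modeWeight μ N x * min ((2 * modeScale N x - μ) ^ 2) 1) /
      totalWeight μ N) atTop (𝓝 0) := by
  obtain ⟨C, hC, hpt⟩ := modeWeight_mul_min_le hμ
  rw [Metric.tendsto_atTop]
  intro ρ hρ
  set ε := min (1 / 10) (ρ / (2 * C)) with hε
  have hε0 : 0 < ε := by positivity
  have hε1 : ε ≤ 1 / 10 := min_le_left _ _
  have hCε : C * ε ≤ ρ / 2 := by
    have := mul_le_mul_of_nonneg_left (min_le_right (1 / 10) (ρ / (2 * C))) hC.le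
    calc C * ε ≤ C * (ρ / (2 * C)) := this
      _ = ρ / 2 := by field_simp
  have h1 : Tendsto (fun N => 3 / ε ^ 2 * ((∑' x, modeWeight μ N x * modeTan x) / totalWeight μ N))
      atTop (𝓝 (3 / ε ^ 2 * 0)) := (tendsto_tsum_modeTan hμ).const_mul _
  rw [mul_zero] at h1
  obtain ⟨N₀, hN₀⟩ := eventually_atTop.1 (h1.eventually_lt_const (half_pos hρ))
  refine ⟨max N₀ 2, fun N hN => ?_⟩
  have h2 := hN₀ N (le_of_max_le_left hN)
  have hN2 : 2 ≤ N := le_of_max_le_right hN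
  obtain ⟨n, rfl⟩ : ∃ n, N = n + 1 := ⟨N - 1, by omega⟩
  have hS := totalWeight_pos hμ (N := n + 1) (by omega)
  have s1 := summable_modeWeight_up hμ (N := n + 1) (by omega)
  have s2 := hasSum_modeWeight_down hμ (N := n + 1) (by omega)
  have s3 := (summable_modeWeight hμ (N := n + 1) (by omega)).mul_left (C * ε - 2)
  have s4 := (summable_modeWeight_mul_modeTan hμ hN2).mul_left (3 / ε ^ 2)
  have h3 := (summable_modeWeight_mul_min hμ (N := n + 1) (by omega)).tsum_le_tsum
    (hpt ε hε0 hε1 n) (((s1.add s2.summable).add s3).add s4)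
  rw [((s1.add s2.summable).add s3).tsum_add s4, (s1.add s2.summable).tsum_add s3,
    s1.tsum_add s2.summable, s2.tsum_eq, tsum_mul_left, tsum_mul_left, ← totalWeight] at h3
  have h4 := tsum_modeWeight_up_le hμ (N := n + 1) (by omega)
  rw [Real.dist_eq, sub_zero, abs_of_nonneg, div_lt_iff₀ hS]
  · rw [mul_div_assoc', div_lt_iff₀ hS] at h2
    have h5 : C * ε * totalWeight μ (n + 1) ≤ ρ / 2 * totalWeight μ (n + 1) :=
      mul_le_mul_of_nonneg_right hCε hS.le
    linarith
  · exact div_nonneg (tsum_nonneg fun x => mul_nonneg (modeWeight_nonneg _ _ _) (by positivity)) hS.le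

end Concentration

/-! ### Convergence of polynomial averages. -/

section Limit

variable {μ : ℝ}

/-- Structural induction. The deviation of the scaling variable may be capped at `1` because the
polynomial prefactor absorbs large deviations; `√t` appears because `s ≤ √t`. -/
theorem IsScalingPoly.abs_sub_le (hμ : 0 < μ) {F : ℝ → ℝ → ℝ → ℝ} {c : ℝ}
    (hF : IsScalingPoly (μ / 2) F c) : ∃ (C : ℝ) (p : ℕ), 0 ≤ C ∧ ∀ n t s : ℝ, 0 ≤ n → 0 ≤ t → 0 ≤ s →
      s ^ 2 ≤ t → |F n t s - c| ≤ C * (1 + n * t * s + t) ^ p *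
        (min |2 * (n * t * s) - μ| 1 + √t) := by
  have hsqrt : ∀ t : ℝ, 0 ≤ t → √t ≤ 1 + t := fun t ht => by
    nlinarith [Real.sq_sqrt ht, sq_nonneg (√t - 1), Real.sqrt_nonneg t]
  induction hF with
  | const c => exact ⟨0, 0, le_rfl, fun n t s _ _ _ _ => by simp⟩
  | scale =>
    refine ⟨1 + μ, 1, by linarith, fun n t s hn ht hs _ => ?_⟩
    set u := n * t * s
    have hu : 0 ≤ u := by positivity
    have h1 : |u - μ / 2| ≤ (1 + μ) * (1 + u + t) * min |2 * u - μ| 1 := by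
      have e : |u - μ / 2| = |2 * u - μ| / 2 := by
        rw [show 2 * u - μ = 2 * (u - μ / 2) by ring, abs_mul, abs_of_pos (two_pos : (0 : ℝ) < 2)]
        ring
      have hW : 1 ≤ (1 + μ) * (1 + u + t) := by nlinarith [mul_nonneg hμ.le hu, mul_nonneg hμ.le ht]
      rcases le_total |2 * u - μ| 1 with h | h
      · rw [min_eq_left h, e]
        nlinarith [abs_nonneg (2 * u - μ)]
      · rw [min_eq_right h, mul_one, abs_le]
        constructor <;> nlinarith [mul_nonneg hμ.le hu, mul_nonneg hμ.le ht]
    have h2 : 0 ≤ (1 + μ) * (1 + u + t) * √t := by positivity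
    rw [pow_one, mul_add]
    linarith
  | fst =>
    refine ⟨1, 1, zero_le_one, fun n t s hn ht hs _ => ?_⟩
    have hu : 0 ≤ n * t * s := by positivity
    have h1 := hsqrt t ht
    have h2 := Real.sq_sqrt ht
    have h3 := Real.sqrt_nonneg t
    have h4 : 0 ≤ min |2 * (n * t * s) - μ| 1 := by positivity
    rw [sub_zero, abs_of_nonneg ht, one_mul, pow_one, mul_add]
    have h5 : 0 ≤ (1 + n * t * s + t) * min |2 * (n * t * s) - μ| 1 := by positivity
    nlinarith
  | snd =>
    refine ⟨1, 0, zero_le_one, fun n t s hn ht hs hst => ?_⟩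
    have h4 : 0 ≤ min |2 * (n * t * s) - μ| 1 := by positivity
    have h5 : s ≤ √t := Real.le_sqrt_of_sq_le hst
    rw [sub_zero, abs_of_nonneg hs, one_mul, pow_zero, one_mul]
    linarith
  | @add F G c d _ _ hF hG =>
    obtain ⟨C, p, hC, hF⟩ := hF
    obtain ⟨D, q, hD, hG⟩ := hG
    refine ⟨C + D, p + q, by linarith, fun n t s hn ht hs hst => ?_⟩
    have h1 := hF n t s hn ht hs hst
    have h2 := hG n t s hn ht hs hst
    have hW : 1 ≤ 1 + n * t * s + t := by
      have : 0 ≤ n * t * s := by positivity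
      linarith
    set W := 1 + n * t * s + t
    set e := min |2 * (n * t * s) - μ| 1 + √t
    have he : 0 ≤ e := by positivity
    have hp : W ^ p ≤ W ^ (p + q) := pow_le_pow_right₀ hW (by omega)
    have hq : W ^ q ≤ W ^ (p + q) := pow_le_pow_right₀ hW (by omega)
    calc |F n t s + G n t s - (c + d)| = |(F n t s - c) + (G n t s - d)| := by ring_nf
      _ ≤ |F n t s - c| + |G n t s - d| := abs_add_le _ _
      _ ≤ C * W ^ p * e + D * W ^ q * e := add_le_add h1 h2
      _ ≤ C * W ^ (p + q) * e + D * W ^ (p + q) * e := by gcongr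
      _ = _ := by ring
  | @mul F G c d _ _ hF hG =>
    obtain ⟨C, p, hC, hF⟩ := hF
    obtain ⟨D, q, hD, hG⟩ := hG
    refine ⟨C * (|d| + 2 * D) + |c| * D, p + q + 1, by positivity, fun n t s hn ht hs hst => ?_⟩
    have h1 := hF n t s hn ht hs hst
    have h2 := hG n t s hn ht hs hst
    have hu : 0 ≤ n * t * s := by positivity
    have hW : 1 ≤ 1 + n * t * s + t := by linarith
    have hle : min |2 * (n * t * s) - μ| 1 + √t ≤ 2 * (1 + n * t * s + t) := by
      have := min_le_right |2 * (n * t * s) - μ| 1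
      have := hsqrt t ht
      linarith
    set W := 1 + n * t * s + t
    set e := min |2 * (n * t * s) - μ| 1 + √t
    have he : 0 ≤ e := by positivity
    have h3 : |G n t s| ≤ (|d| + 2 * D) * W ^ (q + 1) := by
      have h4 : |G n t s| ≤ |d| + |G n t s - d| := by
        have := abs_add_le d (G n t s - d)
        rwa [add_sub_cancel] at this
      have h5 : 1 ≤ W ^ (q + 1) := one_le_pow₀ hW
      have h6 : D * W ^ q * e ≤ D * W ^ q * (2 * W) := by gcongr
      have h7 : |d| ≤ |d| * W ^ (q + 1) := le_mul_of_one_le_right (abs_nonneg d) h5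
      calc _ ≤ |d| * W ^ (q + 1) + D * W ^ q * (2 * W) := by linarith
        _ = _ := by ring
    have hq : W ^ q ≤ W ^ (p + q + 1) := pow_le_pow_right₀ hW (by omega)
    calc |F n t s * G n t s - c * d| = |(F n t s - c) * G n t s + c * (G n t s - d)| := by ring_nf
      _ ≤ |F n t s - c| * |G n t s| + |c| * |G n t s - d| := by
        rw [← abs_mul, ← abs_mul]
        exact abs_add_le _ _
      _ ≤ (C * W ^ p * e) * ((|d| + 2 * D) * W ^ (q + 1)) + |c| * (D * W ^ q * e) := by gcongr
      _ ≤ (C * W ^ p * e) * ((|d| + 2 * D) * W ^ (q + 1)) + |c| * (D * W ^ (p + q + 1) * e) := by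
        gcongr
      _ = _ := by ring

/-- The weighted sum of a function of `N`, `tan²θ` and `1 / M` over the modes. -/
noncomputable def modeSum (μ : ℝ) (F : ℝ → ℝ → ℝ → ℝ) (N : ℕ) : ℝ :=
  ∑' x, modeWeight μ N x * F N (modeTan x) (1 / x.1)

/-- Young's inequality with parameter `l` separates the polynomial prefactor, bounded on average by
`D` independently of `l`, from the small factor, which enters only through vanishing averages. Later
`l` is fixed first, then `N` tends to infinity. -/
theorem IsScalingPoly.eventually_modeSum (hμ : 0 < μ) {F : ℝ → ℝ → ℝ → ℝ} {c : ℝ}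
    (hF : IsScalingPoly (μ / 2) F c) :
    ∃ D : ℝ, ∀ l : ℝ, 0 < l → ∃ E : ℝ, ∀ᶠ N in atTop,
      Summable (fun x : ℕ × ℕ => modeWeight μ N x * F N (modeTan x) (1 / x.1)) ∧
      |modeSum μ F N / totalWeight μ N - c| ≤ l * D +
        E * ((∑' x, modeWeight μ N x * min ((2 * modeScale N x - μ) ^ 2) 1) / totalWeight μ N +
          (∑' x, modeWeight μ N x * modeTan x) / totalWeight μ N) := by
  obtain ⟨C, p, hC, hle⟩ := hF.abs_sub_le hμ
  obtain ⟨D, hD⟩ := eventually_tsum_pow_le hμ (2 * p)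
  refine ⟨D, fun l hl => ⟨C ^ 2 / l, ?_⟩⟩
  filter_upwards [hD, eventually_ge_atTop 2] with N hD hN
  have hS := totalWeight_pos hμ (N := N) (by omega)
  have s0 := summable_modeWeight hμ (N := N) (by omega)
  have s1 := hD.1.mul_left l
  have s2 := (summable_modeWeight_mul_min hμ (N := N) (by omega)).mul_left (C ^ 2 / l)
  have s3 := (summable_modeWeight_mul_modeTan hμ hN).mul_left (C ^ 2 / l)
  have hpt : ∀ x : ℕ × ℕ, |modeWeight μ N x * (F N (modeTan x) (1 / x.1) - c)| ≤
      l * (modeWeight μ N x * (1 + modeScale N x + modeTan x) ^ (2 * p)) +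
        C ^ 2 / l * (modeWeight μ N x * min ((2 * modeScale N x - μ) ^ 2) 1) +
        C ^ 2 / l * (modeWeight μ N x * modeTan x) := by
    intro x
    have hw := modeWeight_nonneg μ N x
    by_cases h : x.2 ∈ modes x.1
    · have ht := modeTan_nonneg x
      have h1 := hle N (modeTan x) (1 / x.1) (by positivity) ht (by positivity)
        (inv_sq_le_modeTan h)
      change _ ≤ C * (1 + modeScale N x + modeTan x) ^ p * (min |2 * modeScale N x - μ| 1 + _) at h1
      set W := (1 + modeScale N x + modeTan x) ^ p with hW
      set a := min |2 * modeScale N x - μ| 1 with ha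
      have ha2 : a ^ 2 = min ((2 * modeScale N x - μ) ^ 2) 1 := by
        rw [ha]
        rcases le_total |2 * modeScale N x - μ| 1 with h | h
        · rw [min_eq_left h, sq_abs, min_eq_left ((sq_le_one_iff_abs_le_one _).2 h)]
        · rw [min_eq_right h, one_pow, min_eq_right ((one_le_sq_iff_one_le_abs _).2 h)]
      have hb2 := Real.sq_sqrt ht
      rw [abs_mul, abs_of_nonneg hw]
      have h2 : C * W * (a + √(modeTan x)) ≤ l * W ^ 2 + C ^ 2 / l * (a ^ 2 + √(modeTan x) ^ 2) := by
        have e1 : l * W ^ 2 + C ^ 2 / l * (a ^ 2 + √(modeTan x) ^ 2) - C * W * (a + √(modeTan x)) =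
            ((l * W - 2 * C * a) ^ 2 + (l * W - 2 * C * √(modeTan x)) ^ 2 + 2 * (l * W) ^ 2) / (4 * l) := by
          field_simp
          ring
        have : 0 ≤ ((l * W - 2 * C * a) ^ 2 + (l * W - 2 * C * √(modeTan x)) ^ 2 +
          2 * (l * W) ^ 2) / (4 * l) := by positivity
        linarith
      have h3 := mul_le_mul_of_nonneg_left (h1.trans h2) hw
      rw [ha2, hb2, hW, ← pow_mul, mul_comm p 2] at h3
      linarith
    · simp [modeWeight_of_notMem h]
  have s4 : Summable (fun x : ℕ × ℕ => |modeWeight μ N x * (F N (modeTan x) (1 / x.1) - c)|) :=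
    Summable.of_nonneg_of_le (fun x => abs_nonneg _) hpt ((s1.add s2).add s3)
  have s5 : Summable (fun x : ℕ × ℕ => modeWeight μ N x * F N (modeTan x) (1 / x.1)) := by
    have := s4.of_abs.add (s0.mul_left c)
    refine this.congr fun x => ?_
    ring
  refine ⟨s5, ?_⟩
  have e1 : modeSum μ F N / totalWeight μ N - c =
      (∑' x : ℕ × ℕ, modeWeight μ N x * (F N (modeTan x) (1 / x.1) - c)) / totalWeight μ N := by
    have : (∑' x : ℕ × ℕ, modeWeight μ N x * (F N (modeTan x) (1 / x.1) - c)) =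
        modeSum μ F N - c * totalWeight μ N := by
      rw [modeSum, totalWeight, ← tsum_mul_left, ← s5.tsum_sub (s0.mul_left c)]
      exact tsum_congr fun x => by ring
    rw [this, sub_div, mul_div_assoc, div_self hS.ne', mul_one]
  rw [e1, abs_div, abs_of_pos hS, div_le_iff₀ hS]
  have h4 : |∑' x : ℕ × ℕ, modeWeight μ N x * (F N (modeTan x) (1 / x.1) - c)| ≤
      ∑' x : ℕ × ℕ, |modeWeight μ N x * (F N (modeTan x) (1 / x.1) - c)| := by
    simpa only [Real.norm_eq_abs] using norm_tsum_le_tsum_norm (f := fun x : ℕ × ℕ =>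
      modeWeight μ N x * (F N (modeTan x) (1 / x.1) - c)) (by simpa only [Real.norm_eq_abs] using s4)
  have h5 := s4.tsum_le_tsum hpt ((s1.add s2).add s3)
  rw [(s1.add s2).tsum_add s3, s1.tsum_add s2, tsum_mul_left, tsum_mul_left, tsum_mul_left] at h5
  have h6 := mul_le_mul_of_nonneg_left hD.2 hl.le
  refine (h4.trans h5).trans ?_
  rw [add_mul, mul_assoc (C ^ 2 / l), add_mul, div_mul_cancel₀ _ hS.ne', div_mul_cancel₀ _ hS.ne']
  linarith

theorem IsScalingPoly.eventually_summable (hμ : 0 < μ) {F : ℝ → ℝ → ℝ → ℝ} {c : ℝ}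
    (hF : IsScalingPoly (μ / 2) F c) : ∀ᶠ N : ℕ in atTop,
      Summable (fun x : ℕ × ℕ => modeWeight μ N x * F N (modeTan x) (1 / x.1)) := by
  obtain ⟨D, hD⟩ := hF.eventually_modeSum hμ
  obtain ⟨E, hE⟩ := hD 1 one_pos
  exact hE.mono fun N h => h.1

theorem IsScalingPoly.tendsto_modeSum (hμ : 0 < μ) {F : ℝ → ℝ → ℝ → ℝ} {c : ℝ}
    (hF : IsScalingPoly (μ / 2) F c) :
    Tendsto (fun N => modeSum μ F N / totalWeight μ N) atTop (𝓝 c) := by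
  obtain ⟨D, hD⟩ := hF.eventually_modeSum hμ
  rw [Metric.tendsto_nhds]
  intro ε hε
  obtain ⟨E, hE⟩ := hD (ε / (2 * (|D| + 1))) (by positivity)
  have h1 := ((tendsto_tsum_min hμ).add (tendsto_tsum_modeTan hμ)).const_mul E
  rw [add_zero, mul_zero] at h1
  filter_upwards [hE, h1.eventually_lt_const (half_pos hε)] with N h2 h3
  rw [Real.dist_eq]
  refine h2.2.trans_lt ?_
  have h4 : ε / (2 * (|D| + 1)) * D ≤ ε / 2 := by
    rw [div_mul_eq_mul_div, div_le_div_iff₀ (by positivity) two_pos]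
    have := le_abs_self D
    nlinarith
  linarith

end Limit

/-! ### Limits of the ratios of weighted counts. -/

/-- The factor `∑_{R=1}^K C(K,R) μ^{R-1}/(R-1)!` of the limiting ball volumes. -/
noncomputable def volumeFactor (μ : ℝ) (K : ℕ) : ℝ :=
  ∑ R ∈ Finset.Icc 1 K, (K.choose R : ℝ) * (μ ^ (R - 1) / ((R - 1).factorial : ℝ))

/-- The factors by which the modes enter the coefficients of the powers of the forest series. -/
noncomputable def forestFactor (K : ℕ) (n t s : ℝ) : ℝ :=
  ∑ R ∈ Finset.range (K + 1), (K.choose R : ℝ) * modeFactor R n t s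

section Ratio

variable {μ : ℝ}

theorem IsScalingPoly.sum {ι : Type*} {v : ℝ} (S : Finset ι) {F : ι → ℝ → ℝ → ℝ → ℝ} {c : ι → ℝ}
    (h : ∀ i ∈ S, IsScalingPoly v (F i) (c i)) :
    IsScalingPoly v (fun n t s => ∑ i ∈ S, F i n t s) (∑ i ∈ S, c i) := by
  classical
  induction S using Finset.induction_on with
  | empty => exact (IsScalingPoly.const 0).congr (fun n t s => by simp) (by simp)
  | insert i S hi ih =>
    refine ((h i (Finset.mem_insert_self i S)).add
      (ih fun j hj => h j (Finset.mem_insert_of_mem hj))).congr (fun n t s => ?_) ?_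
    · rw [Finset.sum_insert hi]
    · rw [Finset.sum_insert hi]

theorem sum_range_succ_eq_sum_Icc (f : ℕ → ℝ) (K : ℕ) :
    ∑ R ∈ Finset.range K, f (R + 1) = ∑ R ∈ Finset.Icc 1 K, f R := by
  rw [Finset.range_eq_Ico, Finset.sum_Ico_add' f 0 K 1]
  rfl

theorem isScalingPoly_forestFactor (μ : ℝ) (K : ℕ) :
    IsScalingPoly (μ / 2) (forestFactor K) (volumeFactor μ K) := by
  refine (IsScalingPoly.sum (Finset.range K) fun R _ => (IsScalingPoly.const
    (K.choose (R + 1) : ℝ)).mul (isScalingPoly_modeFactor μ R)).congr (fun n t s => ?_) ?_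
  · rw [forestFactor, Finset.sum_range_succ']
    simp [modeFactor]
  · rw [volumeFactor, ← sum_range_succ_eq_sum_Icc]
    simp

open PowerSeries in
-- Expand `(2 X B) ^ K = (1 + Y) ^ K` by the binomial theorem and read off the coefficient of index
-- `n + K`. Since `n ≥ 1`, this index exceeds every `R ≤ K`.
theorem coeff_forestSeries_pow (m K n : ℕ) (hn : 1 ≤ n) :
    coeff n (forestSeries m ^ K) = 4 ^ (n + K) / 2 ^ K * ∑ k ∈ modes (m + 2), 2 / ((m + 2 : ℕ) : ℝ) *
      Real.tan (modeAngle (m + 2) k) ^ 2 * (Real.cos (modeAngle (m + 2) k) ^ 2) ^ (n + K) *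
        forestFactor K ((n + K : ℕ) : ℝ) (Real.tan (modeAngle (m + 2) k) ^ 2)
          (1 / ((m + 2 : ℕ) : ℝ)) := by
  have h1 : ((2 ^ K : ℕ) : PowerSeries ℝ) * (X ^ K * forestSeries m ^ K) =
      ∑ R ∈ Finset.range (K + 1), (K.choose R : PowerSeries ℝ) * centredSeries m ^ R := by
    have e : ((2 ^ K : ℕ) : PowerSeries ℝ) * (X ^ K * forestSeries m ^ K) =
        (centredSeries m + 1) ^ K := by
      rw [centredSeries, sub_add_cancel, mul_pow, mul_pow]
      push_cast
      rfl
    rw [e, add_pow]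
    refine Finset.sum_congr rfl fun R _ => ?_
    rw [one_pow, mul_one, mul_comm]
  have h2 := congrArg (coeff (n + K)) h1
  rw [coeff_natCast_mul, coeff_X_pow_mul, map_sum] at h2
  simp only [coeff_natCast_mul] at h2
  have h3 : ∀ R ∈ Finset.range (K + 1), (K.choose R : ℝ) * coeff (n + K) (centredSeries m ^ R) =
      4 ^ (n + K) * ∑ k ∈ modes (m + 2), 2 / ((m + 2 : ℕ) : ℝ) *
      Real.tan (modeAngle (m + 2) k) ^ 2 * (Real.cos (modeAngle (m + 2) k) ^ 2) ^ (n + K) *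
        ((K.choose R : ℝ) * modeFactor R ((n + K : ℕ) : ℝ) (Real.tan (modeAngle (m + 2) k) ^ 2)
          (1 / ((m + 2 : ℕ) : ℝ))) := by
    intro R hR
    rw [Finset.mem_range] at hR
    rw [coeff_centredSeries_pow_eq m R (n + K) (by omega), Finset.mul_sum, Finset.mul_sum]
    refine Finset.sum_congr rfl fun k _ => ?_
    rw [mul_pow 4]
    ring
  rw [Finset.sum_congr rfl h3, ← Finset.mul_sum, Finset.sum_comm] at h2
  simp only [← Finset.mul_sum] at h2
  rw [div_mul_eq_mul_div, eq_div_iff (by positivity)]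
  push_cast at h2
  rw [mul_comm, h2]
  simp only [forestFactor]
  push_cast
  rfl

theorem weightedCount_eq {K n : ℕ} (hn : 1 ≤ n)
    (hs : Summable (fun x : ℕ × ℕ => modeWeight μ (n + K) x *
      forestFactor K ((n + K : ℕ) : ℝ) (modeTan x) (1 / x.1))) :
    weightedCount μ K n = Real.exp (2 * μ) * (4 ^ (n + K) / 2 ^ K) *
      modeSum μ (forestFactor K) (n + K) := by
  have h1 : HasSum (fun M : ℕ => ∑ k ∈ modes M, modeWeight μ (n + K) (M, k) *
      forestFactor K ((n + K : ℕ) : ℝ) (modeTan (M, k)) (1 / (M : ℝ)))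
      (modeSum μ (forestFactor K) (n + K)) := by
    refine hs.hasSum.prod_fiberwise fun M => ?_
    refine hasSum_sum_of_ne_finset_zero fun k hk => ?_
    rw [modeWeight_of_notMem (x := (M, k)) hk, zero_mul]
  -- The height bound `m` corresponds to `M = m + 2`, whence the factor `e^{2μ}`; the values `M = 0,
  -- 1` carry no modes.
  rw [← hasSum_nat_add_iff' 2] at h1
  have h2 : ∀ M < 3, modes M = ∅ := fun M hM => by
    ext k
    rw [mem_modes]
    simp
    omega
  have h3 : ∑ M ∈ Finset.range 2, ∑ k ∈ modes M, modeWeight μ (n + K) (M, k) *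
      forestFactor K ((n + K : ℕ) : ℝ) (modeTan (M, k)) (1 / (M : ℝ)) = 0 := by
    refine Finset.sum_eq_zero fun M hM => ?_
    rw [h2 M (by have := Finset.mem_range.1 hM; omega), Finset.sum_empty]
  rw [h3, sub_zero] at h1
  rw [← (h1.mul_left (Real.exp (2 * μ) * (4 ^ (n + K) / 2 ^ K))).tsum_eq, weightedCount]
  refine tsum_congr fun m => ?_
  rw [extensionCount_eq_coeff, coeff_forestSeries_pow m K n hn, Finset.mul_sum, Finset.mul_sum,
    Finset.mul_sum]
  refine Finset.sum_congr rfl fun k hk => ?_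
  rw [modeWeight, if_pos hk]
  have e : Real.exp (-μ * m) = Real.exp (2 * μ) * Real.exp (-μ * ((m + 2 : ℕ) : ℝ)) := by
    rw [← Real.exp_add]
    push_cast
    ring_nf
  rw [e]
  simp only [modeTan]
  ring

theorem volumeFactor_one (μ : ℝ) : volumeFactor μ 1 = 1 := by simp [volumeFactor]

/-- With `N = j + a`, numerator and denominator are mode sums at `j + K` and `j + a`. The total
weights there are asymptotically equal, so only the powers of `2` and `4` and the polynomial
averages remain. -/
theorem tendsto_weightedCount_ratio (hμ : 0 < μ) (K a : ℕ) :
    Tendsto (fun N => weightedCount μ K (N - a) / weightedCount μ 1 (N - 1)) atTop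
      (𝓝 (2 ^ (K + 1) / 4 ^ a * volumeFactor μ K)) := by
  rw [← tendsto_add_atTop_iff_nat a]
  have hK := isScalingPoly_forestFactor μ K
  have h1 := isScalingPoly_forestFactor μ 1
  have t1 := (hK.tendsto_modeSum hμ).comp (tendsto_add_atTop_nat K)
  have t2 := (h1.tendsto_modeSum hμ).comp (tendsto_add_atTop_nat a)
  have t3 := (tendsto_totalWeight_ratio_add hμ K).div (tendsto_totalWeight_ratio_add hμ a) one_ne_zero
  rw [volumeFactor_one] at t2
  have t4 := ((t1.div t2 one_ne_zero).mul t3).const_mul (2 ^ (K + 1) / 4 ^ a : ℝ)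
  simp only [div_one, mul_one] at t4
  have e1 := (tendsto_add_atTop_nat K).eventually (hK.eventually_summable hμ)
  have e2 := (tendsto_add_atTop_nat a).eventually (h1.eventually_summable hμ)
  refine t4.congr' ?_
  filter_upwards [e1, e2, eventually_ge_atTop 2] with j hj1 hj2 hj
  have s0 := (totalWeight_pos hμ (N := j) (by omega)).ne'
  have s1 := (totalWeight_pos hμ (N := j + K) (by omega)).ne'
  have s2 := (totalWeight_pos hμ (N := j + a) (by omega)).ne'
  have ea : j + a = j + a - 1 + 1 := by omega
  have w1 := weightedCount_eq (μ := μ) (K := K) (n := j) (by omega) hj1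
  have w2 := weightedCount_eq (μ := μ) (K := 1) (n := j + a - 1) (by omega) (by rw [← ea]; exact hj2)
  rw [← ea] at w2
  rw [Nat.add_sub_cancel, w1, w2]
  simp only [Function.comp, Pi.div_apply]
  have e0 := (Real.exp_pos (2 * μ)).ne'
  rw [mul_assoc, mul_assoc, mul_div_mul_left _ _ e0, mul_div_mul_comm]
  have e3 : (4 : ℝ) ^ (j + K) / 2 ^ K / (4 ^ (j + a) / 2 ^ 1) = 2 ^ (K + 1) / 4 ^ a := by
    have : (4 : ℝ) ^ K = 2 ^ K * 2 ^ K := by rw [← mul_pow]; norm_num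
    rw [pow_add, pow_add, this]
    field_simp
    ring
  rw [e3]
  congr 1
  field_simp

end Ratio

/-! ### The summation identity for the limiting volumes. -/

section Consistency

theorem hasSum_pow_div_factorial (μ : ℝ) :
    HasSum (fun n : ℕ => μ ^ n / (n.factorial : ℝ)) (Real.exp μ) := by
  rw [Real.exp_eq_exp_ℝ]
  exact NormedSpace.expSeries_div_hasSum_exp μ

theorem hasSum_choose_mul_pow_div_factorial (μ : ℝ) (i : ℕ) :
    HasSum (fun R : ℕ => (R.choose i : ℝ) * (μ ^ R / (R.factorial : ℝ)))
      (μ ^ i / (i.factorial : ℝ) * Real.exp μ) := by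
  rw [← hasSum_nat_add_iff' i]
  have h0 : ∑ R ∈ Finset.range i, (R.choose i : ℝ) * (μ ^ R / (R.factorial : ℝ)) = 0 :=
    Finset.sum_eq_zero fun R hR => by
      rw [Nat.choose_eq_zero_of_lt (Finset.mem_range.1 hR), Nat.cast_zero, zero_mul]
  rw [h0, sub_zero]
  refine HasSum.congr_fun ((hasSum_pow_div_factorial μ).mul_left (μ ^ i / (i.factorial : ℝ)))
    fun d => ?_
  have h1 : ((d + i).choose i : ℝ) * i.factorial * d.factorial = (d + i).factorial := by
    have := Nat.choose_mul_factorial_mul_factorial (Nat.le_add_left i d)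
    rw [Nat.add_sub_cancel] at this
    exact_mod_cast this
  rw [← h1, pow_add]
  have e1 : (i.factorial : ℝ) ≠ 0 := by positivity
  have e2 : (d.factorial : ℝ) ≠ 0 := by positivity
  have e3 : ((d + i).choose i : ℝ) ≠ 0 := by
    have := Nat.choose_pos (Nat.le_add_left i d)
    positivity
  field_simp

theorem choose_add_succ_eq_sum (K R : ℕ) :
    (K + R).choose (R + 1) = ∑ i ∈ Finset.range K, K.choose (i + 1) * R.choose i := by
  cases K with
  | zero => simp
  | succ L =>
    have h1 : (L + 1 + R).choose (R + 1) = (R + (L + 1)).choose L :=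
      Nat.choose_symm_of_eq_add (by ring) |>.trans (by rw [add_comm])
    rw [h1, Nat.add_choose_eq, Finset.Nat.sum_antidiagonal_eq_sum_range_succ
      (fun i j => R.choose i * (L + 1).choose j)]
    refine Finset.sum_congr rfl fun i hi => ?_
    have hi' := Finset.mem_range.1 hi
    rw [mul_comm, Nat.choose_symm_of_eq_add (show L + 1 = (L - i) + (i + 1) by omega)]

theorem volumeFactor_eq_sum_range (μ : ℝ) {K L : ℕ} (h : K ≤ L) :
    volumeFactor μ K =
      ∑ R ∈ Finset.range L, (K.choose (R + 1) : ℝ) * (μ ^ R / (R.factorial : ℝ)) := by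
  rw [volumeFactor, ← sum_range_succ_eq_sum_Icc]
  refine Finset.sum_subset (Finset.range_mono h) fun R _ hR => ?_
  rw [Finset.mem_range, not_lt] at hR
  rw [Nat.choose_eq_zero_of_lt (by omega), Nat.cast_zero, zero_mul]

/-- Vandermonde splits the binomial coefficient; the sums over `R` are then binomial moments of a
Poisson variable, up to normalisation. -/
theorem hasSum_choose_add_mul (μ : ℝ) (K : ℕ) :
    HasSum (fun R : ℕ => ((K + R).choose (R + 1) : ℝ) * (μ ^ R / (R.factorial : ℝ)))
      (Real.exp μ * volumeFactor μ K) := by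
  have h := hasSum_sum (s := Finset.range K) fun i _ =>
    (hasSum_choose_mul_pow_div_factorial μ i).mul_left (K.choose (i + 1) : ℝ)
  convert! h using 1
  · ext R
    rw [choose_add_succ_eq_sum]
    push_cast
    rw [Finset.sum_mul]
    exact Finset.sum_congr rfl fun i _ => by ring
  · rw [volumeFactor_eq_sum_range μ le_rfl, Finset.mul_sum]
    exact Finset.sum_congr rfl fun i _ => by ring

/-- A binomial moment of the negative binomial law: regrouping the two binomial coefficients leaves
a standard series `∑ C(i + p, p) 2^{-i}`. -/
theorem hasSum_multichoose_mul_choose (K R : ℕ) :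
    HasSum (fun j : ℕ => ((K + 1).multichoose j : ℝ) * (1 / 2) ^ j * (j.choose (R + 1) : ℝ))
      (2 ^ (K + 1) * ((K + 1 + R).choose (R + 1) : ℝ)) := by
  rw [← hasSum_nat_add_iff' (R + 1)]
  have h0 : ∑ j ∈ Finset.range (R + 1),
      ((K + 1).multichoose j : ℝ) * (1 / 2) ^ j * (j.choose (R + 1) : ℝ) = 0 :=
    Finset.sum_eq_zero fun j hj => by
      rw [Nat.choose_eq_zero_of_lt (Finset.mem_range.1 hj), Nat.cast_zero, mul_zero]
  rw [h0, sub_zero]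
  have h1 := (hasSum_choose_mul_geometric_of_norm_lt_one (𝕜 := ℝ) (K + 1 + R) (r := 1 / 2)
    (by norm_num)).mul_left (((K + 1 + R).choose (R + 1) : ℝ) * (1 / 2) ^ (R + 1))
  convert! h1 using 1
  · ext i
    have e : (K + 1).multichoose (i + (R + 1)) * (i + (R + 1)).choose (R + 1) =
        (K + 1 + R).choose (R + 1) * (i + (K + 1 + R)).choose (K + 1 + R) := by
      have h2 := Nat.choose_mul (n := i + (K + 1 + R)) (k := K + 1 + R) (s := K) (by omega)
      rw [Nat.choose_symm_of_eq_add (show K + 1 + R = K + (R + 1) by ring),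
        show i + (K + 1 + R) - K = i + (R + 1) by omega,
        show K + 1 + R - K = R + 1 by omega] at h2
      rw [mul_comm ((K + 1 + R).choose (R + 1)), h2, Nat.multichoose_eq,
        show K + 1 + (i + (R + 1)) - 1 = i + (K + 1 + R) by omega,
        Nat.choose_symm_of_eq_add (show i + (K + 1 + R) = (i + (R + 1)) + K by ring)]
    have e' : ((K + 1).multichoose (i + (R + 1)) : ℝ) * ((i + (R + 1)).choose (R + 1) : ℝ) =
        ((K + 1 + R).choose (R + 1) : ℝ) * ((i + (K + 1 + R)).choose (K + 1 + R) : ℝ) := by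
      exact_mod_cast e
    rw [pow_add (1 / 2 : ℝ) i (R + 1)]
    linear_combination (1 / 2 : ℝ) ^ i * (1 / 2) ^ (R + 1) * e'
  · have e : (1 - 1 / 2 : ℝ) = 1 / 2 := by norm_num
    rw [e, one_div_pow, one_div_pow, one_div_one_div,
      show K + 1 + R + 1 = (K + 1) + (R + 1) by ring, pow_add (2 : ℝ) (K + 1) (R + 1)]
    field_simp

/-- Exchange the sums over `j` and `R`, all terms being nonnegative: the sum over `j` is a negative
binomial moment and the remaining one is of Poisson type. -/
theorem hasSum_multichoose_mul_volumeFactor {μ : ℝ} (hμ : 0 < μ) (K : ℕ) :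
    HasSum (fun j : ℕ => (K.multichoose j : ℝ) * (1 / 2) ^ j * volumeFactor μ j)
      (Real.exp μ * 2 ^ K * volumeFactor μ K) := by
  cases K with
  | zero =>
    have : ∀ j, ((0 : ℕ).multichoose j : ℝ) * (1 / 2) ^ j * volumeFactor μ j = 0 := by
      intro j
      cases j with
      | zero => simp [volumeFactor]
      | succ j => simp
    have h0 : volumeFactor μ 0 = 0 := by simp [volumeFactor]
    rw [h0, mul_zero]
    exact hasSum_zero.congr_fun this
  | succ K =>
    set g : ℕ × ℕ → ℝ := fun p => μ ^ p.1 / (p.1.factorial : ℝ) *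
      (((K + 1).multichoose p.2 : ℝ) * (1 / 2) ^ p.2 * (p.2.choose (p.1 + 1) : ℝ)) with hg
    have hg0 : 0 ≤ g := fun p => by
      simp only [hg, Pi.zero_apply]
      positivity
    have h1 : ∀ R, HasSum (fun j => g (R, j))
        (μ ^ R / (R.factorial : ℝ) * (2 ^ (K + 1) * ((K + 1 + R).choose (R + 1) : ℝ))) :=
      fun R => (hasSum_multichoose_mul_choose K R).mul_left _
    have h2 : HasSum (fun R : ℕ => μ ^ R / (R.factorial : ℝ) *
        (2 ^ (K + 1) * ((K + 1 + R).choose (R + 1) : ℝ)))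
        (Real.exp μ * 2 ^ (K + 1) * volumeFactor μ (K + 1)) := by
      convert! (hasSum_choose_add_mul μ (K + 1)).mul_left (2 ^ (K + 1) : ℝ) using 1
      · ext R
        ring
      · ring
    have hs : Summable g := (summable_prod_of_nonneg hg0).2
      ⟨fun R => (h1 R).summable, by simpa only [(h1 _).tsum_eq] using h2.summable⟩
    have h3 : HasSum g (Real.exp μ * 2 ^ (K + 1) * volumeFactor μ (K + 1)) := by
      have := hs.hasSum.prod_fiberwise h1
      rw [← this.unique h2]
      exact hs.hasSum
    have h4 : HasSum (fun p : ℕ × ℕ => g p.swap)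
        (Real.exp μ * 2 ^ (K + 1) * volumeFactor μ (K + 1)) :=
      (Equiv.prodComm ℕ ℕ).hasSum_iff.2 h3
    refine h4.prod_fiberwise fun j => ?_
    have h5 : HasSum (fun R => g (R, j)) (∑ R ∈ Finset.range j, g (R, j)) := by
      refine hasSum_sum_of_ne_finset_zero fun R hR => ?_
      rw [Finset.mem_range, not_lt] at hR
      simp only [hg]
      rw [Nat.choose_eq_zero_of_lt (by omega), Nat.cast_zero, mul_zero, mul_zero]
    convert! h5 using 1
    rw [volumeFactor_eq_sum_range μ le_rfl, Finset.mul_sum]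
    exact Finset.sum_congr rfl fun R _ => by
      simp only [hg]
      ring

end Consistency

/-! ### Limiting ball volumes and conservation of mass. -/

namespace PlanarTree

/-- The limiting mass of the trees which agree with `T` up to distance `r` from the root, for a tree
`T` of height at most `r`. -/
noncomputable def ballVolume (μ : ℝ) (r : ℕ) (T : PlanarTree) : ℝ :=
  Real.exp (-μ * ((r : ℝ) - 1)) / 4 ^ T.size.toNat * 2 ^ ((T.levelFinset r).card + 1) *
    volumeFactor μ (T.levelFinset r).card

theorem tendsto_nu_real_closedBall {μ : ℝ} (hμ : 0 < μ) {r : ℕ} (hr : 1 ≤ r) {T : PlanarTree}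
    (hT : T.HeightLE r) :
    Tendsto (fun N : ℕ+ => (nu μ N : Measure PlanarTree).real
      (Metric.closedBall T (1 / (r : ℝ)))) atTop (𝓝 (ballVolume μ r T)) := by
  obtain ⟨a, ha, ha1⟩ := hT.exists_size
  have hlim := ((tendsto_weightedCount_ratio hμ (T.levelFinset r).card a).const_mul
    (Real.exp (-μ * ((r : ℝ) - 1)))).comp tendsto_PNat_val_atTop_atTop
  have hval : ballVolume μ r T = Real.exp (-μ * ((r : ℝ) - 1)) *
      (2 ^ ((T.levelFinset r).card + 1) / 4 ^ a * volumeFactor μ (T.levelFinset r).card) := by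
    rw [ballVolume, ha, ENat.toNat_natCast]
    ring
  rw [hval]
  refine hlim.congr' ?_
  filter_upwards [tendsto_PNat_val_atTop_atTop.eventually (eventually_gt_atTop a)] with N hN
  exact (nu_real_closedBall_eq hμ hr hT ha ha1 hN).symm

theorem rootBall_extend {T : PlanarTree} {r : ℕ} (hr : 1 ≤ r) (hT : T.HeightLE r)
    {f : List ℕ → ℕ} (hf : ∀ u, f u ≠ 0 → u ∈ T.levelFinset r) :
    (T.extend r hr f).rootBall r = T.verts :=
  ((rootBall_succ_eq_iff hr hT hf).1 (hT.extend hr f).rootBall_eq).1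

theorem extend_injOn {T : PlanarTree} {r : ℕ} (hr : 1 ≤ r) (hT : T.HeightLE r) (j : ℕ) :
    Set.InjOn (T.extend r hr) (Finset.piAntidiag (T.levelFinset r) j) := by
  intro f hf g hg h
  have hf' := (Finset.mem_piAntidiag.1 hf).2
  have hg' := (Finset.mem_piAntidiag.1 hg).2
  have h1 := ((rootBall_succ_eq_iff hr hT hf').1 (hT.extend hr f).rootBall_eq).2
  have h2 := ((rootBall_succ_eq_iff hr hT hg').1 (hT.extend hr g).rootBall_eq).2
  rw [← h1, ← h2, h]

open Classical in
/-- The trees obtained from a tree of height at most `r` by adding `j` vertices at distance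
`r + 1` from the root. -/
noncomputable def extensions (T : PlanarTree) (r : ℕ) (hr : 1 ≤ r) (j : ℕ) : Finset PlanarTree :=
  (Finset.piAntidiag (T.levelFinset r) j).image (T.extend r hr)

theorem mem_extensions {T S : PlanarTree} {r j : ℕ} {hr : 1 ≤ r} :
    S ∈ T.extensions r hr j ↔
      ∃ f ∈ Finset.piAntidiag (T.levelFinset r) j, T.extend r hr f = S := by
  classical
  exact Finset.mem_image

theorem card_extensions {T : PlanarTree} {r : ℕ} (hr : 1 ≤ r) (hT : T.HeightLE r) (j : ℕ) :
    (T.extensions r hr j).card = (T.levelFinset r).card.multichoose j := by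
  classical
  rw [extensions, Finset.card_image_of_injOn (extend_injOn hr hT j), card_piAntidiag_nat]

section extensions

variable {T S : PlanarTree} {r j : ℕ} {hr : 1 ≤ r}

theorem HeightLE.of_mem_extensions (hT : T.HeightLE r) (hS : S ∈ T.extensions r hr j) :
    S.HeightLE (r + 1) := by
  obtain ⟨f, -, rfl⟩ := mem_extensions.1 hS
  exact hT.extend hr f

theorem HeightLE.rootBall_of_mem_extensions (hT : T.HeightLE r) (hS : S ∈ T.extensions r hr j) :
    S.rootBall r = T.verts := by
  obtain ⟨f, hf, rfl⟩ := mem_extensions.1 hS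
  exact rootBall_extend hr hT (Finset.mem_piAntidiag.1 hf).2

theorem HeightLE.card_levelFinset_of_mem_extensions (hT : T.HeightLE r)
    (hS : S ∈ T.extensions r hr j) : (S.levelFinset (r + 1)).card = j := by
  obtain ⟨f, hf, rfl⟩ := mem_extensions.1 hS
  rw [hT.card_levelFinset_extend hr f]
  exact (Finset.mem_piAntidiag.1 hf).1

theorem HeightLE.size_of_mem_extensions (hT : T.HeightLE r)
    (hS : S ∈ T.extensions r hr j) : S.size.toNat = T.size.toNat + j := by
  obtain ⟨f, hf, rfl⟩ := mem_extensions.1 hS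
  obtain ⟨a, ha, -⟩ := hT.exists_size
  rw [hT.size_extend hr f, (Finset.mem_piAntidiag.1 hf).1, ha, ENat.toNat_natCast]
  exact ENat.toNat_natCast (a + j)

theorem HeightLE.sum_extensions_ballVolume (hT : T.HeightLE r) (μ : ℝ) (hr : 1 ≤ r) (j : ℕ) :
    ∑ S ∈ T.extensions r hr j, ballVolume μ (r + 1) S =
      2 * Real.exp (-μ * r) / 4 ^ T.size.toNat *
        (((T.levelFinset r).card.multichoose j : ℝ) * (1 / 2) ^ j * volumeFactor μ j) := by
  have h : ∀ S ∈ T.extensions r hr j, ballVolume μ (r + 1) S =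
      Real.exp (-μ * r) / 4 ^ (T.size.toNat + j) * 2 ^ (j + 1) * volumeFactor μ j := by
    intro S hS
    rw [ballVolume, hT.card_levelFinset_of_mem_extensions hS, hT.size_of_mem_extensions hS]
    push_cast
    rw [add_sub_cancel_right]
  rw [Finset.sum_congr rfl h, Finset.sum_const, card_extensions hr hT, nsmul_eq_mul]
  have h4 : (4 : ℝ) ^ j = 2 ^ j * 2 ^ j := by rw [← mul_pow]; norm_num
  rw [pow_add, pow_succ, h4, one_div, inv_pow]
  field_simp

/-- Conservation of mass from one depth to the next: nothing is lost to unbounded numbers of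
children. -/
theorem HeightLE.hasSum_extensions_ballVolume (hT : T.HeightLE r) {μ : ℝ} (hμ : 0 < μ)
    (hr : 1 ≤ r) :
    HasSum (fun j => ∑ S ∈ T.extensions r hr j, ballVolume μ (r + 1) S) (ballVolume μ r T) := by
  simp only [hT.sum_extensions_ballVolume]
  have h := (hasSum_multichoose_mul_volumeFactor hμ (T.levelFinset r).card).mul_left
    (2 * Real.exp (-μ * r) / 4 ^ T.size.toNat)
  convert! h using 1
  have he : Real.exp (-μ * ((r : ℝ) - 1)) = Real.exp (-μ * r) * Real.exp μ := by
    rw [← Real.exp_add]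
    congr 1
    ring
  rw [ballVolume, he, pow_succ]
  ring

end extensions

theorem eq_of_mem_extensions {T T' S : PlanarTree} {r j j' : ℕ} {hr : 1 ≤ r}
    (hT : T.HeightLE r) (hT' : T'.HeightLE r) (hS : S ∈ T.extensions r hr j)
    (hS' : S ∈ T'.extensions r hr j') : T = T' ∧ j = j' :=
  ⟨PlanarTree.ext ((hT.rootBall_of_mem_extensions hS).symm.trans
      (hT'.rootBall_of_mem_extensions hS')),
    (hT.card_levelFinset_of_mem_extensions hS).symm.trans
      (hT'.card_levelFinset_of_mem_extensions hS')⟩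

open Classical in
theorem sum_biUnion_extensions (F : Finset PlanarTree) {r : ℕ} (hr : 1 ≤ r)
    (hF : ∀ T ∈ F, T.HeightLE r) (J : Finset ℕ) (g : PlanarTree → ℝ) :
    ∑ S ∈ (F ×ˢ J).biUnion (fun p => p.1.extensions r hr p.2), g S =
      ∑ j ∈ J, ∑ T ∈ F, ∑ S ∈ T.extensions r hr j, g S := by
  rw [Finset.sum_biUnion, Finset.sum_product_right]
  intro p hp q hq hpq
  refine Finset.disjoint_left.2 fun S hS hS' => hpq ?_
  have hp' := Finset.mem_product.1 (Finset.mem_coe.1 hp)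
  have hq' := Finset.mem_product.1 (Finset.mem_coe.1 hq)
  obtain ⟨h1, h2⟩ := eq_of_mem_extensions (hF _ hp'.1) (hF _ hq'.1) hS hS'
  exact Prod.ext h1 h2

theorem ballVolume_path_one (μ : ℝ) : ballVolume μ 1 (path 1 le_rfl) = 1 := by
  have h : (path 1 le_rfl).size = 1 := path_mem 1 le_rfl
  rw [ballVolume, card_levelFinset_path_one, h, volumeFactor_one]
  norm_num

/-- At depth one there is a single ball, of volume `1`. Passing to extensions preserves the sum, and
strictness of the inequality leaves room to truncate the series over `j` without changing `ε`. -/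
theorem exists_finset_lt_sum_ballVolume {μ : ℝ} (hμ : 0 < μ) {r : ℕ} (hr : 1 ≤ r) :
    ∀ {ε : ℝ}, 0 < ε → ∃ F : Finset PlanarTree, (∀ T ∈ F, T.HeightLE r) ∧
      1 - ε < ∑ T ∈ F, ballVolume μ r T := by
  classical
  induction r, hr using Nat.le_induction with
  | base =>
    intro ε hε
    refine ⟨{path 1 le_rfl}, fun T hT => ?_, ?_⟩
    · rw [Finset.mem_singleton.1 hT]
      exact path_one_heightLE
    · rw [Finset.sum_singleton, ballVolume_path_one]
      linarith
  | succ r hr ih =>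
    intro ε hε
    obtain ⟨F, hF, hsum⟩ := ih hε
    have h : HasSum (fun j => ∑ T ∈ F, ∑ S ∈ T.extensions r hr j, ballVolume μ (r + 1) S)
        (∑ T ∈ F, ballVolume μ r T) :=
      hasSum_sum fun T hT => (hF T hT).hasSum_extensions_ballVolume hμ hr
    obtain ⟨J, hJ⟩ := (h.tendsto_sum_nat.eventually (lt_mem_nhds hsum)).exists
    refine ⟨(F ×ˢ Finset.range J).biUnion (fun p => p.1.extensions r hr p.2), fun S hS => ?_, ?_⟩
    · obtain ⟨p, hp, hS⟩ := Finset.mem_biUnion.1 hS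
      exact (hF _ (Finset.mem_product.1 hp).1).of_mem_extensions hS
    · rwa [sum_biUnion_extensions F hr hF]

/-! ### Topology of the space of trees. -/

theorem isClopen_closedBall (T : PlanarTree) {r : ℕ} (hr : 1 ≤ r) :
    IsClopen (Metric.closedBall T (1 / (r : ℝ))) := by
  refine ⟨Metric.isClosed_closedBall, Metric.isOpen_iff.2 fun T' hT' => ?_⟩
  refine ⟨1 / (r : ℝ), by positivity, Metric.ball_subset_closedBall.trans ?_⟩
  rw [closedBall_eq _ hr] at hT' ⊢
  rw [closedBall_eq _ hr]
  exact fun S hS => Eq.trans hS hT'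

theorem measurableSet_closedBall (T : PlanarTree) (r : ℕ) :
    MeasurableSet (Metric.closedBall T (1 / (r : ℝ))) :=
  Metric.isClosed_closedBall.measurableSet

theorem HeightLE.disjoint_closedBall {T T' : PlanarTree} {r : ℕ} (hr : 1 ≤ r)
    (hT : T.HeightLE r) (hT' : T'.HeightLE r) (hne : T ≠ T') :
    Disjoint (Metric.closedBall T (1 / (r : ℝ))) (Metric.closedBall T' (1 / (r : ℝ))) := by
  rw [hT.closedBall_eq hr, hT'.closedBall_eq hr]
  exact Set.disjoint_left.2 fun S hS hS' => hne (PlanarTree.ext (Eq.trans (Eq.symm hS) hS'))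

theorem measureReal_biUnion_closedBall (ν : Measure PlanarTree) [IsFiniteMeasure ν]
    (F : Finset PlanarTree) {r : ℕ} (hr : 1 ≤ r) (hF : ∀ T ∈ F, T.HeightLE r) :
    ν.real (⋃ T ∈ F, Metric.closedBall T (1 / (r : ℝ))) =
      ∑ T ∈ F, ν.real (Metric.closedBall T (1 / (r : ℝ))) :=
  measureReal_biUnion_finset
    (fun T hT T' hT' hne => (hF T hT).disjoint_closedBall hr (hF T' hT') hne)
    fun T _ => measurableSet_closedBall T r

theorem trunc_closedBall (T : PlanarTree) {r : ℕ} (hr : 1 ≤ r) :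
    Metric.closedBall (T.trunc r hr) (1 / (r : ℝ)) = Metric.closedBall T (1 / (r : ℝ)) := by
  rw [(T.trunc_heightLE hr).closedBall_eq hr, closedBall_eq T hr]
  rfl

/-- In a fast Cauchy sequence membership of a word `w` is settled from index `|w|` on, so the limit
tree reads it off there. -/
instance : CompleteSpace PlanarTree := by
  refine Metric.complete_of_convergent_controlled_sequences (fun n => 1 / ((n : ℝ) + 1))
    (fun n => by positivity) fun u hu => ?_
  have key : ∀ n (w : List ℕ), w.length ≤ n → (w ∈ (u n).verts ↔ w ∈ (u w.length).verts) := by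
    intro n w hw
    have h := (hu w.length n w.length hw le_rfl).le
    have h' : u n ∈ Metric.closedBall (u w.length) (1 / ((w.length + 1 : ℕ) : ℝ)) := by
      rw [Metric.mem_closedBall]
      exact_mod_cast h
    rw [closedBall_eq _ (by omega)] at h'
    have := Set.ext_iff.1 h' w
    simpa only [mem_rootBall, Nat.le_succ, and_true] using this
  let T : PlanarTree :=
    { verts := {w | w ∈ (u w.length).verts}
      root_mem := (u 0).root_mem
      singleton_mem_iff := (u 1).singleton_mem_iff
      parent_mem := fun w n h => by
        refine (key (w ++ [n]).length w (by simp)).1 ((u _).parent_mem w n h)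
      sibling_mem := fun w m n hmn h => by
        have := (u (w ++ [n]).length).sibling_mem w m n hmn h
        exact (key _ _ (by simp)).1 this
      locally_finite := fun w => by
        refine ((u (w.length + 1)).locally_finite w).subset fun n h => ?_
        exact (key _ _ (by simp)).2 h }
  refine ⟨T, Metric.tendsto_atTop.2 fun ε hε => ?_⟩
  obtain ⟨N, hN⟩ := exists_nat_one_div_lt hε
  refine ⟨N + 1, fun n hn => lt_of_le_of_lt ?_ hN⟩
  have h : (u n).rootBall (N + 1) = T.rootBall (N + 1) := by
    ext w
    simp only [mem_rootBall]
    exact and_congr_left fun hw => key n w (hw.trans hn)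
  exact_mod_cast dist_le_of_rootBall_eq (by omega) h

/-- The closed balls of radius `1/r` around trees of height at most `r`. -/
def cylinders : Set (Set PlanarTree) :=
  {s | ∃ (r : ℕ) (T : PlanarTree), 1 ≤ r ∧ T.HeightLE r ∧ s = Metric.closedBall T (1 / (r : ℝ))}

theorem isTopologicalBasis_cylinders : TopologicalSpace.IsTopologicalBasis cylinders := by
  refine TopologicalSpace.isTopologicalBasis_of_isOpen_of_nhds ?_ fun T U hT hU => ?_
  · rintro _ ⟨r, T, hr, -, rfl⟩
    exact (isClopen_closedBall T hr).isOpen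
  · obtain ⟨ε, hε, hsub⟩ := Metric.isOpen_iff.1 hU T hT
    obtain ⟨n, hn⟩ := exists_nat_one_div_lt hε
    refine ⟨_, ⟨n + 1, T.trunc (n + 1) (by omega), by omega, T.trunc_heightLE _, rfl⟩, ?_, ?_⟩
    · rw [trunc_closedBall]
      exact Metric.mem_closedBall_self (by positivity)
    · rw [trunc_closedBall]
      refine (Metric.closedBall_subset_ball ?_).trans hsub
      exact_mod_cast hn

theorem countable_cylinders : cylinders.Countable := by
  have hfin : {T : PlanarTree | T.verts.Finite}.Countable := by
    have h : {s : Set (List ℕ) | s.Finite}.Countable := by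
      simpa using Set.countable_ofPred_finite_subset (Set.countable_univ (α := List ℕ))
    exact h.preimage_of_injOn (f := verts) fun T _ T' _ h => PlanarTree.ext h
  refine (Set.countable_iUnion fun r : ℕ =>
    hfin.image fun T => Metric.closedBall T (1 / (r : ℝ))).mono ?_
  rintro _ ⟨r, T, -, hT, rfl⟩
  exact Set.mem_iUnion.2 ⟨r, T, hT.verts_finite, rfl⟩

/-- The metric is ultrametric in nature: two balls that meet are nested. -/
theorem isPiSystem_cylinders : IsPiSystem cylinders := by
  have key : ∀ {r r' : ℕ} {T T' : PlanarTree}, 1 ≤ r → r ≤ r' →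
      (Metric.closedBall T (1 / (r : ℝ)) ∩ Metric.closedBall T' (1 / (r' : ℝ))).Nonempty →
      Metric.closedBall T' (1 / (r' : ℝ)) ⊆ Metric.closedBall T (1 / (r : ℝ)) := by
    intro r r' T T' hr hrr'
    rw [closedBall_eq T hr, closedBall_eq T' (hr.trans hrr')]
    rintro ⟨S, hS, hS'⟩ S' hS''
    exact (rootBall_eq_of_le hrr' (Eq.trans hS'' (Eq.symm hS'))).trans hS
  rintro _ ⟨r, T, hr, hT, rfl⟩ _ ⟨r', T', hr', hT', rfl⟩ hne
  rcases le_total r r' with h | h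
  · rw [Set.inter_eq_right.2 (key hr h hne)]
    exact ⟨r', T', hr', hT', rfl⟩
  · rw [Set.inter_comm] at hne
    rw [Set.inter_eq_left.2 (key hr' h hne)]
    exact ⟨r, T, hr, hT, rfl⟩

theorem probabilityMeasure_ext {ν ν' : ProbabilityMeasure PlanarTree}
    (h : ∀ (r : ℕ) (T : PlanarTree), 1 ≤ r → T.HeightLE r →
      (ν : Measure PlanarTree).real (Metric.closedBall T (1 / (r : ℝ))) =
        (ν' : Measure PlanarTree).real (Metric.closedBall T (1 / (r : ℝ)))) : ν = ν' := by
  have : SecondCountableTopology PlanarTree :=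
    isTopologicalBasis_cylinders.secondCountableTopology countable_cylinders
  refine ProbabilityMeasure.toMeasure_injective (ext_of_generate_finite cylinders
    isTopologicalBasis_cylinders.borel_eq_generateFrom isPiSystem_cylinders ?_ ?_)
  · rintro _ ⟨r, T, hr, hT, rfl⟩
    exact (measureReal_eq_measureReal_iff (measure_ne_top _ _) (measure_ne_top _ _)).1 (h r T hr hT)
  · exact (measure_univ (μ := (ν : Measure PlanarTree))).trans
      (measure_univ (μ := (ν' : Measure PlanarTree))).symm

/-! ### Uniqueness of the measure with the given volumes. -/

theorem HeightLE.height_eq {T : PlanarTree} {r : ℕ} (hT : T.HeightLE r)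
    (h : (T.levelFinset r).Nonempty) : T.height = r := by
  refine le_antisymm (height_le_iff.2 hT) ?_
  obtain ⟨u, hu⟩ := h
  rw [mem_levelFinset] at hu
  rw [← hu.2]
  exact le_iSup₂ (f := fun (u : List ℕ) (_ : u ∈ T.verts) => (u.length : ℕ∞)) u hu.1

theorem HeightLE.isFinite {T : PlanarTree} {r : ℕ} (hT : T.HeightLE r) : T.IsFinite := by
  obtain ⟨a, ha, -⟩ := hT.exists_size
  rw [size] at ha
  exact Set.finite_of_encard_eq_coe ha

theorem HasBallVolumes.real_closedBall_of_nonempty {μ : ℝ} {ν : ProbabilityMeasure PlanarTree}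
    (h : HasBallVolumes μ ν) {r : ℕ} (hr : 1 ≤ r) {T : PlanarTree} (hT : T.HeightLE r)
    (hne : (T.levelFinset r).Nonempty) :
    (ν : Measure PlanarTree).real (Metric.closedBall T (1 / (r : ℝ))) = ballVolume μ r T := by
  rw [h r T hr hT.isFinite (hT.height_eq hne), ncard_level]
  rfl

theorem ballVolume_of_not_nonempty (μ : ℝ) {r : ℕ} {T : PlanarTree}
    (h : ¬ (T.levelFinset r).Nonempty) : ballVolume μ r T = 0 := by
  rw [ballVolume, Finset.not_nonempty_iff_eq_empty.1 h]
  simp [volumeFactor]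

theorem hasBallVolumes_of_real_closedBall {μ : ℝ} {ν : ProbabilityMeasure PlanarTree}
    (h : ∀ (r : ℕ) (T : PlanarTree), 1 ≤ r → T.HeightLE r →
      (ν : Measure PlanarTree).real (Metric.closedBall T (1 / (r : ℝ))) = ballVolume μ r T) :
    HasBallVolumes μ ν := by
  intro r T hr _ hT
  rw [h r T hr (height_le_iff.1 hT.le), ncard_level]
  rfl

/-- The trees which agree with a given finite tree beyond the height of the latter are negligible. -/
theorem HasBallVolumes.real_closedBall_eq_zero {μ : ℝ} (hμ : 0 < μ)
    {ν : ProbabilityMeasure PlanarTree} (hν : HasBallVolumes μ ν) {h r : ℕ} (hh : 1 ≤ h)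
    (hhr : h < r) {T : PlanarTree} (hT : T.HeightLE h) (hne : (T.levelFinset h).Nonempty) :
    (ν : Measure PlanarTree).real (Metric.closedBall T (1 / (r : ℝ))) = 0 := by
  classical
  have hsum := hT.hasSum_extensions_ballVolume hμ hh
  have hzero : ∑ S ∈ T.extensions h hh 0, ballVolume μ (h + 1) S = 0 :=
    Finset.sum_eq_zero fun S hS => ballVolume_of_not_nonempty μ fun hS' =>
      hS'.card_ne_zero (hT.card_levelFinset_of_mem_extensions hS)
  -- The proper one-level extensions of `T` have balls inside the ball of radius `1/h`, disjoint
  -- from the one in question. By conservation of mass they exhaust it as `J` grows.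
  have key : ∀ J : ℕ, (ν : Measure PlanarTree).real (Metric.closedBall T (1 / (r : ℝ))) ≤
      ballVolume μ h T -
        ∑ j ∈ Finset.range J, ∑ S ∈ T.extensions h hh j, ballVolume μ (h + 1) S := by
    intro J
    -- `j = 0` is left out: it gives `T` itself, whose volume at radius `1/(h + 1)` is not
    -- prescribed. Its summand is zero anyway.
    set F := (({T} : Finset PlanarTree) ×ˢ (Finset.range J).erase 0).biUnion
      (fun p => p.1.extensions h hh p.2) with hF
    have hmem : ∀ S ∈ F, ∃ j, j ≠ 0 ∧ S ∈ T.extensions h hh j := by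
      intro S hS
      obtain ⟨⟨T', j⟩, hp, hS'⟩ := Finset.mem_biUnion.1 hS
      obtain ⟨hT', hj⟩ := Finset.mem_product.1 hp
      obtain rfl := Finset.mem_singleton.1 hT'
      exact ⟨j, Finset.ne_of_mem_erase hj, hS'⟩
    have hFh : ∀ S ∈ F, S.HeightLE (h + 1) := fun S hS => by
      obtain ⟨j, -, hS⟩ := hmem S hS
      exact hT.of_mem_extensions hS
    have hFne : ∀ S ∈ F, (S.levelFinset (h + 1)).Nonempty := fun S hS => by
      obtain ⟨j, hj, hS⟩ := hmem S hS
      rw [← Finset.card_ne_zero, hT.card_levelFinset_of_mem_extensions hS]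
      exact hj
    have hU : (ν : Measure PlanarTree).real (⋃ S ∈ F, Metric.closedBall S (1 / ((h + 1 : ℕ) : ℝ))) =
        ∑ j ∈ Finset.range J, ∑ S ∈ T.extensions h hh j, ballVolume μ (h + 1) S := by
      rw [measureReal_biUnion_closedBall _ F (by omega) hFh, Finset.sum_congr rfl fun S hS =>
        hν.real_closedBall_of_nonempty (by omega) (hFh S hS) (hFne S hS), hF,
        sum_biUnion_extensions {T} hh (by simpa using hT)]
      simp only [Finset.sum_singleton]
      exact Finset.sum_erase _ hzero
    have hdisj : Disjoint (Metric.closedBall T (1 / (r : ℝ)))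
        (⋃ S ∈ F, Metric.closedBall S (1 / ((h + 1 : ℕ) : ℝ))) := by
      rw [Set.disjoint_iUnion₂_right]
      intro S hS
      rw [closedBall_eq T (by omega), (hFh S hS).closedBall_eq (by omega)]
      refine Set.disjoint_left.2 fun T' h1 h2 => ?_
      obtain ⟨u, hu⟩ := hFne S hS
      rw [mem_levelFinset] at hu
      have hu' : u ∈ T'.rootBall (h + 1) := by
        rw [show T'.rootBall (h + 1) = S.verts from h2]
        exact hu.1
      rw [rootBall_eq_of_le (by omega : h + 1 ≤ r) h1] at hu'
      have := hT u hu'.1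
      omega
    have hsub : Metric.closedBall T (1 / (r : ℝ)) ∪
        (⋃ S ∈ F, Metric.closedBall S (1 / ((h + 1 : ℕ) : ℝ))) ⊆
          Metric.closedBall T (1 / (h : ℝ)) := by
      rw [closedBall_eq T hh, closedBall_eq T (by omega)]
      refine Set.union_subset (fun S hS => rootBall_eq_of_le hhr.le hS)
        (Set.iUnion₂_subset fun S hS => ?_)
      rw [closedBall_eq S (by omega)]
      obtain ⟨j, -, hS⟩ := hmem S hS
      intro T' hT'
      exact (rootBall_eq_of_le (by omega) hT').trans
        ((hT.rootBall_of_mem_extensions hS).trans hT.rootBall_eq.symm)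
    have hle := measureReal_mono (μ := (ν : Measure PlanarTree)) hsub
    rw [measureReal_union hdisj
      (F.measurableSet_biUnion fun S _ => measurableSet_closedBall S (h + 1))
      (measure_ne_top _ _) (measure_ne_top _ _), hU,
      hν.real_closedBall_of_nonempty hh hT hne] at hle
    linarith
  have hlim := hsum.tendsto_sum_nat.const_sub (ballVolume μ h T)
  rw [sub_self] at hlim
  exact le_antisymm (ge_of_tendsto' hlim key) measureReal_nonneg

/-- The prescribed volumes concern only trees of height exactly `r`. For a lower tree the formula
gives zero, and the ball is null by comparison at its true height. -/
theorem HasBallVolumes.real_closedBall {μ : ℝ} (hμ : 0 < μ)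
    {ν : ProbabilityMeasure PlanarTree} (hν : HasBallVolumes μ ν) {r : ℕ} (hr : 1 ≤ r)
    {T : PlanarTree} (hT : T.HeightLE r) :
    (ν : Measure PlanarTree).real (Metric.closedBall T (1 / (r : ℝ))) = ballVolume μ r T := by
  by_cases hne : (T.levelFinset r).Nonempty
  · exact hν.real_closedBall_of_nonempty hr hT hne
  · rw [ballVolume_of_not_nonempty μ hne]
    classical
    have hex : ∃ h, T.HeightLE h := ⟨r, hT⟩
    have hmin := Nat.find_spec hex
    have hle : Nat.find hex ≤ r := Nat.find_min' hex hT
    have h1 : 1 ≤ Nat.find hex := hmin [0] ((T.singleton_mem_iff 0).2 rfl)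
    have hne' : (T.levelFinset (Nat.find hex)).Nonempty := by
      by_contra hemp
      refine Nat.find_min hex (m := Nat.find hex - 1) (by omega) fun u hu => ?_
      have h2 := hmin u hu
      have h3 : u.length ≠ Nat.find hex := fun h =>
        hemp ⟨u, mem_levelFinset.2 ⟨hu, h⟩⟩
      omega
    have hlt : Nat.find hex < r := lt_of_le_of_ne hle fun h => hne (h ▸ hne')
    exact hν.real_closedBall_eq_zero hμ h1 hlt hmin hne'

theorem HasBallVolumes.unique {μ : ℝ} (hμ : 0 < μ) {ν ν' : ProbabilityMeasure PlanarTree}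
    (hν : HasBallVolumes μ ν) (hν' : HasBallVolumes μ ν') : ν = ν' :=
  probabilityMeasure_ext fun _ _ hr hT =>
    (hν.real_closedBall hμ hr hT).trans (hν'.real_closedBall hμ hr hT).symm

/-! ### Tightness and convergence. -/

theorem nu_compl_eq_zero (μ : ℝ) (N : ℕ+) {U : Set PlanarTree} (hU : MeasurableSet U)
    (h : ∀ T ∈ treeFinset N, T ∈ U) : (nu μ N : Measure PlanarTree) Uᶜ = 0 := by
  change gibbsMeasure μ N Uᶜ = 0
  simp only [gibbsMeasure, Measure.coe_finsetSum, Finset.sum_apply, Measure.smul_apply,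
    smul_eq_mul]
  refine Finset.sum_eq_zero fun T hT => ?_
  rw [Measure.dirac_apply' _ hU.compl, Set.indicator_of_notMem (Set.notMem_compl_iff.2 (h T hT)),
    mul_zero]

/-- For large `N`, finitely many balls with limiting volume above `1 - ε` suffice; for the finitely
many remaining `N`, all trees of these sizes are added as centres. -/
theorem exists_finset_nu_compl_le {μ : ℝ} (hμ : 0 < μ) {r : ℕ} (hr : 1 ≤ r) {ε : ℝ}
    (hε : 0 < ε) : ∃ F : Finset PlanarTree, ∀ N : ℕ+,
      (nu μ N : Measure PlanarTree).real (⋃ T ∈ F, Metric.closedBall T (1 / (r : ℝ)))ᶜ ≤ ε := by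
  classical
  obtain ⟨F₀, hF₀, hsum⟩ := exists_finset_lt_sum_ballVolume hμ hr hε
  have hlim := tendsto_finsetSum F₀ fun T hT => tendsto_nu_real_closedBall hμ hr (hF₀ T hT)
  obtain ⟨N₀, hN₀⟩ := eventually_atTop.1 (hlim.eventually (lt_mem_nhds hsum))
  set F := F₀ ∪ (Finset.Iic N₀).biUnion fun N => treeFinset N with hF
  have hmeas : MeasurableSet (⋃ T ∈ F, Metric.closedBall T (1 / (r : ℝ))) :=
    F.measurableSet_biUnion fun T _ => measurableSet_closedBall T r
  refine ⟨F, fun N => ?_⟩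
  rcases le_total N N₀ with hN | hN
  · rw [measureReal_def, nu_compl_eq_zero μ N hmeas fun T hT => ?_]
    · simpa using hε.le
    · refine Set.mem_iUnion₂.2 ⟨T, ?_, Metric.mem_closedBall_self (by positivity)⟩
      exact Finset.mem_union_right _ (Finset.mem_biUnion.2 ⟨N, Finset.mem_Iic.2 hN, hT⟩)
  · have h1 := hN₀ N hN
    rw [← measureReal_biUnion_closedBall _ F₀ hr hF₀] at h1
    have hsub : (⋃ T ∈ F₀, Metric.closedBall T (1 / (r : ℝ))) ⊆
        ⋃ T ∈ F, Metric.closedBall T (1 / (r : ℝ)) :=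
      Set.biUnion_subset_biUnion_left fun T hT => Finset.mem_union_left _ hT
    have h2 := measureReal_mono (μ := (nu μ N : Measure PlanarTree)) hsub (measure_ne_top _ _)
    rw [measureReal_compl hmeas, probReal_univ]
    linarith

/-- Intersecting over all depths the finite unions of balls with errors summing to less than `ε`
gives a closed, totally bounded set, which is compact by completeness. -/
theorem isTightMeasureSet_range_nu {μ : ℝ} (hμ : 0 < μ) :
    IsTightMeasureSet {(ν : Measure PlanarTree) | ν ∈ Set.range (nu μ)} := by
  rw [isTightMeasureSet_iff_exists_isCompact_measure_compl_le]
  intro ε hε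
  obtain ⟨δ, hδ, hsum⟩ := ENNReal.exists_pos_sum_of_countable hε.ne' ℕ
  choose F hF using fun r : ℕ =>
    exists_finset_nu_compl_le hμ (Nat.le_add_left 1 r) (NNReal.coe_pos.2 (hδ r))
  refine ⟨⋂ r : ℕ, ⋃ T ∈ F r, Metric.closedBall T (1 / ((r + 1 : ℕ) : ℝ)), ?_, ?_⟩
  · refine TotallyBounded.isCompact_of_isClosed ?_ ?_
    · refine Metric.totallyBounded_iff.2 fun a ha => ?_
      obtain ⟨n, hn⟩ := exists_nat_one_div_lt ha
      refine ⟨F n, (F n).finite_toSet, (Set.iInter_subset _ n).trans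
        (Set.iUnion₂_mono fun T _ => Metric.closedBall_subset_ball ?_)⟩
      exact_mod_cast hn
    · exact isClosed_iInter fun r =>
        (F r).finite_toSet.isClosed_biUnion fun T _ => Metric.isClosed_closedBall
  · rintro _ ⟨_, ⟨N, rfl⟩, rfl⟩
    rw [Set.compl_iInter]
    refine (measure_iUnion_le _).trans ((ENNReal.tsum_le_tsum fun r => ?_).trans hsum.le)
    rw [← ofReal_measureReal (measure_ne_top _ _), ← ENNReal.ofReal_coe_nnreal]
    exact ENNReal.ofReal_le_ofReal (hF r N)

/-- Balls are clopen, so weak convergence along an ultrafilter carries their masses to the limit,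
where they agree with the limits already computed. -/
theorem hasBallVolumes_of_mapClusterPt {μ : ℝ} (hμ : 0 < μ) {ν : ProbabilityMeasure PlanarTree}
    (h : MapClusterPt ν atTop (nu μ)) : HasBallVolumes μ ν := by
  obtain ⟨U, hU, hlim⟩ := mapClusterPt_iff_ultrafilter.1 h
  refine hasBallVolumes_of_real_closedBall fun r T hr hT => ?_
  have h1 := (NNReal.continuous_coe.tendsto _).comp
    (ProbabilityMeasure.tendsto_measure_of_isClopen_of_tendsto hlim (isClopen_closedBall T hr))
  exact tendsto_nhds_unique h1 ((tendsto_nu_real_closedBall hμ hr hT).mono_left hU)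

end PlanarTree

theorem mainTheorem1 (μ : ℝ) (hμ : 0 < μ) :
    ∃ ν : ProbabilityMeasure PlanarTree,
      Tendsto (PlanarTree.nu μ) atTop (𝓝 ν) ∧
      PlanarTree.HasBallVolumes μ ν ∧
      ∀ ν' : ProbabilityMeasure PlanarTree, PlanarTree.HasBallVolumes μ ν' → ν' = ν := by
  have hcomp := isCompact_closure_of_isTightMeasureSet (PlanarTree.isTightMeasureSet_range_nu hμ)
  have hmem : ∀ N, PlanarTree.nu μ N ∈ closure (Set.range (PlanarTree.nu μ)) :=
    fun N => subset_closure ⟨N, rfl⟩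
  obtain ⟨ν, -, hν⟩ := hcomp.exists_mapClusterPt (f := atTop) (u := PlanarTree.nu μ)
    (tendsto_principal.2 (Eventually.of_forall hmem))
  have hvol := PlanarTree.hasBallVolumes_of_mapClusterPt hμ hν
  refine ⟨ν, ?_, hvol, fun ν' h => h.unique hμ hvol⟩
  exact hcomp.tendsto_nhds_of_unique_mapClusterPt (Eventually.of_forall hmem) fun ν' _ h =>
    (PlanarTree.hasBallVolumes_of_mapClusterPt hμ h).unique hμ hvol
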